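/- Let $\mathbb D=\{z\in\mathbb C:|z|<1\}$ and $dA=\frac{dx\,dy}{\pi}$. A radial weight is a non-negative $\omega\in L^1(\mathbb D)$ with $\omega(z)=\omega(|z|)$ and $\widehat\omega(z)=\int_{|z|}^1\omega(s)\,ds>0$ for all $z\in\mathbb D$. The class $\mathcal D$ consists of the radial weights $\omega$ for which there are constants $C\ge 1$, $K>1$ and $C'>1$ such that $\widehat\omega(r)\le C\,\widehat\omega\left(\frac{1+r}{2}\right)$ and $\widehat\omega(r)\ge C'\,\widehat\omega\left(1-\frac{1-r}{K}\right)$ for all $0\le r<1$. For $0<p<\infty$, $A^p_\omega$ is the space of analytic functions $g$ on $\mathbb D$ with $\|g\|_{A^p_\omega}^p=\int_{\mathbb D}|g|^p\omega\,dA<\infty$. For analytic $f$ on $\mathbb D$ let $$h^\nu_f(g)(z)=\int_{\mathbb D}f(\zeta)\overline{g(\zeta)B^\nu_z(\zeta)}\,\nu(\zeta)\,dA(\zeta),\qquad z\in\mathbb D,$$ where $B^\nu_z$ is the reproducing kernel of $A^2_\nu$ at $z$. The formula is used for $g$ in the space $H^\infty$ of bounded analytic functions, which is dense in $A^p_\omega$;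 that $h^\nu_f:A^p_\omega\to A^q_\nu$ is bounded means that $h^\nu_f$ extends from $H^\infty$ to a bounded conjugate-linear operator from $A^p_\omega$ to $A^q_\nu$, and $\|h^\nu_f\|_{A^p_\omega\to A^q_\nu}$ is the least constant $C$ such that $\|h^\nu_f(g)\|_{A^q_\nu}\le C\|g\|_{A^p_\omega}$ for all $g\in A^p_\omega$ (and $\infty$ if $h^\nu_f$ is not bounded). **Theorem.** Let $0<q<1$, $0<p\le 1$ and $\omega,\nu\in\mathcal D$. Then there exists $N=N(\omega,\nu,p,q)\in\mathbb N$ such that the following hold for every analytic function $f$ on $\mathbb D$ with $\int_{\mathbb D}|f(z)|\left(\log\frac{e}{1-|z|}\right)\nu(z)\,dA(z)<\infty$. The operator $h^\nu_f:A^p_\omega\to A^q_\nu$ is bounded if and only if $$\sup_{z\in\mathbb D}|f^{(n)}(z)|(1-|z|)^n\frac{\widehat\nu(z)(1-|z|)}{\left(\widehat\omega(z)(1-|z|)\right)^{1/p}}<\infty$$ for some (equivalently, for all) $n\ge N$. Moreover, for each fixed $n\ge N$, $$\|h^\nu_f\|_{A^p_\omega\to A^q_\nu}\asymp\sup_{z\in\mathbb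 D}|f^{(n)}(z)|(1-|z|)^n\frac{\widehat\nu(z)(1-|z|)}{\left(\widehat\omega(z)(1-|z|)\right)^{1/p}}+\sum_{j=0}^{n-1}|f^{(j)}(0)|,$$ where the constants of comparison are positive and finite and depend only on $\omega,\nu,p,q$ and $n$, not on $f$. -/

import Mathlib

open MeasureTheory Metric Set
open scoped ENNReal NNReal ComplexConjugate

noncomputable section

/-- The unit disc `{z : |z| < 1}`. -/
abbrev unitDisc : Set ℂ := ball (0 : ℂ) 1

/-- The tail integral `∫_r^1 ω(s) ds` of a radial function. -/
def tailIntegral (ω : ℂ → ℝ) (r : ℝ) : ℝ := ∫ s in r..1, ω (s : ℂ)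

/-- Radial weights: non-negative integrable radial functions on the unit disc whose tail integrals
are all positive. (Since a non-integrable function has Bochner integral `0`, positivity at `r = 0`
includes the finiteness of `∫_0^1 ω(s) ds`, which membership in the doubling class below
forces anyway.) -/
structure IsRadialWeight (ω : ℂ → ℝ) : Prop where
  nonneg : ∀ z ∈ unitDisc, 0 ≤ ω z
  integrable : IntegrableOn ω unitDisc
  radial : ∀ z ∈ unitDisc, ω z = ω (‖z‖ : ℂ)
  tail_pos : ∀ r ∈ Ico (0 : ℝ) 1, 0 < tailIntegral ω r

/-- The doubling class of radial weights: upper doubling and reverse doubling of the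
tail integral. -/
structure IsDoublingWeight (ω : ℂ → ℝ) : Prop extends IsRadialWeight ω where
  upper : ∃ C : ℝ, 1 ≤ C ∧ ∀ r ∈ Ico (0 : ℝ) 1,
    tailIntegral ω r ≤ C * tailIntegral ω ((1 + r) / 2)
  lower : ∃ K C : ℝ, 1 < K ∧ 1 < C ∧ ∀ r ∈ Ico (0 : ℝ) 1,
    C * tailIntegral ω (1 - (1 - r) / K) ≤ tailIntegral ω r

/-- The measure `ω dA` on the unit disc, where `dA = dx dy / π`. -/
def weightedArea (ω : ℂ → ℝ) : Measure ℂ :=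
  ENNReal.ofReal (Real.pi⁻¹) •
    (volume.restrict unitDisc).withDensity (fun z => ENNReal.ofReal (ω z))

/-- The (quasi-)norm `(∫_𝔻 |f|^p ω dA)^(1/p)`, with values in `[0, ∞]`. -/
def bergmanNorm (p : ℝ) (ω : ℂ → ℝ) (f : ℂ → ℂ) : ℝ≥0∞ :=
  eLpNorm f (ENNReal.ofReal p) (weightedArea ω)

/-- The weighted Bergman space `A^p_ω` (for `0 < p < ∞`): the functions that are analytic in the
unit disc and belong to `L^p(ω dA)`. Values outside the disc are irrelevant. -/
def bergmanSpace (p : ℝ) (ω : ℂ → ℝ) : Submodule ℂ (ℂ → ℂ) where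
  carrier := {f | DifferentiableOn ℂ f unitDisc ∧
    MemLp f (ENNReal.ofReal p) (weightedArea ω)}
  add_mem' hf hg := ⟨hf.1.add hg.1, hf.2.add hg.2⟩
  zero_mem' := ⟨differentiableOn_const 0, MemLp.zero⟩
  smul_mem' c _ hf := ⟨hf.1.const_smul c, hf.2.const_smul c⟩

/-- The weight `ν_log(z) = log(e / (1 - |z|)) ν(z)`. -/
def logWeight (ν : ℂ → ℝ) (z : ℂ) : ℝ := Real.log (Real.exp 1 / (1 - ‖z‖)) * ν z

/-- The space `H^∞` of bounded analytic functions on the unit disc. -/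
def boundedAnalytic : Set (ℂ → ℂ) :=
  {g | DifferentiableOn ℂ g unitDisc ∧ ∃ M : ℝ, ∀ z ∈ unitDisc, ‖g z‖ ≤ M}

/-- `K` is the reproducing kernel of `A^2_ν` at `z`: it lies in `A^2_ν` and
`g(z) = ∫_𝔻 g conj(K) ν dA` for all `g ∈ A^2_ν`. -/
def IsBergmanKernelAt (ν : ℂ → ℝ) (z : ℂ) (K : ℂ → ℂ) : Prop :=
  K ∈ bergmanSpace 2 ν ∧
    ∀ g ∈ bergmanSpace 2 ν, g z = ∫ ζ, g ζ * conj (K ζ) ∂(weightedArea ν)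

open Classical in
/-- The reproducing kernel `B^ν_z` of `A^2_ν` (unique on the unit disc; for a radial weight and
`|z| < 1` it exists, the point evaluations being bounded on `A^2_ν`). -/
def bergmanKernel (ν : ℂ → ℝ) (z : ℂ) : ℂ → ℂ :=
  if h : ∃ K, IsBergmanKernelAt ν z K then h.choose else 0

/-- `h^ν_f(g)(z) = ∫_𝔻 f(ζ) conj(g(ζ) B^ν_z(ζ)) ν(ζ) dA(ζ)`; for `f ∈ A^1_ν` and `g ∈ H^∞`
the integral converges absolutely. -/
def smallHankel (ν : ℂ → ℝ) (f g : ℂ → ℂ) (z : ℂ) : ℂ :=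
  ∫ ζ, f ζ * conj (g ζ * bergmanKernel ν z ζ) ∂(weightedArea ν)

/-- The operator `h^ν_f`, which is given by its integral formula on the dense subspace `H^∞` of
`A^p_ω`, is bounded from `A^p_ω` to `A^q_ν` with constant `C`: it extends to a conjugate-linear
operator `T` on all of `A^p_ω` such that `‖T g‖ ≤ C ‖g‖`. -/
def HankelBoundedBy (p q : ℝ) (ω ν : ℂ → ℝ) (f : ℂ → ℂ) (C : ℝ≥0) : Prop :=
  ∃ T : bergmanSpace p ω →ₛₗ[starRingEnd ℂ] bergmanSpace q ν,
    (∀ g : bergmanSpace p ω, (g : ℂ → ℂ) ∈ boundedAnalytic →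
      ∀ z ∈ unitDisc, (T g : ℂ → ℂ) z = smallHankel ν f g z) ∧
    ∀ g : bergmanSpace p ω, bergmanNorm q ν (T g) ≤ C * bergmanNorm p ω g

/-- Boundedness of `h^ν_f : A^p_ω → A^q_ν`. -/
def HankelBounded (p q : ℝ) (ω ν : ℂ → ℝ) (f : ℂ → ℂ) : Prop :=
  ∃ C : ℝ≥0, HankelBoundedBy p q ω ν f C

/-- The operator norm of `h^ν_f : A^p_ω → A^q_ν`, equal to `∞` if the operator is unbounded. -/
def hankelNorm (p q : ℝ) (ω ν : ℂ → ℝ) (f : ℂ → ℂ) : ℝ≥0∞ :=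
  ⨅ (C : ℝ≥0) (_ : HankelBoundedBy p q ω ν f C), (C : ℝ≥0∞)

/-- `sup_{|z|<1} |f^{(n)}(z)| (1-|z|)^n · ν̂(z)(1-|z|) / (ω̂(z)(1-|z|))^{1/p}`,
with values in `[0, ∞]`. -/
def derivativeSup (p : ℝ) (ω ν : ℂ → ℝ) (n : ℕ) (f : ℂ → ℂ) : ℝ≥0∞ :=
  ⨆ z ∈ unitDisc, ENNReal.ofReal (‖iteratedDeriv n f z‖ * (1 - ‖z‖) ^ n *
    ((tailIntegral ν ‖z‖ * (1 - ‖z‖)) / (tailIntegral ω ‖z‖ * (1 - ‖z‖)) ^ (1 / p)))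

end

/-! Write `ν̂` for `tailIntegral ν` and `Λ_n(r) = (ω̂(r)(1-r))^{1/p} / (ν̂(r)(1-r)^{n+1})`, which is
`growthFactor`. The condition on the symbol says that `|f^{(n)}| ≲ Λ_n`. Both directions rest on the
size of the kernel `B_z(ζ) = Σ (z̄ζ)^m / ν_m`, where `ν_m = ∫ |ζ|^{2m} ν dA`.

Kernel. Doubling gives `ν_m ≍ ν̂(1 - 1/(m+1))`, and each difference in `m` gains a factor `1/(m+1)`.
Reciprocals inherit these symbol estimates. Repeated summation by parts from `m ≈ 1/|1-w|` on bounds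
the `n`-th derivative of `Σ w^m / ν_m`, and reverse doubling turns the bound into `(1-r)^β ν̂(r)⁻¹
|1-w|^{-(n+1+β)}` whenever `1-r ≤ |1-w|`, with a fixed `β > 0` (`norm_kernelSeries_le`).

Necessity. As `B_0` is constant, `h_f(g)(0)` is a multiple of `∫ f ḡ ν dA`, and evaluation at the
origin is bounded on `A^q_ν`. For the bounded function `g = ∂ⁿB_a/∂āⁿ` the pairing equals
`f^{(n)}(a)`. Hence `|f^{(n)}(a)| ≲ ‖h_f‖ ‖∂ⁿB_a/∂āⁿ‖_{A^p_ω}`, and the kernel estimate bounds the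
last norm by `Λ_n(|a|)` (`bergmanNorm_kernelDeriv_le`). The same functions with `a = 0` control
`f^{(j)}(0)` for `j < n`.

Sufficiency. The operator `D = 1 + ζ d/dζ` multiplies the `m`-th Taylor coefficient by `m+1`, and
passing from `ν` to `averageWeight ν` divides the `m`-th moment by `m+1`. With `ν_(n)` the `n`-th
iterate of the latter, `∫ f Ḡ ν dA = ∫ (Dⁿf) Ḡ ν_(n) dA` for bounded analytic `G`. So `h_f(g)` is
the integral of `H = (Dⁿf) ḡ` against the kernel with respect to `ν_(n) dA`. Three estimates finish
the argument. The condition on `f^{(n)}` and the values `f^{(j)}(0)` give `|Dⁿf| ≲ Λ_n`, since `Λ_n`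
is almost increasing. As `ν_(n)` has size `(1-r)^{n-1} ν̂(r)` near the boundary, the `L¹(ν_(n) dA)`
norm of `H` is at most an integral of `|g|` against `(ω̂(r)(1-r))^{1/p} (1-r)^{-2}`, and `A^p_ω`
embeds into that weighted `L¹` because `p ≤ 1`. Finally the kernel maps `L¹` into `A^q_ν`: the first
means of the image on `|z| = r` are `≲ ‖H‖₁ / ν̂(r)`, and `ν̂^{-q}` is integrable against `ν`
because `q < 1`. The formula makes sense for every `g` in `A^p_ω`, so it is itself the extension of
`h_f` and no density argument is needed.

Threshold. If `s` is an upper growth exponent of `ω̂` in the sense of `exists_exponent`, both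
directions work once `p(n+1) ≥ s+1`. -/

noncomputable section

/-! ### The radial part of a weight. -/

/-- The measure `2 r ω(r) dr` on `(0, 1)`: the radial part of `ω dA`. -/
def radialMeasure (ω : ℂ → ℝ) : Measure ℝ :=
  (volume.restrict (Ioo (0 : ℝ) 1)).withDensity fun r => ENNReal.ofReal (2 * r * ω (r : ℂ))

instance (ω : ℂ → ℝ) : SFinite (radialMeasure ω) := by
  unfold radialMeasure; infer_instance

namespace IsRadialWeight

variable {ω : ℂ → ℝ}

/-- The integral of a non-integrable function is 0 by convention, so positivity of the tail at 0
forces integrability. -/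
theorem intervalIntegrable (hω : IsRadialWeight ω) :
    IntervalIntegrable (fun s : ℝ => ω (s : ℂ)) volume 0 1 := by
  by_contra h
  have := hω.tail_pos 0 (by simp)
  simp [tailIntegral, intervalIntegral.integral_undef h] at this

theorem integrableOn_Ioo (hω : IsRadialWeight ω) {a : ℝ} (ha : 0 ≤ a) :
    IntegrableOn (fun s : ℝ => ω (s : ℂ)) (Ioo a 1) := by
  have h := (intervalIntegrable_iff_integrableOn_Ioo_of_le zero_le_one).1 hω.intervalIntegrable
  exact h.mono_set (Ioo_subset_Ioo_left ha)

theorem nonneg_ofReal (hω : IsRadialWeight ω) {r : ℝ} (h0 : 0 ≤ r) (h1 : r < 1) :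
    0 ≤ ω (r : ℂ) := by
  apply hω.nonneg
  simpa [abs_of_nonneg h0] using h1

theorem tailIntegral_eq_setIntegral {r : ℝ} (h1 : r ≤ 1) :
    tailIntegral ω r = ∫ s in Ioo r 1, ω (s : ℂ) := by
  rw [tailIntegral, intervalIntegral.integral_of_le h1, integral_Ioc_eq_integral_Ioo]

theorem tailIntegral_anti (hω : IsRadialWeight ω) {x y : ℝ} (hx : 0 ≤ x) (hxy : x ≤ y)
    (hy : y ≤ 1) : tailIntegral ω y ≤ tailIntegral ω x := by
  rw [tailIntegral_eq_setIntegral hy, tailIntegral_eq_setIntegral (hxy.trans hy)]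
  apply setIntegral_mono_set (hω.integrableOn_Ioo hx)
  · filter_upwards [ae_restrict_mem measurableSet_Ioo] with s hs
    exact hω.nonneg_ofReal (hx.trans hs.1.le) hs.2
  · exact (Ioo_subset_Ioo_left hxy).eventuallyLE

theorem ofReal_tailIntegral (hω : IsRadialWeight ω) {x : ℝ} (hx : 0 ≤ x) (h1 : x ≤ 1) :
    ENNReal.ofReal (tailIntegral ω x) = ∫⁻ s in Ioo x 1, ENNReal.ofReal (ω (s : ℂ)) := by
  rw [tailIntegral_eq_setIntegral h1, ofReal_integral_eq_lintegral_ofReal (hω.integrableOn_Ioo hx)]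
  filter_upwards [ae_restrict_mem measurableSet_Ioo] with s hs
  exact hω.nonneg_ofReal (hx.trans hs.1.le) hs.2

theorem aemeasurable_radial_density (hω : IsRadialWeight ω) :
    AEMeasurable (fun r : ℝ => ENNReal.ofReal (2 * r * ω (r : ℂ)))
      (volume.restrict (Ioo (0 : ℝ) 1)) := by
  have h := (hω.integrableOn_Ioo le_rfl).aestronglyMeasurable.aemeasurable
  exact ((by fun_prop : Measurable fun r : ℝ => 2 * r).aemeasurable.mul h).ennreal_ofReal

theorem lintegral_radialMeasure (hω : IsRadialWeight ω) {g : ℝ → ℝ≥0∞}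
    (hg : AEMeasurable g (volume.restrict (Ioo (0 : ℝ) 1))) :
    ∫⁻ r, g r ∂radialMeasure ω
      = ∫⁻ r in Ioo (0 : ℝ) 1, ENNReal.ofReal (2 * r * ω (r : ℂ)) * g r := by
  rw [radialMeasure, lintegral_withDensity_eq_lintegral_mul₀ hω.aemeasurable_radial_density hg]
  rfl

theorem radialMeasure_Ioo {x : ℝ} (hx : 0 ≤ x) :
    radialMeasure ω (Ioo x 1) = ∫⁻ r in Ioo x 1, ENNReal.ofReal (2 * r * ω (r : ℂ)) := by
  rw [radialMeasure, withDensity_apply _ measurableSet_Ioo, Measure.restrict_restrict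
    measurableSet_Ioo, Ioo_inter_Ioo]
  simp [hx]

theorem radialMeasure_Ioo_le (hω : IsRadialWeight ω) {x : ℝ} (hx : 0 ≤ x) (h1 : x ≤ 1) :
    radialMeasure ω (Ioo x 1) ≤ ENNReal.ofReal (2 * tailIntegral ω x) := by
  rw [radialMeasure_Ioo hx, ENNReal.ofReal_mul zero_le_two, hω.ofReal_tailIntegral hx h1,
    ← lintegral_const_mul' _ _ ENNReal.ofReal_ne_top]
  refine setLIntegral_mono' measurableSet_Ioo fun r hr => ?_
  rw [← ENNReal.ofReal_mul zero_le_two]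
  refine ENNReal.ofReal_le_ofReal ?_
  have := hω.nonneg_ofReal (hx.trans hr.1.le) hr.2
  nlinarith [hr.2, hr.1]

/-- The density `2 r ω(r)` dominates `ω(r)` only where `r ≥ 1/2`; doubling removes this restriction
in `IsDoublingWeight.radialMeasure_Ioo_ge`. -/
theorem le_radialMeasure_Ioo (hω : IsRadialWeight ω) {x : ℝ} (hx : 1 / 2 ≤ x) (h1 : x ≤ 1) :
    ENNReal.ofReal (tailIntegral ω x) ≤ radialMeasure ω (Ioo x 1) := by
  have h0 : 0 ≤ x := by linarith
  rw [radialMeasure_Ioo h0, hω.ofReal_tailIntegral h0 h1]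
  refine setLIntegral_mono' measurableSet_Ioo fun r hr => ENNReal.ofReal_le_ofReal ?_
  have := hω.nonneg_ofReal (h0.trans hr.1.le) hr.2
  nlinarith [hr.2, hr.1]

theorem radialMeasure_ae (ω : ℂ → ℝ) : ∀ᵐ r ∂radialMeasure ω, r ∈ Ioo (0 : ℝ) 1 :=
  (withDensity_absolutelyContinuous _ _).ae_le (ae_restrict_mem measurableSet_Ioo)

theorem isFiniteMeasure_radialMeasure (hω : IsRadialWeight ω) :
    IsFiniteMeasure (radialMeasure ω) := by
  constructor
  have h : radialMeasure ω univ = radialMeasure ω (Ioo 0 1) := by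
    refine (measure_congr ?_).symm
    filter_upwards [radialMeasure_ae ω] with r hr
    exact eq_true hr |>.trans (eq_true (mem_univ r)).symm
  rw [h]
  exact (hω.radialMeasure_Ioo_le le_rfl zero_le_one).trans_lt ENNReal.ofReal_lt_top

end IsRadialWeight

/-! ### Power growth and decay of the tail integrals. -/

namespace IsDoublingWeight

variable {ω : ℂ → ℝ}

/-- Iterated upper doubling. -/
theorem tailIntegral_dyadic (hω : IsDoublingWeight ω) {C : ℝ} (hC1 : 1 ≤ C)
    (hC : ∀ r ∈ Ico (0 : ℝ) 1, tailIntegral ω r ≤ C * tailIntegral ω ((1 + r) / 2))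
    {a : ℝ} (ha : a ∈ Ico (0 : ℝ) 1) (k : ℕ) :
    tailIntegral ω (max (1 - 2 ^ k * (1 - a)) 0) ≤ C ^ k * tailIntegral ω a := by
  have hR := hω.toIsRadialWeight
  have hC0 : 0 ≤ C := by linarith
  induction k with
  | zero => simp [ha.1]
  | succ k ih =>
    have hmem : max (1 - 2 ^ (k + 1) * (1 - a)) 0 ∈ Ico (0 : ℝ) 1 := by
      refine ⟨le_max_right _ _, max_lt ?_ one_pos⟩
      have : 0 < 2 ^ (k + 1) * (1 - a) := mul_pos (by positivity) (by linarith [ha.2])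
      linarith
    calc tailIntegral ω (max (1 - 2 ^ (k + 1) * (1 - a)) 0)
        ≤ C * tailIntegral ω ((1 + max (1 - 2 ^ (k + 1) * (1 - a)) 0) / 2) := hC _ hmem
      _ ≤ C * tailIntegral ω (max (1 - 2 ^ k * (1 - a)) 0) := by
          refine mul_le_mul_of_nonneg_left (hR.tailIntegral_anti (le_max_right _ _) ?_ ?_) hC0
          · refine max_le ?_ ?_
            · have := le_max_left (1 - 2 ^ (k + 1) * (1 - a)) 0
              rw [pow_succ] at this ⊢
              linarith
            · linarith [hmem.1]
          · linarith [hmem.2]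
      _ ≤ C * (C ^ k * tailIntegral ω a) := mul_le_mul_of_nonneg_left ih hC0
      _ = C ^ (k + 1) * tailIntegral ω a := by ring

/-- Upper doubling replaces `x` by `(1 + x) / 2 ≥ 1/2`, where the factor `2 r` of the density is
harmless. -/
theorem radialMeasure_Ioo_ge (hω : IsDoublingWeight ω) :
    ∃ C : ℝ, 1 ≤ C ∧ ∀ x ∈ Ico (0 : ℝ) 1,
      ENNReal.ofReal (tailIntegral ω x) ≤ ENNReal.ofReal C * radialMeasure ω (Ioo x 1) := by
  have hR := hω.toIsRadialWeight
  obtain ⟨C, hC1, hC⟩ := hω.upper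
  refine ⟨C, hC1, fun x hx => ?_⟩
  have hC0 : 0 ≤ C := by linarith
  calc ENNReal.ofReal (tailIntegral ω x) ≤ ENNReal.ofReal (C * tailIntegral ω ((1 + x) / 2)) :=
        ENNReal.ofReal_le_ofReal (hC x hx)
    _ = ENNReal.ofReal C * ENNReal.ofReal (tailIntegral ω ((1 + x) / 2)) :=
        ENNReal.ofReal_mul hC0
    _ ≤ ENNReal.ofReal C * radialMeasure ω (Ioo ((1 + x) / 2) 1) := by
        gcongr
        exact hR.le_radialMeasure_Ioo (by linarith [hx.1]) (by linarith [hx.2])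
    _ ≤ ENNReal.ofReal C * radialMeasure ω (Ioo x 1) := by
        gcongr
        linarith [hx.2]

/-- Upper power growth of the tail and the resulting integral estimate. -/
theorem exists_exponent (hω : IsDoublingWeight ω) :
    ∃ (s : ℕ) (C : ℝ), 1 ≤ s ∧ 1 ≤ C ∧
      (∀ x a : ℝ, 0 ≤ x → x ≤ a → a < 1 →
        tailIntegral ω x ≤ C * ((1 - x) / (1 - a)) ^ s * tailIntegral ω a) ∧
      ∀ a ∈ Ico (0 : ℝ) 1, ∫⁻ r, ENNReal.ofReal (((1 - a * r) ^ s)⁻¹) ∂radialMeasure ω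
        ≤ ENNReal.ofReal (C * tailIntegral ω a * ((1 - a) ^ s)⁻¹) := by
  have hR := hω.toIsRadialWeight
  obtain ⟨C, hC1, hC⟩ := hω.upper
  -- One exponent serves both claims: `C ≤ 2 ^ s` turns `k` doublings into the power `(2 ^ k) ^ s`,
  -- and `2 C < 2 ^ s` makes the ratio `C / 2 ^ s` of the later series at most `1/2`.
  obtain ⟨s, hs⟩ := pow_unbounded_of_one_lt (2 * C) one_lt_two
  have hC0 : 0 < C := by linarith
  have hs1 : 1 ≤ s := by
    rcases Nat.eq_zero_or_pos s with h | h
    · subst h; norm_num at hs; linarith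
    · exact h
  refine ⟨s, 4 * C, hs1, by linarith, fun x a hx hxa ha => ?_, fun a ha => ?_⟩
  · have ha' : 0 < 1 - a := by linarith
    obtain ⟨k, hk1, hk2⟩ := exists_nat_pow_near (x := (1 - x) / (1 - a)) (y := 2)
      ((one_le_div ha').2 (by linarith)) one_lt_two
    have hτ := hR.tail_pos a ⟨hx.trans hxa, ha⟩
    rw [div_lt_iff₀ ha'] at hk2
    calc tailIntegral ω x ≤ tailIntegral ω (max (1 - 2 ^ (k + 1) * (1 - a)) 0) :=
          hR.tailIntegral_anti (le_max_right _ _) (max_le (by linarith) hx) (by linarith)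
      _ ≤ C ^ (k + 1) * tailIntegral ω a :=
          hω.tailIntegral_dyadic hC1 hC ⟨hx.trans hxa, ha⟩ _
      _ ≤ 4 * C * ((1 - x) / (1 - a)) ^ s * tailIntegral ω a := by
          refine mul_le_mul_of_nonneg_right ?_ hτ.le
          calc C ^ (k + 1) = C * C ^ k := by ring
            _ ≤ C * (2 ^ s) ^ k := by gcongr; linarith
            _ = C * (2 ^ k) ^ s := by rw [← pow_mul, ← pow_mul, mul_comm s k]
            _ ≤ C * ((1 - x) / (1 - a)) ^ s := by gcongr
            _ ≤ 4 * C * ((1 - x) / (1 - a)) ^ s := by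
                have : 0 ≤ C * ((1 - x) / (1 - a)) ^ s := by
                  have : 0 ≤ (1 - x) / (1 - a) := div_nonneg (by linarith) ha'.le
                  positivity
                linarith
  · have ha' : 0 < 1 - a := by linarith [ha.2]
    have hτ := hR.tail_pos a ha
    -- Points at distance `2 ^ k (1 - a)` from 1, cut off at 0. The first `k` with `b (k + 1) < r`
    -- has `1 - a r ≥ 2 ^ k (1 - a)`. Indicators of the full intervals `(b (k + 1), 1)` suffice in
    -- place of disjoint shells.
    set b : ℕ → ℝ := fun k => max (1 - 2 ^ k * (1 - a)) 0 with hb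
    have hb1 : ∀ k, b k ∈ Ico (0 : ℝ) 1 := fun k => by
      refine ⟨le_max_right _ _, max_lt ?_ one_pos⟩
      have : 0 < 2 ^ k * (1 - a) := by positivity
      linarith
    have hpt : ∀ r ∈ Ioo (0 : ℝ) 1, ENNReal.ofReal (((1 - a * r) ^ s)⁻¹)
        ≤ ∑' k : ℕ, (Ioo (b (k + 1)) 1).indicator
            (fun _ => ENNReal.ofReal (((2 ^ k * (1 - a)) ^ s)⁻¹)) r := by
      intro r hr
      have har : 1 - a ≤ 1 - a * r ∧ 1 - r ≤ 1 - a * r := by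
        constructor <;> nlinarith [hr.1, hr.2, ha.1, ha.2]
      have hex : ∃ k : ℕ, b (k + 1) < r := by
        obtain ⟨k, hk⟩ := pow_unbounded_of_one_lt (1 / (1 - a)) one_lt_two
        refine ⟨k, max_lt ?_ hr.1⟩
        rw [div_lt_iff₀ ha'] at hk
        have : (2 : ℝ) ^ k * (1 - a) ≤ 2 ^ (k + 1) * (1 - a) := by
          gcongr
          · norm_num
          · omega
        linarith [hr.1]
      classical
      obtain ⟨k, hk, hmin⟩ : ∃ k, b (k + 1) < r ∧ ∀ j < k, ¬ b (j + 1) < r :=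
        ⟨Nat.find hex, Nat.find_spec hex, fun j hj => Nat.find_min hex hj⟩
      refine le_trans ?_ (ENNReal.le_tsum k)
      rw [indicator_of_mem (show r ∈ Ioo (b (k + 1)) 1 from ⟨hk, hr.2⟩)]
      refine ENNReal.ofReal_le_ofReal (inv_anti₀ (by positivity) ?_)
      refine pow_le_pow_left₀ (by positivity) ?_ s
      rcases k with _ | j
      · simpa using har.1
      · have := hmin j (by omega)
        have h2 : r ≤ 1 - 2 ^ (j + 1) * (1 - a) := by
          have h3 : r ≤ b (j + 1) := not_lt.1 this
          rcases le_max_iff.1 h3 with h | h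
          · exact h
          · linarith [hr.1]
        linarith [har.2]
    have hterm : ∀ k : ℕ, ENNReal.ofReal (((2 ^ k * (1 - a)) ^ s)⁻¹)
        * radialMeasure ω (Ioo (b (k + 1)) 1)
        ≤ ENNReal.ofReal (2 * C * tailIntegral ω a * ((1 - a) ^ s)⁻¹) *
          (2⁻¹ : ℝ≥0∞) ^ k := by
      intro k
      have h2 : (2⁻¹ : ℝ≥0∞) ^ k = ENNReal.ofReal ((1 / 2) ^ k) := by
        rw [ENNReal.ofReal_pow (by norm_num)]
        congr 1
        rw [one_div, ENNReal.ofReal_inv_of_pos two_pos]; simp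
      rw [h2, ← ENNReal.ofReal_mul (by positivity)]
      refine (mul_le_mul_right (hR.radialMeasure_Ioo_le (hb1 _).1 (hb1 _).2.le) _).trans ?_
      rw [← ENNReal.ofReal_mul (by positivity)]
      refine ENNReal.ofReal_le_ofReal ?_
      have h3 := hω.tailIntegral_dyadic hC1 hC ha (k + 1)
      calc ((2 ^ k * (1 - a)) ^ s)⁻¹ * (2 * tailIntegral ω (b (k + 1)))
          ≤ ((2 ^ k * (1 - a)) ^ s)⁻¹ * (2 * (C ^ (k + 1) * tailIntegral ω a)) := by gcongr
        _ = 2 * C * tailIntegral ω a * ((1 - a) ^ s)⁻¹ * (C / 2 ^ s) ^ k := by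
            rw [mul_pow, ← pow_mul, mul_comm k s, pow_mul, div_pow]
            field_simp
            ring
        _ ≤ 2 * C * tailIntegral ω a * ((1 - a) ^ s)⁻¹ * (1 / 2) ^ k := by
            refine mul_le_mul_of_nonneg_left (pow_le_pow_left₀ (by positivity) ?_ k)
              (by positivity)
            rw [div_le_div_iff₀ (by positivity) two_pos]
            linarith
    calc ∫⁻ r, ENNReal.ofReal (((1 - a * r) ^ s)⁻¹) ∂radialMeasure ω
        ≤ ∫⁻ r, ∑' k : ℕ, (Ioo (b (k + 1)) 1).indicator
            (fun _ => ENNReal.ofReal (((2 ^ k * (1 - a)) ^ s)⁻¹)) r ∂radialMeasure ω := by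
          refine lintegral_mono_ae ?_
          filter_upwards [IsRadialWeight.radialMeasure_ae ω] with r hr using hpt r hr
      _ = ∑' k : ℕ, ENNReal.ofReal (((2 ^ k * (1 - a)) ^ s)⁻¹)
            * radialMeasure ω (Ioo (b (k + 1)) 1) := by
          rw [lintegral_tsum fun k =>
            (measurable_const.indicator measurableSet_Ioo).aemeasurable]
          congr 1 with k
          rw [lintegral_indicator_const measurableSet_Ioo]
      _ ≤ ∑' k : ℕ, ENNReal.ofReal (2 * C * tailIntegral ω a * ((1 - a) ^ s)⁻¹) *
            (2⁻¹ : ℝ≥0∞) ^ k := ENNReal.tsum_le_tsum hterm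
      _ = ENNReal.ofReal (4 * C * tailIntegral ω a * ((1 - a) ^ s)⁻¹) := by
          rw [ENNReal.tsum_mul_left, ENNReal.tsum_geometric, ENNReal.one_sub_inv_two, inv_inv,
            ← ENNReal.ofReal_ofNat 2, ← ENNReal.ofReal_mul (by positivity)]
          congr 1; ring

/-- Lower power decay of the tail. -/
theorem exists_decay (hω : IsDoublingWeight ω) :
    ∃ β C : ℝ, 0 < β ∧ 1 ≤ C ∧ ∀ x y : ℝ, 0 ≤ x → x ≤ y → y < 1 →
      tailIntegral ω y ≤ C * ((1 - y) / (1 - x)) ^ β * tailIntegral ω x := by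
  have hR := hω.toIsRadialWeight
  obtain ⟨K, C, hK, hC, h⟩ := hω.lower
  have hK0 : 0 < K := by linarith
  have hC0 : 0 < C := by linarith
  -- The exponent is chosen so that `K ^ β = C`: dividing the distance to 1 by `K` divides the tail
  -- by at least `C`.
  have hβ : 0 < Real.log C / Real.log K := div_pos (Real.log_pos hC) (Real.log_pos hK)
  refine ⟨Real.log C / Real.log K, C, hβ, hC.le, fun x y hx hxy hy => ?_⟩
  have hx1 : 0 < 1 - x := by linarith
  have hy1 : 0 < 1 - y := by linarith
  have hiter : ∀ k : ℕ, C ^ k * tailIntegral ω (1 - (1 - x) / K ^ k) ≤ tailIntegral ω x := by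
    intro k
    induction k with
    | zero => simp
    | succ k ih =>
      have hKk : 1 ≤ K ^ k := one_le_pow₀ hK.le
      have hmem : 1 - (1 - x) / K ^ k ∈ Ico (0 : ℝ) 1 := by
        constructor
        · have : (1 - x) / K ^ k ≤ 1 := (div_le_one (by positivity)).2 (by linarith)
          linarith
        · have : 0 < (1 - x) / K ^ k := by positivity
          linarith
      have := h _ hmem
      have heq : 1 - (1 - (1 - (1 - x) / K ^ k)) / K = 1 - (1 - x) / K ^ (k + 1) := by
        rw [pow_succ]; field_simp; ring
      rw [heq] at this
      calc C ^ (k + 1) * tailIntegral ω (1 - (1 - x) / K ^ (k + 1))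
          = C ^ k * (C * tailIntegral ω (1 - (1 - x) / K ^ (k + 1))) := by ring
        _ ≤ C ^ k * tailIntegral ω (1 - (1 - x) / K ^ k) := by gcongr
        _ ≤ _ := ih
  obtain ⟨k, hk1, hk2⟩ := exists_nat_pow_near (x := (1 - x) / (1 - y)) (y := K)
      ((one_le_div hy1).2 (by linarith)) hK
  have hKk : 0 < K ^ k := by positivity
  have h1 : tailIntegral ω y ≤ tailIntegral ω (1 - (1 - x) / K ^ k) := by
    refine hR.tailIntegral_anti ?_ ?_ hy.le
    · have : (1 - x) / K ^ k ≤ 1 :=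
        (div_le_one (by positivity)).2 (by linarith [one_le_pow₀ (n := k) hK.le])
      linarith
    · rw [le_div_iff₀ hy1] at hk1
      have : 1 - y ≤ (1 - x) / K ^ k := (le_div_iff₀ hKk).2 (by linarith)
      linarith
  have h2 := hiter k
  have hpow : (K ^ (k + 1)) ^ (Real.log C / Real.log K) = C ^ (k + 1) := by
    rw [← Real.rpow_natCast K, ← Real.rpow_mul hK0.le, mul_comm, Real.rpow_mul hK0.le,
      Real.rpow_natCast]
    congr 1
    rw [Real.rpow_def_of_pos hK0, mul_div_cancel₀ _ (Real.log_pos hK).ne', Real.exp_log hC0]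
  have h3 : 1 / C ^ (k + 1) ≤ ((1 - y) / (1 - x)) ^ (Real.log C / Real.log K) := by
    rw [← hpow, one_div, ← Real.inv_rpow (by positivity)]
    refine Real.rpow_le_rpow (by positivity) ?_ hβ.le
    rw [← inv_div (1 - x) (1 - y)]
    exact inv_anti₀ (by positivity) hk2.le
  have hτ := hR.tail_pos x ⟨hx, by linarith⟩
  calc tailIntegral ω y ≤ tailIntegral ω (1 - (1 - x) / K ^ k) := h1
    _ ≤ tailIntegral ω x / C ^ k := by
        rw [le_div_iff₀ (by positivity)]; linarith
    _ = C * (1 / C ^ (k + 1)) * tailIntegral ω x := by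
        rw [pow_succ]; field_simp
    _ ≤ _ := by gcongr

/-- Power decay bounds the integrand by a multiple of `(1 - x) ^ (β - 1)`, which is integrable up to
1. In terms of tails, the density `ω̂(x) / (1 - x)` is thus dominated by `ω`. -/
theorem lintegral_tail_div_le (hω : IsDoublingWeight ω) :
    ∃ C : ℝ, 0 < C ∧ ∀ a ∈ Ico (0 : ℝ) 1,
      ∫⁻ x in Ioo a 1, ENNReal.ofReal (tailIntegral ω x / (1 - x))
        ≤ ENNReal.ofReal (C * tailIntegral ω a) := by
  have hR := hω.toIsRadialWeight
  obtain ⟨β, C, hβ, hC, h⟩ := hω.exists_decay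
  refine ⟨C / β, by positivity, fun a ha => ?_⟩
  have ha' : 0 < 1 - a := by linarith [ha.2]
  have hτ := hR.tail_pos a ha
  have hint : IntervalIntegrable (fun x : ℝ => (1 - x) ^ (β - 1)) volume a 1 := by
    have := (intervalIntegral.intervalIntegrable_rpow' (a := 0) (b := 1 - a) (r := β - 1)
      (by linarith)).comp_sub_left 1
    simpa using this.symm
  have hval : ∫ x in a..1, (1 - x) ^ (β - 1) = (1 - a) ^ β / β := by
    rw [intervalIntegral.integral_comp_sub_left (fun x : ℝ => x ^ (β - 1)) 1,
      integral_rpow (Or.inl (by linarith))]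
    simp [Real.zero_rpow hβ.ne']
  calc ∫⁻ x in Ioo a 1, ENNReal.ofReal (tailIntegral ω x / (1 - x))
      ≤ ∫⁻ x in Ioo a 1, ENNReal.ofReal
          (C * tailIntegral ω a * ((1 - a) ^ β)⁻¹ * (1 - x) ^ (β - 1)) := by
        refine setLIntegral_mono' measurableSet_Ioo fun x hx => ENNReal.ofReal_le_ofReal ?_
        have hx1 : 0 < 1 - x := by linarith [hx.2]
        rw [div_le_iff₀ hx1]
        refine (h a x ha.1 hx.1.le hx.2).trans_eq ?_
        rw [Real.div_rpow hx1.le ha'.le, Real.rpow_sub_one hx1.ne']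
        field_simp
    _ = ENNReal.ofReal (C / β * tailIntegral ω a) := by
        rw [← ofReal_integral_eq_lintegral_ofReal]
        · rw [integral_const_mul, ← integral_Ioc_eq_integral_Ioo,
            ← intervalIntegral.integral_of_le ha.2.le, hval]
          congr 1
          have : (1 - a) ^ β ≠ 0 := (Real.rpow_pos_of_pos ha' _).ne'
          field_simp
        · exact ((intervalIntegrable_iff_integrableOn_Ioo_of_le ha.2.le).1 hint).const_mul _
        · filter_upwards [ae_restrict_mem measurableSet_Ioo] with x hx
          have hx1 : 0 < 1 - x := by linarith [hx.2]
          simp only [Pi.zero_apply]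
          positivity

/-- Formally this is `∫ t^{-q} dt` with `t = ω̂(r)`, and it is where the strict inequality `q < 1`
is needed. On the shell from `b k` to `b (k + 1)` the tail is comparable to its value at `b k` by
upper doubling; the shell contributes at most a multiple of `ω̂(b k)^{1 - q}`, and these powers
decay geometrically. -/
theorem lintegral_tail_rpow_neg_lt_top (hω : IsDoublingWeight ω) {q : ℝ} (hq0 : 0 < q)
    (hq1 : q < 1) :
    ∫⁻ r, ENNReal.ofReal ((tailIntegral ω r)⁻¹ ^ q) ∂radialMeasure ω < ⊤ := by
  have hR := hω.toIsRadialWeight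
  obtain ⟨β, D, hβ, hD, hdecay⟩ := hω.exists_decay
  obtain ⟨C, hC1, hC⟩ := hω.upper
  set b : ℕ → ℝ := fun k => 1 - (1 / 2) ^ k with hb
  have hb1 : ∀ k, b k ∈ Ico (0 : ℝ) 1 := fun k => by
    have h1 : ((1 : ℝ) / 2) ^ k ≤ 1 := pow_le_one₀ (by norm_num) (by norm_num)
    have h2 : 0 < ((1 : ℝ) / 2) ^ k := by positivity
    constructor <;> simp only [hb] <;> linarith
  have hbs : ∀ k, (1 + b k) / 2 = b (k + 1) := fun k => by simp only [hb, pow_succ]; ring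
  have hpt : ∀ r ∈ Ioo (0 : ℝ) 1, ENNReal.ofReal ((tailIntegral ω r)⁻¹ ^ q)
      ≤ ∑' k : ℕ, (Ioo (b k) 1).indicator
          (fun _ => ENNReal.ofReal ((C * (tailIntegral ω (b k))⁻¹) ^ q)) r := by
    intro r hr
    have hex : ∃ k : ℕ, r ≤ b (k + 1) := by
      obtain ⟨k, hk⟩ := exists_pow_lt_of_lt_one (sub_pos.2 hr.2) (by norm_num : (1 : ℝ) / 2 < 1)
      refine ⟨k, ?_⟩
      have : ((1 : ℝ) / 2) ^ (k + 1) ≤ (1 / 2) ^ k := by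
        rw [pow_succ]; linarith [show (0 : ℝ) < (1 / 2) ^ k by positivity]
      simp only [hb]; linarith
    classical
    obtain ⟨k, hk, hmin⟩ : ∃ k, r ≤ b (k + 1) ∧ ∀ j < k, ¬ r ≤ b (j + 1) :=
      ⟨Nat.find hex, Nat.find_spec hex, fun j hj => Nat.find_min hex hj⟩
    refine le_trans ?_ (ENNReal.le_tsum k)
    have hbk : b k < r := by
      rcases k with _ | j
      · simpa [hb] using hr.1
      · exact not_le.1 (hmin j (by omega))
    rw [indicator_of_mem (show r ∈ Ioo (b k) 1 from ⟨hbk, hr.2⟩)]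
    have hτ := hR.tail_pos r ⟨hr.1.le, hr.2⟩
    have hτk := hR.tail_pos _ (hb1 k)
    refine ENNReal.ofReal_le_ofReal (Real.rpow_le_rpow (by positivity) ?_ hq0.le)
    rw [inv_le_comm₀ hτ (by positivity), mul_inv, inv_inv]
    have h1 := hC _ (hb1 k)
    rw [hbs] at h1
    have h2 := hR.tailIntegral_anti hr.1.le hk (hb1 _).2.le
    rw [inv_mul_le_iff₀ (by linarith)]
    exact h1.trans (by gcongr)
  set E : ℝ := 2 * C ^ q * (D * tailIntegral ω 0) ^ (1 - q) with hE
  have hτ0 := hR.tail_pos 0 (by simp)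
  have hterm : ∀ k : ℕ, ENNReal.ofReal ((C * (tailIntegral ω (b k))⁻¹) ^ q)
      * radialMeasure ω (Ioo (b k) 1)
      ≤ ENNReal.ofReal E * (ENNReal.ofReal ((1 / 2) ^ (β * (1 - q)))) ^ k := by
    intro k
    have hτk := hR.tail_pos _ (hb1 k)
    refine (mul_le_mul_right (hR.radialMeasure_Ioo_le (hb1 _).1 (hb1 _).2.le) _).trans ?_
    rw [← ENNReal.ofReal_pow (by positivity), ← ENNReal.ofReal_mul (by positivity),
      ← ENNReal.ofReal_mul (by positivity)]
    refine ENNReal.ofReal_le_ofReal ?_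
    calc (C * (tailIntegral ω (b k))⁻¹) ^ q * (2 * tailIntegral ω (b k))
        = 2 * C ^ q * tailIntegral ω (b k) ^ (1 - q) := by
          rw [Real.mul_rpow (by positivity) (by positivity), Real.inv_rpow hτk.le,
            Real.rpow_sub hτk, Real.rpow_one]
          ring
      _ ≤ 2 * C ^ q * (D * ((1 - b k) / (1 - 0)) ^ β * tailIntegral ω 0) ^ (1 - q) := by
          refine mul_le_mul_of_nonneg_left (Real.rpow_le_rpow hτk.le ?_ (by linarith))
            (by positivity)
          exact hdecay 0 (b k) le_rfl (hb1 k).1 (hb1 k).2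
      _ = E * ((1 / 2) ^ (β * (1 - q))) ^ k := by
          have h1 : (1 - b k) / (1 - 0) = (1 / 2) ^ k := by simp [hb]
          rw [h1, hE, show D * ((1 / 2) ^ k) ^ β * tailIntegral ω 0
            = D * tailIntegral ω 0 * ((1 / 2) ^ k) ^ β by ring,
            Real.mul_rpow (by positivity) (by positivity), ← Real.rpow_natCast,
            ← Real.rpow_natCast, ← Real.rpow_mul (by norm_num), ← Real.rpow_mul (by norm_num),
            ← Real.rpow_mul (by norm_num)]
          rw [show (k : ℝ) * (β * (1 - q)) = β * (1 - q) * k by ring]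
          ring
  calc ∫⁻ r, ENNReal.ofReal ((tailIntegral ω r)⁻¹ ^ q) ∂radialMeasure ω
      ≤ ∫⁻ r, ∑' k : ℕ, (Ioo (b k) 1).indicator
          (fun _ => ENNReal.ofReal ((C * (tailIntegral ω (b k))⁻¹) ^ q)) r ∂radialMeasure ω := by
        refine lintegral_mono_ae ?_
        filter_upwards [IsRadialWeight.radialMeasure_ae ω] with r hr using hpt r hr
    _ = ∑' k : ℕ, ENNReal.ofReal ((C * (tailIntegral ω (b k))⁻¹) ^ q)
          * radialMeasure ω (Ioo (b k) 1) := by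
        rw [lintegral_tsum fun k =>
          (measurable_const.indicator measurableSet_Ioo).aemeasurable]
        congr 1 with k
        rw [lintegral_indicator_const measurableSet_Ioo]
    _ ≤ ∑' k : ℕ, ENNReal.ofReal E * (ENNReal.ofReal ((1 / 2) ^ (β * (1 - q)))) ^ k :=
        ENNReal.tsum_le_tsum hterm
    _ < ⊤ := by
        rw [ENNReal.tsum_mul_left]
        refine ENNReal.mul_lt_top ENNReal.ofReal_lt_top ?_
        rw [ENNReal.tsum_geometric]
        refine ENNReal.inv_lt_top.2 (tsub_pos_of_lt ?_)
        rw [ENNReal.ofReal_lt_one]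
        refine Real.rpow_lt_one (by norm_num) (by norm_num) ?_
        exact mul_pos hβ (by linarith)

end IsDoublingWeight

/-! ### Polar coordinates for the weighted area measure. -/

/-- Normalized arc length `dθ / 2π` on `(-π, π)`. -/
def angularMeasure : Measure ℝ :=
  ENNReal.ofReal ((2 * Real.pi)⁻¹) • volume.restrict (Ioo (-Real.pi) Real.pi)

instance : IsProbabilityMeasure angularMeasure := by
  constructor
  have : 0 < Real.pi := Real.pi_pos
  rw [angularMeasure, Measure.smul_apply, Measure.restrict_apply_univ, Real.volume_Ioo, smul_eq_mul,
    ← ENNReal.ofReal_mul (by positivity)]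
  rw [show (2 * Real.pi)⁻¹ * (Real.pi - -Real.pi) = 1 by field_simp; ring]
  simp

theorem circleMap_zero_mem_unitDisc {r : ℝ} (hr : r ∈ Ioo (0 : ℝ) 1) (θ : ℝ) :
    circleMap 0 r θ ∈ unitDisc := by
  simp [abs_of_pos hr.1, hr.2]

theorem continuous_circleMap_uncurry :
    Continuous fun p : ℝ × ℝ => circleMap 0 p.1 p.2 := by
  unfold circleMap; fun_prop

theorem weightedArea_absolutelyContinuous (ω : ℂ → ℝ) :
    weightedArea ω ≪ volume.restrict unitDisc :=
  (Measure.smul_absolutelyContinuous).trans (withDensity_absolutelyContinuous _ _)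

theorem weightedArea_ae (ω : ℂ → ℝ) : ∀ᵐ z ∂weightedArea ω, z ∈ unitDisc :=
  (weightedArea_absolutelyContinuous ω).ae_le (ae_restrict_mem measurableSet_ball)

theorem ContinuousOn.aestronglyMeasurable_weightedArea {E : Type*} [TopologicalSpace E]
    [TopologicalSpace.PseudoMetrizableSpace E] {F : ℂ → E}
    [SecondCountableTopologyEither ℂ E] (hF : ContinuousOn F unitDisc) (ω : ℂ → ℝ) :
    AEStronglyMeasurable F (weightedArea ω) :=
  (hF.aestronglyMeasurable measurableSet_ball).mono_ac (weightedArea_absolutelyContinuous ω)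

namespace IsRadialWeight

variable {ω : ℂ → ℝ}

/-- The measure `ω dA` in polar coordinates. -/
theorem weightedArea_eq_map (hω : IsRadialWeight ω) :
    weightedArea ω = Measure.map (fun p : ℝ × ℝ => circleMap 0 p.1 p.2)
      ((radialMeasure ω).prod angularMeasure) := by
  have hcont := continuous_circleMap_uncurry
  have hW : AEMeasurable (fun r : ℝ => ENNReal.ofReal (ω (r : ℂ)))
      (volume.restrict (Ioo (0 : ℝ) 1)) :=
    (hω.integrableOn_Ioo le_rfl).aestronglyMeasurable.aemeasurable.ennreal_ofReal
  ext s hs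
  have hpre : MeasurableSet ((fun p : ℝ × ℝ => circleMap 0 p.1 p.2) ⁻¹' s) :=
    hcont.measurable hs
  have hsl : ∀ r : ℝ, MeasurableSet {θ | circleMap 0 r θ ∈ s} := fun r =>
    (continuous_circleMap 0 r).measurable hs
  rw [Measure.map_apply hcont.measurable hs, Measure.prod_apply hpre]
  -- The normalizations match because `2 r · (2 π)⁻¹ = π⁻¹ r`.
  have hR : ∫⁻ r, angularMeasure (Prod.mk r ⁻¹' ((fun p : ℝ × ℝ => circleMap 0 p.1 p.2) ⁻¹' s))
        ∂radialMeasure ω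
      = ENNReal.ofReal Real.pi⁻¹ * ∫⁻ r in Ioo (0 : ℝ) 1, ENNReal.ofReal r *
        ENNReal.ofReal (ω (r : ℂ)) *
        (volume.restrict (Ioo (-Real.pi) Real.pi)) {θ | circleMap 0 r θ ∈ s} := by
    rw [hω.lintegral_radialMeasure (measurable_measure_prodMk_left hpre).aemeasurable,
      ← lintegral_const_mul' _ _ ENNReal.ofReal_ne_top]
    refine setLIntegral_congr_fun measurableSet_Ioo fun r hr => ?_
    have h1 : angularMeasure (Prod.mk r ⁻¹' ((fun p : ℝ × ℝ => circleMap 0 p.1 p.2) ⁻¹' s))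
        = ENNReal.ofReal ((2 * Real.pi)⁻¹) *
          (volume.restrict (Ioo (-Real.pi) Real.pi)) {θ | circleMap 0 r θ ∈ s} := rfl
    simp only [h1]
    rw [← mul_assoc, ← mul_assoc, ← ENNReal.ofReal_mul hr.1.le,
      ← ENNReal.ofReal_mul (inv_nonneg.2 Real.pi_pos.le),
      ← ENNReal.ofReal_mul (by have := hω.nonneg_ofReal hr.1.le hr.2; have := hr.1; positivity)]
    congr 2
    have := Real.pi_pos
    field_simp
  rw [hR, weightedArea, Measure.smul_apply, smul_eq_mul, withDensity_apply _ hs]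
  congr 1
  rw [Measure.restrict_restrict hs, ← lintegral_indicator (hs.inter measurableSet_ball),
    ← Complex.lintegral_comp_polarCoord_symm, polarCoord_target]
  have hpt : ∀ p ∈ Ioi (0 : ℝ) ×ˢ Ioo (-Real.pi) Real.pi,
      ENNReal.ofReal p.1 • (s ∩ unitDisc).indicator (fun z => ENNReal.ofReal (ω z))
          (Complex.polarCoord.symm p)
        = (Ioo (0 : ℝ) 1 ×ˢ univ).indicator (fun p : ℝ × ℝ => ENNReal.ofReal p.1 *
          ENNReal.ofReal (ω (p.1 : ℂ)) *
          ((fun p : ℝ × ℝ => circleMap 0 p.1 p.2) ⁻¹' s).indicator 1 p) p := by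
    rintro ⟨r, θ⟩ ⟨hr, hθ⟩
    simp only [mem_Ioi] at hr
    have hpol : (Complex.polarCoord.symm (r, θ) : ℂ) = circleMap 0 r θ := by
      rw [Complex.polarCoord_symm_apply, circleMap, Complex.exp_mul_I]
      push_cast; ring
    rw [hpol]
    have hnorm : ‖circleMap 0 r θ‖ = r := by simp [abs_of_pos hr]
    by_cases h1 : r < 1
    · have hmem : circleMap 0 r θ ∈ unitDisc := circleMap_zero_mem_unitDisc ⟨hr, h1⟩ θ
      by_cases h2 : circleMap 0 r θ ∈ s
      · rw [indicator_of_mem (show circleMap 0 r θ ∈ s ∩ unitDisc from ⟨h2, hmem⟩),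
          indicator_of_mem (show (r, θ) ∈ Ioo (0 : ℝ) 1 ×ˢ univ from ⟨⟨hr, h1⟩, trivial⟩),
          indicator_of_mem (show (r, θ) ∈ (fun p : ℝ × ℝ => circleMap 0 p.1 p.2) ⁻¹' s from h2),
          hω.radial _ hmem, hnorm]
        simp
      · rw [indicator_of_notMem (show circleMap 0 r θ ∉ s ∩ unitDisc from fun h => h2 h.1),
          indicator_of_mem (show (r, θ) ∈ Ioo (0 : ℝ) 1 ×ˢ univ from ⟨⟨hr, h1⟩, trivial⟩),
          indicator_of_notMem
            (show (r, θ) ∉ (fun p : ℝ × ℝ => circleMap 0 p.1 p.2) ⁻¹' s from h2)]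
        simp
    · rw [indicator_of_notMem (show circleMap 0 r θ ∉ s ∩ unitDisc from fun h => h1 (by
          have := h.2; rw [mem_ball_zero_iff, hnorm] at this; exact this)),
        indicator_of_notMem (show (r, θ) ∉ Ioo (0 : ℝ) 1 ×ˢ univ from fun h => h1 h.1.2)]
      simp
  rw [setLIntegral_congr_fun (measurableSet_Ioi.prod measurableSet_Ioo) hpt,
    setLIntegral_indicator (measurableSet_Ioo.prod MeasurableSet.univ), prod_inter_prod,
    univ_inter, show Ioo (0 : ℝ) 1 ∩ Ioi 0 = Ioo 0 1 from inter_eq_left.2 Ioo_subset_Ioi_self,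
    Measure.volume_eq_prod, ← Measure.prod_restrict, lintegral_prod]
  · refine setLIntegral_congr_fun measurableSet_Ioo fun r hr => ?_
    simp only
    rw [lintegral_const_mul' _ _ (ENNReal.mul_ne_top ENNReal.ofReal_ne_top ENNReal.ofReal_ne_top)]
    congr 1
    rw [← lintegral_indicator_one (hsl r)]
    rfl
  · exact ((by fun_prop : Measurable fun p : ℝ × ℝ => ENNReal.ofReal p.1).aemeasurable.mul
      hW.comp_fst).mul (measurable_one.indicator hpre).aemeasurable

theorem lintegral_weightedArea (hω : IsRadialWeight ω) {F : ℂ → ℝ≥0∞}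
    (hF : AEMeasurable F (weightedArea ω)) :
    ∫⁻ z, F z ∂weightedArea ω
      = ∫⁻ r, ∫⁻ θ, F (circleMap 0 r θ) ∂angularMeasure ∂radialMeasure ω := by
  rw [hω.weightedArea_eq_map] at hF ⊢
  have hc := continuous_circleMap_uncurry.measurable.aemeasurable
    (μ := (radialMeasure ω).prod angularMeasure)
  rw [lintegral_map' hF hc]
  exact lintegral_prod _ (hF.comp_aemeasurable hc)

theorem integral_weightedArea (hω : IsRadialWeight ω) {F : ℂ → ℂ}
    (hF : Integrable F (weightedArea ω)) :
    ∫ z, F z ∂weightedArea ω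
      = ∫ r, ∫ θ, F (circleMap 0 r θ) ∂angularMeasure ∂radialMeasure ω := by
  rw [hω.weightedArea_eq_map] at hF ⊢
  have hc := continuous_circleMap_uncurry.measurable.aemeasurable
    (μ := (radialMeasure ω).prod angularMeasure)
  rw [integral_map hc hF.1, integral_prod]
  exact hF.comp_aemeasurable hc

theorem isFiniteMeasure_weightedArea (hω : IsRadialWeight ω) :
    IsFiniteMeasure (weightedArea ω) := by
  have := hω.isFiniteMeasure_radialMeasure
  rw [hω.weightedArea_eq_map]
  infer_instance

end IsRadialWeight

/-! ### Rotation invariance and integral means of powers of `1 - c z`. -/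

theorem lintegral_angularMeasure_rotate {F : ℂ → ℝ≥0∞} (r α : ℝ) :
    ∫⁻ θ, F (circleMap 0 r (θ + α)) ∂angularMeasure
      = ∫⁻ θ, F (circleMap 0 r θ) ∂angularMeasure := by
  have hπ : 0 < 2 * Real.pi := by have := Real.pi_pos; positivity
  -- Half-open intervals of length `2 π` are fundamental domains for translation by multiples of `2
  -- π`, so a periodic function has the same integral over each.
  have key : ∀ t : ℝ, ∫⁻ θ in Ioc t (t + 2 * Real.pi), F (circleMap 0 r θ)
      = ∫⁻ θ in Ioc (-Real.pi) (-Real.pi + 2 * Real.pi), F (circleMap 0 r θ) := by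
    intro t
    refine (isAddFundamentalDomain_Ioc hπ t).setLIntegral_eq
      (isAddFundamentalDomain_Ioc hπ (-Real.pi)) _ ?_
    rintro ⟨g, hg⟩ x
    obtain ⟨k, rfl⟩ := AddSubgroup.mem_zmultiples_iff.1 hg
    congr 1
    have := (periodic_circleMap 0 r).zsmul k x
    simpa [AddSubgroup.vadd_def, add_comm] using this
  simp only [angularMeasure, lintegral_smul_measure]
  congr 1
  rw [restrict_Ioo_eq_restrict_Ioc]
  have h2 : -Real.pi + 2 * Real.pi = Real.pi := by ring
  rw [h2] at key
  rw [← key (-Real.pi + α)]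
  have hpre : (fun θ : ℝ => θ + α) ⁻¹' Ioc (-Real.pi + α) (-Real.pi + α + 2 * Real.pi)
      = Ioc (-Real.pi) Real.pi := by
    ext θ; simp only [mem_preimage, mem_Ioc]
    constructor <;> rintro ⟨h1, h2⟩ <;> constructor <;> linarith
  have := (measurePreserving_add_right volume α).setLIntegral_comp_preimage_emb
    (MeasurableEquiv.addRight α).measurableEmbedding (fun θ => F (circleMap 0 r θ))
    (Ioc (-Real.pi + α) (-Real.pi + α + 2 * Real.pi))
  rw [← this, hpre]

/-- The norm dominates both `1 - x` and `|θ| / π`, hence their average. For `|θ| ≤ π/2` the second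
bound holds because the distance from 1 to the line through 0 and `e^{iθ}` is `sin |θ|`; for larger
angles `cos θ ≤ 0` makes the norm at least 1. -/
theorem norm_one_sub_circleMap_ge {x θ : ℝ} (hx0 : 0 ≤ x)
    (hθ : θ ∈ Ioo (-Real.pi) Real.pi) :
    ((1 - x) + |θ| / Real.pi) / 2 ≤ ‖1 - circleMap 0 x θ‖ := by
  have hπ := Real.pi_pos
  have h1 : 1 - x ≤ ‖1 - circleMap 0 x θ‖ := by
    have := norm_sub_norm_le (1 : ℂ) (circleMap 0 x θ)
    simpa [abs_of_nonneg hx0] using this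
  have hsq : ‖1 - circleMap 0 x θ‖ ^ 2 = 1 - 2 * x * Real.cos θ + x ^ 2 := by
    rw [← Complex.normSq_eq_norm_sq, Complex.normSq_apply, circleMap, Complex.exp_mul_I]
    simp only [zero_add, Complex.sub_re, Complex.one_re, Complex.mul_re, Complex.add_re,
      Complex.ofReal_re, Complex.ofReal_im, Complex.sub_im, Complex.one_im, Complex.mul_im,
      Complex.add_im, Complex.I_re, Complex.I_im, Complex.cos_ofReal_re, Complex.sin_ofReal_re,
      Complex.cos_ofReal_im, Complex.sin_ofReal_im]
    have := Real.sin_sq_add_cos_sq θ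
    linear_combination (x ^ 2) * this
  have h2 : |θ| / Real.pi ≤ ‖1 - circleMap 0 x θ‖ := by
    have habs : |θ| < Real.pi := abs_lt.2 hθ
    by_cases hc : |θ| ≤ Real.pi / 2
    · have hs := Real.mul_le_sin (abs_nonneg θ) hc
      have hle : |θ| / Real.pi ≤ Real.sin |θ| := by
        refine le_trans ?_ hs
        rw [div_mul_eq_mul_div]
        gcongr
        linarith [abs_nonneg θ]
      refine hle.trans ?_
      refine abs_le_of_sq_le_sq' ?_ (norm_nonneg _) |>.2
      rw [hsq, ← Real.cos_abs θ]
      have := Real.sin_sq_add_cos_sq |θ|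
      nlinarith [sq_nonneg (x - Real.cos |θ|)]
    · push Not at hc
      have hcos : Real.cos θ ≤ 0 := by
        rw [← Real.cos_abs]
        exact Real.cos_nonpos_of_pi_div_two_le_of_le hc.le (by linarith)
      have h3 : |θ| / Real.pi ≤ 1 := (div_le_one hπ).2 habs.le
      refine h3.trans ?_
      refine abs_le_of_sq_le_sq' ?_ (norm_nonneg _) |>.2
      rw [hsq]
      nlinarith [mul_nonneg hx0 (neg_nonneg.2 hcos), sq_nonneg x]
  linarith

/-- Integral means of `|1 - c z|^{-P}` for `P > 1`. -/
theorem lintegral_norm_one_sub_rpow_le {P : ℝ} (hP : 1 < P) :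
    ∃ C : ℝ, 0 < C ∧ ∀ (c : ℂ) (r : ℝ), 0 ≤ r → ‖c‖ * r < 1 →
      ∫⁻ θ, ENNReal.ofReal (‖1 - c * circleMap 0 r θ‖ ^ (-P)) ∂angularMeasure
        ≤ ENNReal.ofReal (C * (1 - ‖c‖ * r) ^ (1 - P)) := by
  have hπ := Real.pi_pos
  refine ⟨2 ^ P / (P - 1), div_pos (by positivity) (by linarith), fun c r hr hcr => ?_⟩
  set x := ‖c‖ * r with hx
  have hx0 : 0 ≤ x := by positivity
  have hrot : ∀ θ, c * circleMap 0 r θ = circleMap 0 x (θ + c.arg) := by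
    intro θ
    conv_lhs => rw [← Complex.norm_mul_exp_arg_mul_I c]
    simp only [circleMap, zero_add, hx]
    push_cast
    rw [add_mul, Complex.exp_add]
    ring
  simp only [hrot]
  rw [lintegral_angularMeasure_rotate (F := fun z => ENNReal.ofReal (‖1 - z‖ ^ (-P)))]
  set d := 1 - x with hd
  have hd0 : 0 < d := by linarith
  have hbound : ∀ θ ∈ Ioo (-Real.pi) Real.pi, ENNReal.ofReal (‖1 - circleMap 0 x θ‖ ^ (-P))
      ≤ ENNReal.ofReal (2 ^ P * (d + |θ| / Real.pi) ^ (-P)) := by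
    intro θ hθ
    refine ENNReal.ofReal_le_ofReal ?_
    have h := norm_one_sub_circleMap_ge hx0 hθ
    have hpos : 0 < d + |θ| / Real.pi := by positivity
    calc ‖1 - circleMap 0 x θ‖ ^ (-P) ≤ ((d + |θ| / Real.pi) / 2) ^ (-P) :=
          Real.rpow_le_rpow_of_nonpos (by positivity) h (by linarith)
      _ = 2 ^ P * (d + |θ| / Real.pi) ^ (-P) := by
          rw [Real.div_rpow hpos.le (by norm_num), Real.rpow_neg (by norm_num : (0 : ℝ) ≤ 2)]
          field_simp
  have hcont : Continuous fun θ : ℝ => (d + |θ| / Real.pi) ^ (-P) := by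
    refine Continuous.rpow_const (by fun_prop) fun θ => Or.inl ?_
    positivity
  have hhalf : ∫ θ in (0 : ℝ)..Real.pi, (d + |θ| / Real.pi) ^ (-P)
      ≤ Real.pi * (d ^ (1 - P) / (P - 1)) := by
    have h1 : ∫ θ in (0 : ℝ)..Real.pi, (d + |θ| / Real.pi) ^ (-P)
        = ∫ θ in (0 : ℝ)..Real.pi, (d + θ / Real.pi) ^ (-P) := by
      refine intervalIntegral.integral_congr fun θ hθ => ?_
      rw [uIcc_of_le hπ.le] at hθ
      simp only [abs_of_nonneg hθ.1]
    rw [h1, intervalIntegral.integral_comp_add_div (fun u : ℝ => u ^ (-P)) hπ.ne' d,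
      integral_rpow (Or.inr ⟨by linarith, ?_⟩)]
    · rw [smul_eq_mul, zero_div, add_zero, div_self hπ.ne']
      refine mul_le_mul_of_nonneg_left ?_ hπ.le
      rw [show -P + 1 = -(P - 1) by ring, show 1 - P = -(P - 1) by ring, div_neg, ← neg_div]
      have : 0 ≤ (d + 1) ^ (-(P - 1)) := by positivity
      have hP1 : 0 < P - 1 := by linarith
      gcongr
      linarith
    · rw [zero_div, add_zero, div_self hπ.ne', uIcc_of_le (by linarith)]
      intro h
      linarith [h.1]
  have hneg : ∫ θ in (-Real.pi)..0, (d + |θ| / Real.pi) ^ (-P)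
      = ∫ θ in (0 : ℝ)..Real.pi, (d + |θ| / Real.pi) ^ (-P) := by
    have := intervalIntegral.integral_comp_neg (fun θ : ℝ => (d + |θ| / Real.pi) ^ (-P))
      (a := 0) (b := Real.pi)
    simp only [abs_neg, neg_zero] at this
    exact this.symm
  have htot : ∫ θ in Ioo (-Real.pi) Real.pi, (d + |θ| / Real.pi) ^ (-P)
      ≤ 2 * Real.pi * (d ^ (1 - P) / (P - 1)) := by
    rw [← integral_Ioc_eq_integral_Ioo, ← intervalIntegral.integral_of_le (by linarith),
      ← intervalIntegral.integral_add_adjacent_intervals (b := 0)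
        (hcont.intervalIntegrable _ _) (hcont.intervalIntegrable _ _), hneg]
    linarith
  calc ∫⁻ θ, ENNReal.ofReal (‖1 - circleMap 0 x θ‖ ^ (-P)) ∂angularMeasure
      = ENNReal.ofReal ((2 * Real.pi)⁻¹) * ∫⁻ θ in Ioo (-Real.pi) Real.pi,
          ENNReal.ofReal (‖1 - circleMap 0 x θ‖ ^ (-P)) := by
        rw [angularMeasure, lintegral_smul_measure, smul_eq_mul]
    _ ≤ ENNReal.ofReal ((2 * Real.pi)⁻¹) * ∫⁻ θ in Ioo (-Real.pi) Real.pi,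
          ENNReal.ofReal (2 ^ P * (d + |θ| / Real.pi) ^ (-P)) := by
        refine mul_le_mul_right ?_ _
        exact setLIntegral_mono' measurableSet_Ioo hbound
    _ = ENNReal.ofReal ((2 * Real.pi)⁻¹ *
          (2 ^ P * ∫ θ in Ioo (-Real.pi) Real.pi, (d + |θ| / Real.pi) ^ (-P))) := by
        rw [ENNReal.ofReal_mul (by positivity), ← integral_const_mul,
          ofReal_integral_eq_lintegral_ofReal]
        · exact ((hcont.integrableOn_Icc).mono_set Ioo_subset_Icc_self).const_mul _
        · filter_upwards with θ
          simp only [Pi.zero_apply]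
          positivity
    _ ≤ ENNReal.ofReal (2 ^ P / (P - 1) * d ^ (1 - P)) := by
        refine ENNReal.ofReal_le_ofReal ?_
        calc (2 * Real.pi)⁻¹ *
              (2 ^ P * ∫ θ in Ioo (-Real.pi) Real.pi, (d + |θ| / Real.pi) ^ (-P))
            ≤ (2 * Real.pi)⁻¹ * (2 ^ P * (2 * Real.pi * (d ^ (1 - P) / (P - 1)))) := by gcongr
          _ = _ := by field_simp

/-! ### Taylor coefficients, orthogonality of monomials and moments. -/

/-- The `m`-th Taylor coefficient at the origin. -/
def taylorCoeff (f : ℂ → ℂ) (m : ℕ) : ℂ := (m.factorial : ℂ)⁻¹ * iteratedDeriv m f 0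

theorem hasSum_taylorCoeff {f : ℂ → ℂ} (hf : DifferentiableOn ℂ f unitDisc) {z : ℂ}
    (hz : z ∈ unitDisc) : HasSum (fun m => taylorCoeff f m * z ^ m) (f z) := by
  have := Complex.hasSum_taylorSeries_on_ball hf hz
  refine this.congr_fun fun m => ?_
  simp [taylorCoeff, mul_comm, mul_left_comm]

theorem summable_norm_taylorCoeff {f : ℂ → ℂ} (hf : DifferentiableOn ℂ f unitDisc) {r : ℝ}
    (hr : r ∈ Ico (0 : ℝ) 1) : Summable fun m => ‖taylorCoeff f m‖ * r ^ m := by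
  have hz : (r : ℂ) ∈ unitDisc := by simp [abs_of_nonneg hr.1, hr.2]
  have := (hasSum_taylorCoeff hf hz).summable.norm
  simpa [abs_of_nonneg hr.1] using this

theorem integrable_angularMeasure {E : Type*} [NormedAddCommGroup E] {F : ℝ → E}
    (hF : Continuous F) : Integrable F angularMeasure := by
  unfold angularMeasure
  refine Integrable.smul_measure ?_ ENNReal.ofReal_ne_top
  exact (hF.integrableOn_Icc (a := -Real.pi) (b := Real.pi)).mono_set Ioo_subset_Icc_self

theorem continuous_comp_circleMap {E : Type*} [TopologicalSpace E] {F : ℂ → E}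
    (hF : ContinuousOn F unitDisc) {r : ℝ} (hr : r ∈ Ioo (0 : ℝ) 1) :
    Continuous fun θ => F (circleMap 0 r θ) :=
  hF.comp_continuous (continuous_circleMap 0 r) fun θ => circleMap_zero_mem_unitDisc hr θ

theorem integral_circleMap_pow_mul_conj (ρ r : ℝ) (m k : ℕ) :
    ∫ θ, circleMap 0 ρ θ ^ m * conj (circleMap 0 r θ ^ k) ∂angularMeasure
      = if m = k then (ρ : ℂ) ^ m * (r : ℂ) ^ m else 0 := by
  have hπ := Real.pi_pos
  have hpt : ∀ θ : ℝ, circleMap 0 ρ θ ^ m * conj (circleMap 0 r θ ^ k)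
      = (ρ : ℂ) ^ m * (r : ℂ) ^ k * Complex.exp ((((m : ℤ) - k : ℤ) * Complex.I) * θ) := by
    intro θ
    simp only [circleMap, zero_add, mul_pow, map_mul, map_pow, Complex.conj_ofReal,
      ← Complex.exp_conj, Complex.conj_I]
    rw [← Complex.exp_nat_mul, ← Complex.exp_nat_mul, mul_mul_mul_comm, ← Complex.exp_add]
    congr 2
    push_cast; ring
  simp only [hpt]
  rw [integral_const_mul]
  split_ifs with h
  · subst h; simp
  · have hc : (((m : ℤ) - k : ℤ) : ℂ) * Complex.I ≠ 0 := by
      refine mul_ne_zero ?_ Complex.I_ne_zero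
      exact Int.cast_ne_zero.2 (sub_ne_zero.2 (by exact_mod_cast h))
    have : ∫ θ : ℝ, Complex.exp ((((m : ℤ) - k : ℤ) * Complex.I) * θ) ∂angularMeasure = 0 := by
      rw [angularMeasure, integral_smul_measure, ← integral_Ioc_eq_integral_Ioo,
        ← intervalIntegral.integral_of_le (by linarith), integral_exp_mul_complex hc]
      have h1 : Complex.exp ((((m : ℤ) - k : ℤ) * Complex.I) * (Real.pi : ℝ))
          = Complex.exp ((((m : ℤ) - k : ℤ) * Complex.I) * (-Real.pi : ℝ)) := by
        rw [Complex.exp_eq_exp_iff_exists_int]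
        refine ⟨(m : ℤ) - k, ?_⟩
        push_cast; ring
      rw [h1]; simp
    rw [this, mul_zero]

theorem integral_mul_conj_pow {f : ℂ → ℂ} (hf : DifferentiableOn ℂ f unitDisc) {ρ : ℝ}
    (hρ : ρ ∈ Ioo (0 : ℝ) 1) (r : ℝ) (k : ℕ) :
    ∫ θ, f (circleMap 0 ρ θ) * conj (circleMap 0 r θ ^ k) ∂angularMeasure
      = taylorCoeff f k * ((ρ : ℂ) ^ k * (r : ℂ) ^ k) := by
  have hsum : HasSum (fun m => ∫ θ, taylorCoeff f m * circleMap 0 ρ θ ^ m *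
        conj (circleMap 0 r θ ^ k) ∂angularMeasure)
      (∫ θ, ∑' m, taylorCoeff f m * circleMap 0 ρ θ ^ m * conj (circleMap 0 r θ ^ k)
        ∂angularMeasure) := by
    refine hasSum_integral_of_summable_integral_norm (fun m => ?_) ?_
    · refine integrable_angularMeasure ?_
      have := continuous_circleMap 0 r
      have := continuous_circleMap 0 ρ
      fun_prop
    · have := (summable_norm_taylorCoeff hf ⟨hρ.1.le, hρ.2⟩).mul_right (|r| ^ k)
      convert! this using 2 with m
      simp [abs_of_pos hρ.1]
  have h1 : ∀ θ, ∑' m, taylorCoeff f m * circleMap 0 ρ θ ^ m * conj (circleMap 0 r θ ^ k)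
      = f (circleMap 0 ρ θ) * conj (circleMap 0 r θ ^ k) := fun θ => by
    rw [tsum_mul_right, (hasSum_taylorCoeff hf (circleMap_zero_mem_unitDisc hρ θ)).tsum_eq]
  simp only [h1] at hsum
  refine hsum.unique ?_
  simp only [mul_assoc, integral_const_mul, integral_circleMap_pow_mul_conj]
  have := hasSum_single (f := fun m => taylorCoeff f m *
    if m = k then (ρ : ℂ) ^ m * (r : ℂ) ^ m else 0) k (fun m hm => by simp [hm])
  simpa using this

/-- The moments `∫ |ζ|^{2k} ω dA`. -/
def radialMoment (ω : ℂ → ℝ) (k : ℕ) : ℝ := ∫ r, r ^ (2 * k) ∂radialMeasure ω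

theorem IsRadialWeight.integrable_pow {ω : ℂ → ℝ} (hω : IsRadialWeight ω) (k : ℕ) :
    Integrable (fun r : ℝ => r ^ k) (radialMeasure ω) := by
  have := hω.isFiniteMeasure_radialMeasure
  refine Integrable.of_bound (by fun_prop) 1 ?_
  filter_upwards [IsRadialWeight.radialMeasure_ae ω] with r hr
  rw [Real.norm_of_nonneg (pow_nonneg hr.1.le _)]
  exact pow_le_one₀ hr.1.le hr.2.le

theorem IsRadialWeight.integral_mul_conj_pow {ω : ℂ → ℝ} (hω : IsRadialWeight ω) {f : ℂ → ℂ}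
    (hf : DifferentiableOn ℂ f unitDisc) (hfi : Integrable f (weightedArea ω)) (k : ℕ) :
    ∫ ζ, f ζ * conj (ζ ^ k) ∂weightedArea ω = taylorCoeff f k * radialMoment ω k := by
  have hint : Integrable (fun ζ => f ζ * conj (ζ ^ k)) (weightedArea ω) := by
    refine hfi.mul_bdd (c := 1) (by fun_prop) ?_
    filter_upwards [weightedArea_ae ω] with z hz
    rw [mem_ball_zero_iff] at hz
    simpa using pow_le_one₀ (norm_nonneg z) hz.le
  rw [hω.integral_weightedArea hint, radialMoment, ← integral_complex_ofReal, ← integral_const_mul]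
  refine integral_congr_ae ?_
  filter_upwards [IsRadialWeight.radialMeasure_ae ω] with r hr
  rw [_root_.integral_mul_conj_pow hf hr]
  push_cast; ring

/-- Parseval for `L¹` against absolutely summable power series: the `m`-th term is at most `‖c m‖
‖f‖₁`, so the exchange of sum and integral needs no information on the Taylor coefficients of `f`.
-/
theorem IsRadialWeight.hasSum_integral_mul_conj_series {ω : ℂ → ℝ} (hω : IsRadialWeight ω)
    {f : ℂ → ℂ} (hf : DifferentiableOn ℂ f unitDisc) (hfi : Integrable f (weightedArea ω))
    {c : ℕ → ℂ} (hc : Summable fun m => ‖c m‖) :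
    HasSum (fun m => conj (c m) * (taylorCoeff f m * radialMoment ω m))
      (∫ ζ, f ζ * conj (∑' m, c m * ζ ^ m) ∂weightedArea ω) := by
  have hbd : ∀ᵐ z ∂weightedArea ω, ∀ m : ℕ, ‖z ^ m‖ ≤ 1 := by
    filter_upwards [weightedArea_ae ω] with z hz m
    rw [mem_ball_zero_iff] at hz
    simpa using pow_le_one₀ (norm_nonneg z) hz.le
  have hint : ∀ m, Integrable (fun ζ => f ζ * conj (c m * ζ ^ m)) (weightedArea ω) := by
    intro m
    refine hfi.mul_bdd (c := ‖c m‖) (by fun_prop) ?_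
    filter_upwards [hbd] with z hz
    rw [RCLike.norm_conj, norm_mul]
    exact mul_le_of_le_one_right (norm_nonneg _) (hz m)
  have hsum : HasSum (fun m => ∫ ζ, f ζ * conj (c m * ζ ^ m) ∂weightedArea ω)
      (∫ ζ, ∑' m, f ζ * conj (c m * ζ ^ m) ∂weightedArea ω) := by
    refine hasSum_integral_of_summable_integral_norm hint ?_
    refine Summable.of_nonneg_of_le (fun m => integral_nonneg fun _ => norm_nonneg _)
      (fun m => ?_) (hc.mul_right (∫ ζ, ‖f ζ‖ ∂weightedArea ω))
    rw [← integral_const_mul]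
    refine integral_mono_ae (hint m).norm (hfi.norm.const_mul _) ?_
    filter_upwards [hbd] with z hz
    rw [norm_mul, RCLike.norm_conj, norm_mul, mul_comm]
    exact mul_le_mul_of_nonneg_right (mul_le_of_le_one_right (norm_nonneg _) (hz m))
      (norm_nonneg _)
  have h1 : ∫ ζ, ∑' m, f ζ * conj (c m * ζ ^ m) ∂weightedArea ω
      = ∫ ζ, f ζ * conj (∑' m, c m * ζ ^ m) ∂weightedArea ω := by
    refine integral_congr_ae ?_
    filter_upwards with z
    rw [tsum_mul_left, Complex.conj_tsum]
  rw [h1] at hsum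
  refine hsum.congr_fun fun m => ?_
  rw [← hω.integral_mul_conj_pow hf hfi, ← integral_const_mul]
  congr 1 with z
  simp only [map_mul]; ring

/-! ### Symbol calculus for sequences. -/

/-- Symbol estimates `|Δ^i a(m)| ≲ h(m) (m+1)^{-i}` up to order `N`, stated recursively. -/
def IsSymbol : ℕ → (ℕ → ℝ) → (ℕ → ℝ) → Prop
  | 0, h, a => ∃ C : ℝ, 0 ≤ C ∧ ∀ m, |a m| ≤ C * h m
  | N + 1, h, a => (∃ C : ℝ, 0 ≤ C ∧ ∀ m, |a m| ≤ C * h m) ∧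
      IsSymbol N (fun m => h m / (m + 1)) (fun m => a (m + 1) - a m)

namespace IsSymbol

theorem bound {N : ℕ} {h a : ℕ → ℝ} (H : IsSymbol N h a) :
    ∃ C : ℝ, 0 ≤ C ∧ ∀ m, |a m| ≤ C * h m := by
  cases N with
  | zero => exact H
  | succ N => exact H.1

theorem of_le {N : ℕ} {h k a : ℕ → ℝ} (H : IsSymbol N h a) {c : ℝ} (hc : 0 ≤ c)
    (hk : ∀ m, h m ≤ c * k m) : IsSymbol N k a := by
  have hb : ∀ {h k a : ℕ → ℝ} (_ : ∃ C : ℝ, 0 ≤ C ∧ ∀ m, |a m| ≤ C * h m)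
      (_ : ∀ m, h m ≤ c * k m), ∃ C : ℝ, 0 ≤ C ∧ ∀ m, |a m| ≤ C * k m := by
    rintro h k a ⟨C, hC, H⟩ hk
    refine ⟨C * c, by positivity, fun m => (H m).trans ?_⟩
    rw [mul_assoc]
    exact mul_le_mul_of_nonneg_left (hk m) hC
  induction N generalizing h k a with
  | zero => exact hb H hk
  | succ N ih =>
    refine ⟨hb H.1 hk, ih H.2 fun m => ?_⟩
    rw [mul_div_assoc']
    have : (0 : ℝ) < m + 1 := by positivity
    gcongr
    exact hk m

theorem pred {N : ℕ} {h a : ℕ → ℝ} (H : IsSymbol (N + 1) h a) : IsSymbol N h a := by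
  induction N generalizing h a with
  | zero => exact H.1
  | succ N ih => exact ⟨H.1, ih H.2⟩

theorem add {N : ℕ} {h a b : ℕ → ℝ} (ha : IsSymbol N h a) (hb : IsSymbol N h b) :
    IsSymbol N h (fun m => a m + b m) := by
  have key : ∀ {h a b : ℕ → ℝ} (_ : ∃ C : ℝ, 0 ≤ C ∧ ∀ m, |a m| ≤ C * h m)
      (_ : ∃ C : ℝ, 0 ≤ C ∧ ∀ m, |b m| ≤ C * h m),
      ∃ C : ℝ, 0 ≤ C ∧ ∀ m, |a m + b m| ≤ C * h m := by
    rintro h a b ⟨C, hC, H⟩ ⟨D, hD, H'⟩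
    refine ⟨C + D, by positivity, fun m => (abs_add_le _ _).trans ?_⟩
    linarith [H m, H' m]
  induction N generalizing h a b with
  | zero => exact key ha hb
  | succ N ih =>
    refine ⟨key ha.1 hb.1, ?_⟩
    have := ih ha.2 hb.2
    convert! this using 2 with m
    ring

theorem neg {N : ℕ} {h a : ℕ → ℝ} (ha : IsSymbol N h a) : IsSymbol N h (fun m => -a m) := by
  induction N generalizing h a with
  | zero => simpa [IsSymbol] using ha
  | succ N ih =>
    refine ⟨by simpa using ha.1, ?_⟩
    have := ih ha.2
    convert! this using 2 with m
    ring

theorem shift {N : ℕ} {h a : ℕ → ℝ} (H : IsSymbol N h a) (h0 : ∀ m, 0 ≤ h m) {c : ℝ}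
    (hc : 0 ≤ c) (hh : ∀ m, h (m + 1) ≤ c * h m) : IsSymbol N h (fun m => a (m + 1)) := by
  have key : ∀ {h a : ℕ → ℝ} (_ : ∃ C : ℝ, 0 ≤ C ∧ ∀ m, |a m| ≤ C * h m)
      (_ : ∀ m, h (m + 1) ≤ c * h m), ∃ C : ℝ, 0 ≤ C ∧ ∀ m, |a (m + 1)| ≤ C * h m := by
    rintro h a ⟨C, hC, H⟩ hh
    refine ⟨C * c, by positivity, fun m => (H _).trans ?_⟩
    rw [mul_assoc]
    exact mul_le_mul_of_nonneg_left (hh m) hC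
  induction N generalizing h a with
  | zero => exact key H hh
  | succ N ih =>
    refine ⟨key H.1 hh, ih H.2 (fun m => div_nonneg (h0 m) (by positivity)) fun m => ?_⟩
    rw [mul_div_assoc']
    have := hh m
    have := h0 (m + 1)
    push_cast
    gcongr
    · linarith
    · linarith

/-- Discrete Leibniz rule `Δ(ab)(m) = Δa(m) b(m+1) + a(m) Δb(m)`. The shifted factor is the reason
for the condition `hk` on the majorant of `b`. -/
theorem mul {N : ℕ} {h k a b : ℕ → ℝ} (ha : IsSymbol N h a) (hb : IsSymbol N k b)
    (h0 : ∀ m, 0 ≤ h m) (k0 : ∀ m, 0 ≤ k m) {c : ℝ} (hc : 0 ≤ c)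
    (hk : ∀ m, k (m + 1) ≤ c * k m) :
    IsSymbol N (fun m => h m * k m) (fun m => a m * b m) := by
  have key : ∀ {h k a b : ℕ → ℝ} (_ : ∃ C : ℝ, 0 ≤ C ∧ ∀ m, |a m| ≤ C * h m)
      (_ : ∃ C : ℝ, 0 ≤ C ∧ ∀ m, |b m| ≤ C * k m) (_ : ∀ m, 0 ≤ h m),
      ∃ C : ℝ, 0 ≤ C ∧ ∀ m, |a m * b m| ≤ C * (h m * k m) := by
    rintro h k a b ⟨C, hC, H⟩ ⟨D, hD, H'⟩ h0
    refine ⟨C * D, by positivity, fun m => ?_⟩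
    rw [abs_mul, mul_mul_mul_comm]
    exact mul_le_mul (H m) (H' m) (abs_nonneg _) (mul_nonneg hC (h0 m))
  induction N generalizing h k a b with
  | zero => exact key ha hb h0
  | succ N ih =>
    refine ⟨key ha.1 hb.1 h0, ?_⟩
    have h1 := ih ha.2 (hb.pred.shift k0 hc hk) (fun m => div_nonneg (h0 m) (by positivity)) k0 hk
    have h2 := ih ha.pred hb.2 h0 (fun m => div_nonneg (k0 m) (by positivity)) fun m => by
      rw [mul_div_assoc']
      have := hk m
      have := k0 (m + 1)
      push_cast
      gcongr
      · linarith
      · linarith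
    have h1' := h1.of_le (k := fun m => h m * k m / (m + 1)) zero_le_one
      fun m => (by ring_nf; exact le_rfl)
    have h2' := h2.of_le (k := fun m => h m * k m / (m + 1)) zero_le_one
      fun m => (by ring_nf; exact le_rfl)
    have := h1'.add h2'
    convert! this using 2 with m
    ring

theorem zero (N : ℕ) {h : ℕ → ℝ} : IsSymbol N h (fun _ => 0) := by
  induction N generalizing h with
  | zero => exact ⟨0, le_rfl, by simp⟩
  | succ N ih => exact ⟨⟨0, le_rfl, by simp⟩, by simpa using ih⟩

theorem const {N : ℕ} {h : ℕ → ℝ} {b c : ℝ} (hc : 0 ≤ c) (hh : ∀ m, |b| ≤ c * h m) :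
    IsSymbol N h (fun _ => b) := by
  cases N with
  | zero => exact ⟨c, hc, hh⟩
  | succ N => exact ⟨⟨c, hc, hh⟩, by simpa using zero N⟩

theorem natCast_add (N j : ℕ) : IsSymbol N (fun m => (m : ℝ) + 1) (fun m => (m : ℝ) + j) := by
  have hb : ∃ C : ℝ, 0 ≤ C ∧ ∀ m : ℕ, |(m : ℝ) + j| ≤ C * ((m : ℝ) + 1) := by
    refine ⟨j + 1, by positivity, fun m => ?_⟩
    rw [abs_of_nonneg (by positivity)]
    have : (0 : ℝ) ≤ j * m := by positivity
    linarith
  cases N with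
  | zero => exact hb
  | succ N =>
    refine ⟨hb, ?_⟩
    have : IsSymbol N (fun m : ℕ => ((m : ℝ) + 1) / (m + 1)) (fun _ => (1 : ℝ)) := by
      refine const (c := 1) zero_le_one fun m => ?_
      rw [div_self (by positivity)]; simp
    convert! this using 2 with m
    push_cast; ring

/-- Induction on the order through `Δ(1/a)(m) = -Δa(m) · a(m)⁻¹ · a(m+1)⁻¹`, a product of symbols of
lower order; the lower bound `hca` starts it. -/
theorem inv {N : ℕ} {h a : ℕ → ℝ} (ha : IsSymbol N h a) (h0 : ∀ m, 0 < h m) {c d : ℝ}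
    (hc : 0 < c) (hca : ∀ m, c * h m ≤ a m) (hd : 0 ≤ d) (hh : ∀ m, h m ≤ d * h (m + 1)) :
    IsSymbol N (fun m => (h m)⁻¹) (fun m => (a m)⁻¹) := by
  have ha0 : ∀ m, 0 < a m := fun m => (mul_pos hc (h0 m)).trans_le (hca m)
  have hb : ∃ C : ℝ, 0 ≤ C ∧ ∀ m, |(a m)⁻¹| ≤ C * (h m)⁻¹ := by
    refine ⟨c⁻¹, by positivity, fun m => ?_⟩
    rw [abs_of_pos (inv_pos.2 (ha0 m)), ← mul_inv]
    exact inv_anti₀ (mul_pos hc (h0 m)) (hca m)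
  have hs : ∀ m, (h (m + 1))⁻¹ ≤ d * (h m)⁻¹ := fun m => by
    rw [← div_eq_mul_inv, le_div_iff₀ (h0 m), inv_mul_le_iff₀ (h0 _), mul_comm]
    exact hh m
  have hpos : ∀ m, 0 ≤ (h m)⁻¹ := fun m => inv_nonneg.2 (h0 m).le
  induction N with
  | zero => exact hb
  | succ N ih =>
    refine ⟨hb, ?_⟩
    have hl := ih ha.pred
    have h1 := (ha.2.neg.mul hl (fun m => div_nonneg (h0 m).le (by positivity)) hpos hd hs).mul
      (hl.shift hpos hd hs) (fun m => mul_nonneg (div_nonneg (h0 m).le (by positivity)) (hpos m))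
      hpos hd hs
    have h2 := h1.of_le (k := fun m => (h m)⁻¹ / (m + 1)) zero_le_one fun m => by
      have := (h0 m).ne'
      field_simp
      exact le_rfl
    convert! h2 using 2 with m
    have := (ha0 m).ne'
    have := (ha0 (m + 1)).ne'
    field_simp
    ring

theorem ascFactorial (N n : ℕ) :
    IsSymbol N (fun m => ((m : ℝ) + 1) ^ n) (fun m => ((m + 1).ascFactorial n : ℝ)) := by
  induction n with
  | zero => simpa using const (N := N) (h := fun _ => (1 : ℝ)) (b := 1) (c := 1) zero_le_one (by simp)
  | succ n ih =>
    have h1 := (natCast_add N (n + 1)).mul ih (fun m => by positivity) (fun m => by positivity)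
      (c := 2 ^ n) (by positivity) fun m => by
        rw [← mul_pow]
        push_cast
        gcongr
        linarith [show (0 : ℝ) ≤ m by positivity]
    have h2 := h1.of_le (k := fun m => ((m : ℝ) + 1) ^ (n + 1)) zero_le_one fun m => by
      rw [pow_succ, one_mul, mul_comm]
    convert! h2 using 2 with m
    rw [Nat.ascFactorial_succ]
    push_cast; ring

theorem fwdDiff_bound {N : ℕ} {h a : ℕ → ℝ} (H : IsSymbol N h a) (h0 : ∀ m, 0 ≤ h m) :
    ∃ C : ℝ, 0 ≤ C ∧ ∀ i ≤ N, ∀ m, |(fwdDiff 1)^[i] a m| ≤ C * h m / (m + 1) ^ i := by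
  induction N generalizing h a with
  | zero =>
    obtain ⟨C, hC, H⟩ := H
    exact ⟨C, hC, fun i hi m => by simpa [Nat.le_zero.1 hi] using H m⟩
  | succ N ih =>
    obtain ⟨C, hC, H1⟩ := H.1
    obtain ⟨D, hD, H2⟩ := ih H.2 fun m => div_nonneg (h0 m) (by positivity)
    refine ⟨max C D, le_max_of_le_left hC, fun i hi m => ?_⟩
    have := h0 m
    rcases i with _ | i
    · simp only [Function.iterate_zero, id, pow_zero, div_one]
      exact (H1 m).trans (mul_le_mul_of_nonneg_right (le_max_left _ _) this)
    · rw [Function.iterate_succ_apply, show fwdDiff 1 a = fun m => a (m + 1) - a m from rfl]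
      refine (H2 i (by omega) m).trans ?_
      rw [pow_succ', mul_div_assoc, div_div, mul_div_assoc]
      gcongr
      exact le_max_right _ _

end IsSymbol

/-! ### Moments of a doubling weight satisfy symbol estimates. -/

theorem integral_le_of_lintegral_le {α : Type*} [MeasurableSpace α] {μ : Measure α} {f : α → ℝ}
    (hf : 0 ≤ᵐ[μ] f) (hm : AEStronglyMeasurable f μ) {B : ℝ} (hB : 0 ≤ B)
    (h : ∫⁻ x, ENNReal.ofReal (f x) ∂μ ≤ ENNReal.ofReal B) : ∫ x, f x ∂μ ≤ B := by
  rw [integral_eq_lintegral_of_nonneg_ae hf hm]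
  exact ENNReal.toReal_le_of_le_ofReal hB h

namespace IsDoublingWeight

variable {ν : ℂ → ℝ}

theorem node_mem (m : ℕ) : 1 - 1 / ((m : ℝ) + 1) ∈ Ico (0 : ℝ) 1 := by
  have h : (0 : ℝ) < m + 1 := by positivity
  have h1 : 1 / ((m : ℝ) + 1) ≤ 1 := (div_le_one h).2 (by linarith [show (0 : ℝ) ≤ m by positivity])
  have h2 : 0 < 1 / ((m : ℝ) + 1) := by positivity
  constructor <;> linarith

/-- The factor `r ^ (2 * m)` concentrates at distance `1/(m+1)` from 1, where `1 - r ^ 2` has size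
`1/(m+1)`. With `u = (m+1)(1-r)` one has `r ^ (2 * m) ≤ e^{1-u}`, and the exponential absorbs every
power of `u`. What remains is the integral of `((1 - a) / (1 - a r)) ^ s`, known from
`exists_exponent`. -/
theorem integral_pow_mul_le (hν : IsDoublingWeight ν) (i : ℕ) :
    ∃ C : ℝ, 0 ≤ C ∧ ∀ m : ℕ, ∫ r, r ^ (2 * m) * (1 - r ^ 2) ^ i ∂radialMeasure ν
      ≤ C * tailIntegral ν (1 - 1 / ((m : ℝ) + 1)) / (m + 1) ^ i := by
  have hR := hν.toIsRadialWeight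
  obtain ⟨s, C, hs1, hC1, -, hC⟩ := hν.exists_exponent
  set E : ℝ := Real.exp 2 * 2 ^ i * (i + s).factorial with hE
  have hE0 : 0 < E := by positivity
  refine ⟨E * C, by positivity, fun m => ?_⟩
  set a : ℝ := 1 - 1 / ((m : ℝ) + 1) with ha
  have ham := node_mem m
  rw [← ha] at ham
  have hτ := hR.tail_pos a ham
  have hm1 : (0 : ℝ) < m + 1 := by positivity
  have h1a : 1 - a = 1 / (m + 1) := by simp [ha]
  have hpt : ∀ r ∈ Ioo (0 : ℝ) 1, r ^ (2 * m) * (1 - r ^ 2) ^ i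
      ≤ E * ((m : ℝ) + 1)⁻¹ ^ i * (1 - a) ^ s * ((1 - a * r) ^ s)⁻¹ := by
    intro r hr
    set u : ℝ := (m + 1) * (1 - r) with hu
    have hu0 : 0 ≤ u := mul_nonneg hm1.le (by linarith [hr.2])
    have har : 0 < 1 - a * r := by nlinarith [hr.1, hr.2, ham.1, ham.2]
    have h2 : 1 - a * r ≤ (1 - a) * (u + 1) := by
      have : (1 - a) * u = 1 - r := by rw [h1a, hu]; field_simp
      nlinarith [hr.1, hr.2, ham.2]
    have h3 : r ^ (2 * m) ≤ Real.exp (1 - u) := by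
      have hr' : r ≤ Real.exp (-(1 - r)) := by
        have := Real.add_one_le_exp (-(1 - r)); linarith
      calc r ^ (2 * m) ≤ Real.exp (-(1 - r)) ^ (2 * m) := pow_le_pow_left₀ hr.1.le hr' _
        _ = Real.exp (-((2 * m : ℕ) * (1 - r))) := by rw [← Real.exp_nat_mul]; congr 1; ring
        _ ≤ Real.exp (1 - u) := by
            apply Real.exp_le_exp.2
            push_cast
            have : (0 : ℝ) ≤ m := by positivity
            rw [hu]
            nlinarith [hr.1, hr.2, mul_nonneg this (by linarith [hr.2] : 0 ≤ 1 - r)]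
    have h4 : (1 - r ^ 2) ^ i ≤ 2 ^ i * (u * ((m : ℝ) + 1)⁻¹) ^ i := by
      rw [← mul_pow]
      have : u * ((m : ℝ) + 1)⁻¹ = 1 - r := by rw [hu]; field_simp
      rw [this]
      refine pow_le_pow_left₀ (by nlinarith [hr.1, hr.2]) (by nlinarith [hr.1, hr.2]) _
    have h5 : (u + 1) ^ (i + s) ≤ (i + s).factorial * Real.exp (u + 1) := by
      have := Real.pow_div_factorial_le_exp (u + 1) (by linarith) (i + s)
      rwa [div_le_iff₀' (by positivity)] at this
    rw [← div_eq_mul_inv, le_div_iff₀ (by positivity)]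
    calc r ^ (2 * m) * (1 - r ^ 2) ^ i * (1 - a * r) ^ s
        ≤ Real.exp (1 - u) * (2 ^ i * (u * ((m : ℝ) + 1)⁻¹) ^ i) * ((1 - a) * (u + 1)) ^ s := by
          gcongr
          exact pow_nonneg (by nlinarith [hr.1, hr.2]) _
      _ = Real.exp (1 - u) * 2 ^ i * ((m : ℝ) + 1)⁻¹ ^ i * (1 - a) ^ s *
            (u ^ i * (u + 1) ^ s) := by
          rw [mul_pow u, mul_pow (1 - a)]; ring
      _ ≤ Real.exp (1 - u) * 2 ^ i * ((m : ℝ) + 1)⁻¹ ^ i * (1 - a) ^ s *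
            ((i + s).factorial * Real.exp (u + 1)) := by
          have : 0 ≤ 1 - a := by linarith [ham.2]
          refine mul_le_mul_of_nonneg_left ?_ (by positivity)
          refine le_trans ?_ h5
          rw [pow_add]
          gcongr
          linarith
      _ = E * ((m : ℝ) + 1)⁻¹ ^ i * (1 - a) ^ s := by
          have : Real.exp 2 = Real.exp (1 - u) * Real.exp (u + 1) := by
            rw [← Real.exp_add]; congr 1; ring
          rw [hE, this]; ring
  have h1a0 : 0 < 1 - a := by linarith [ham.2]
  refine integral_le_of_lintegral_le ?_ (by fun_prop) (by positivity) ?_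
  · filter_upwards [IsRadialWeight.radialMeasure_ae ν] with r hr
    have : 0 ≤ 1 - r ^ 2 := by nlinarith [hr.1, hr.2]
    have := hr.1
    simp only [Pi.zero_apply]
    positivity
  · calc ∫⁻ r, ENNReal.ofReal (r ^ (2 * m) * (1 - r ^ 2) ^ i) ∂radialMeasure ν
        ≤ ∫⁻ r, ENNReal.ofReal (E * ((m : ℝ) + 1)⁻¹ ^ i * (1 - a) ^ s) *
            ENNReal.ofReal (((1 - a * r) ^ s)⁻¹) ∂radialMeasure ν := by
          refine lintegral_mono_ae ?_
          filter_upwards [IsRadialWeight.radialMeasure_ae ν] with r hr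
          rw [← ENNReal.ofReal_mul (by positivity)]
          exact ENNReal.ofReal_le_ofReal (hpt r hr)
      _ ≤ ENNReal.ofReal (E * ((m : ℝ) + 1)⁻¹ ^ i * (1 - a) ^ s) *
            ENNReal.ofReal (C * tailIntegral ν a * ((1 - a) ^ s)⁻¹) := by
          rw [lintegral_const_mul' _ _ ENNReal.ofReal_ne_top]
          exact mul_le_mul_right (hC a ham) _
      _ = ENNReal.ofReal (E * C * tailIntegral ν a / (m + 1) ^ i) := by
          rw [← ENNReal.ofReal_mul (by positivity)]
          congr 1
          rw [inv_pow]
          field_simp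

/-- For `m ≥ 1` the node `a = 1 - 1/(m+1)` is at least `e^{-1/m}`, so `r ^ (2 * m) ≥ e^{-2}` on `(a,
1)`; the mass of this interval is comparable to the tail at `a`. -/
theorem le_radialMoment (hν : IsDoublingWeight ν) :
    ∃ c : ℝ, 0 < c ∧ ∀ m : ℕ, c * tailIntegral ν (1 - 1 / ((m : ℝ) + 1)) ≤ radialMoment ν m := by
  have hR := hν.toIsRadialWeight
  obtain ⟨C, hC1, hC⟩ := hν.radialMeasure_Ioo_ge
  have hfin := hR.isFiniteMeasure_radialMeasure
  refine ⟨Real.exp (-2) * C⁻¹, by positivity, fun m => ?_⟩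
  set a : ℝ := 1 - 1 / ((m : ℝ) + 1) with ha
  have ham := node_mem m
  rw [← ha] at ham
  have hm1 : (0 : ℝ) < m + 1 := by positivity
  have hpow : Real.exp (-2) ≤ a ^ (2 * m) := by
    rcases Nat.eq_zero_or_pos m with h | h
    · subst h; simp
    · have hm : (0 : ℝ) < m := by exact_mod_cast h
      have h1 : Real.exp (-(1 / m)) ≤ a := by
        rw [Real.exp_neg, inv_le_comm₀ (Real.exp_pos _)]
        · have := Real.add_one_le_exp (1 / (m : ℝ))
          refine le_trans (le_of_eq ?_) this
          rw [ha, show 1 - 1 / ((m : ℝ) + 1) = m / (m + 1) by field_simp; ring, inv_div]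
          field_simp
          ring
        · rw [ha, show 1 - 1 / ((m : ℝ) + 1) = m / (m + 1) by field_simp; ring]
          positivity
      calc Real.exp (-2) = Real.exp (-(1 / m)) ^ (2 * m) := by
            rw [← Real.exp_nat_mul]; congr 1; push_cast; field_simp
        _ ≤ a ^ (2 * m) := pow_le_pow_left₀ (Real.exp_pos _).le h1 _
  have h1 : tailIntegral ν a ≤ C * (radialMeasure ν).real (Ioo a 1) := by
    have := hC a ham
    rw [ENNReal.ofReal_le_iff_le_toReal (by finiteness), ENNReal.toReal_mul,
      ENNReal.toReal_ofReal (by linarith)] at this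
    exact this
  have h2 : Real.exp (-2) * (radialMeasure ν).real (Ioo a 1) ≤ radialMoment ν m := by
    calc Real.exp (-2) * (radialMeasure ν).real (Ioo a 1)
        = ∫ r in Ioo a 1, Real.exp (-2) ∂radialMeasure ν := by simp [mul_comm]
      _ ≤ ∫ r in Ioo a 1, r ^ (2 * m) ∂radialMeasure ν := by
          refine setIntegral_mono_on (integrable_const _).integrableOn
            (hR.integrable_pow _).integrableOn measurableSet_Ioo fun r hr => ?_
          exact hpow.trans (pow_le_pow_left₀ ham.1 hr.1.le _)
      _ ≤ radialMoment ν m := by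
          refine setIntegral_le_integral (hR.integrable_pow _) ?_
          filter_upwards [IsRadialWeight.radialMeasure_ae ν] with r hr
          exact pow_nonneg hr.1.le _
  refine le_trans ?_ h2
  rw [mul_assoc]
  refine mul_le_mul_of_nonneg_left ?_ (Real.exp_pos _).le
  rw [inv_mul_le_iff₀ (by linarith)]
  exact h1

theorem tail_node_le (hν : IsDoublingWeight ν) :
    ∃ (s : ℕ) (C : ℝ), 1 ≤ s ∧ 1 ≤ C ∧ ∀ m k : ℕ, tailIntegral ν (1 - 1 / ((m : ℝ) + 1))
      ≤ C * (((m + k : ℕ) + 1) / (m + 1)) ^ s *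
        tailIntegral ν (1 - 1 / (((m + k : ℕ) : ℝ) + 1)) := by
  obtain ⟨s, C, hs, hC, h, -⟩ := hν.exists_exponent
  refine ⟨s, C, hs, hC, fun m k => ?_⟩
  refine (h _ (1 - 1 / (((m + k : ℕ) : ℝ) + 1)) (node_mem m).1 ?_ (node_mem _).2).trans_eq ?_
  · push_cast
    have : (0 : ℝ) ≤ k := by positivity
    gcongr
    linarith
  · congr 3
    have : (((m + k : ℕ) : ℝ) + 1) ≠ 0 := by positivity
    field_simp
    ring

theorem tail_node_anti (hν : IsDoublingWeight ν) {m k : ℕ} (h : m ≤ k) :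
    tailIntegral ν (1 - 1 / ((k : ℝ) + 1)) ≤ tailIntegral ν (1 - 1 / ((m : ℝ) + 1)) := by
  refine hν.toIsRadialWeight.tailIntegral_anti (node_mem m).1 ?_ (node_mem k).2.le
  gcongr

theorem tail_node_pos (hν : IsDoublingWeight ν) (m : ℕ) :
    0 < tailIntegral ν (1 - 1 / ((m : ℝ) + 1)) :=
  hν.tail_pos _ (node_mem m)

/-- A difference in `m` puts the factor `-(1 - r ^ 2)` into the integrand. The family of integrals
with `(1 - r ^ 2) ^ i` is therefore closed under differences, and the induction runs over all `i` at
once. -/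
theorem isSymbol_radialMoment (hν : IsDoublingWeight ν) (N : ℕ) :
    IsSymbol N (fun m => tailIntegral ν (1 - 1 / ((m : ℝ) + 1))) (radialMoment ν) := by
  have hR := hν.toIsRadialWeight
  have key : ∀ N i : ℕ, IsSymbol N
      (fun m => tailIntegral ν (1 - 1 / ((m : ℝ) + 1)) / (m + 1) ^ i)
      (fun m => ∫ r, r ^ (2 * m) * (1 - r ^ 2) ^ i ∂radialMeasure ν) := by
    intro N
    have hb : ∀ i : ℕ, ∃ C : ℝ, 0 ≤ C ∧ ∀ m : ℕ,
        |∫ r, r ^ (2 * m) * (1 - r ^ 2) ^ i ∂radialMeasure ν|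
          ≤ C * (tailIntegral ν (1 - 1 / ((m : ℝ) + 1)) / (m + 1) ^ i) := by
      intro i
      obtain ⟨C, hC, h⟩ := hν.integral_pow_mul_le i
      refine ⟨C, hC, fun m => ?_⟩
      rw [abs_of_nonneg, mul_div_assoc']
      · exact h m
      · refine integral_nonneg_of_ae ?_
        filter_upwards [IsRadialWeight.radialMeasure_ae ν] with r hr
        have : 0 ≤ 1 - r ^ 2 := by nlinarith [hr.1, hr.2]
        have := hr.1
        simp only [Pi.zero_apply]
        positivity
    have hfin := hR.isFiniteMeasure_radialMeasure
    have hint : ∀ m i : ℕ, Integrable (fun r : ℝ => r ^ (2 * m) * (1 - r ^ 2) ^ i)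
        (radialMeasure ν) := by
      intro m i
      refine Integrable.of_bound (by fun_prop) 1 ?_
      filter_upwards [IsRadialWeight.radialMeasure_ae ν] with r hr
      have h1 : 0 ≤ 1 - r ^ 2 := by nlinarith [hr.1, hr.2]
      have h2 := hr.1
      rw [Real.norm_of_nonneg (by positivity)]
      exact mul_le_one₀ (pow_le_one₀ hr.1.le hr.2.le) (by positivity)
        (pow_le_one₀ h1 (by nlinarith [hr.1]))
    induction N with
    | zero => exact hb
    | succ N ih =>
      intro i
      refine ⟨hb i, ?_⟩
      have h1 := (ih (i + 1)).neg.of_le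
        (k := fun m => tailIntegral ν (1 - 1 / ((m : ℝ) + 1)) / (m + 1) ^ i / (m + 1))
        zero_le_one fun m => by rw [one_mul, div_div, pow_succ]
      convert! h1 using 2 with m
      rw [← integral_sub (hint _ _) (hint _ _), ← integral_neg]
      congr 1 with r
      ring
  have := key N 0
  simp only [pow_zero, div_one, mul_one] at this
  exact this

end IsDoublingWeight

/-! ### Kernel coefficients and summation by parts. -/

/-- The coefficients of the `n`-th derivative of `w ↦ ∑ wᵐ / ∫|ζ|^{2m}ν dA`. -/
def kernelCoeff (ν : ℂ → ℝ) (n m : ℕ) : ℝ :=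
  (radialMoment ν (m + n))⁻¹ * ((m + 1).ascFactorial n : ℝ)

theorem IsDoublingWeight.isSymbol_kernelCoeff {ν : ℂ → ℝ} (hν : IsDoublingWeight ν) (N n : ℕ) :
    IsSymbol N (fun m => (tailIntegral ν (1 - 1 / ((m : ℝ) + 1)))⁻¹ * ((m : ℝ) + 1) ^ n)
      (kernelCoeff ν n) := by
  obtain ⟨c, hc, hcm⟩ := hν.le_radialMoment
  obtain ⟨s, C, hs, hC, hstep⟩ := hν.tail_node_le
  have hd : ∀ m : ℕ, tailIntegral ν (1 - 1 / ((m : ℝ) + 1))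
      ≤ C * 2 ^ s * tailIntegral ν (1 - 1 / (((m + 1 : ℕ) : ℝ) + 1)) := by
    intro m
    refine (hstep m 1).trans ?_
    have := hν.tail_node_pos (m + 1)
    gcongr
    rw [div_le_iff₀ (by positivity)]
    push_cast
    linarith [show (0 : ℝ) ≤ m by positivity]
  have hpos : ∀ m : ℕ, 0 ≤ (tailIntegral ν (1 - 1 / ((m : ℝ) + 1)))⁻¹ := fun m =>
    (inv_pos.2 (hν.tail_node_pos m)).le
  have hsh : ∀ m : ℕ, (tailIntegral ν (1 - 1 / (((m + 1 : ℕ) : ℝ) + 1)))⁻¹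
      ≤ C * 2 ^ s * (tailIntegral ν (1 - 1 / ((m : ℝ) + 1)))⁻¹ := fun m => by
    rw [← div_eq_mul_inv, le_div_iff₀ (hν.tail_node_pos m),
      inv_mul_le_iff₀ (hν.tail_node_pos _), mul_comm]
    exact hd m
  have h1 : IsSymbol N (fun m => (tailIntegral ν (1 - 1 / ((m : ℝ) + 1)))⁻¹)
      (fun m => (radialMoment ν m)⁻¹) :=
    (hν.isSymbol_radialMoment N).inv hν.tail_node_pos hc hcm (by positivity) hd
  have h2 : IsSymbol N (fun m => (tailIntegral ν (1 - 1 / ((m : ℝ) + 1)))⁻¹)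
      (fun m => (radialMoment ν (m + n))⁻¹) := by
    induction n with
    | zero => simpa using h1
    | succ n ih =>
      have := ih.shift hpos (by positivity) hsh
      convert! this using 3 with m
      congr 1; ring
  exact h2.mul (IsSymbol.ascFactorial N n) hpos (fun m => by positivity) (c := 2 ^ n)
    (by positivity) fun m => by
      rw [← mul_pow]
      push_cast
      gcongr
      linarith [show (0 : ℝ) ≤ m by positivity]

theorem summable_mul_pow_of_poly {b : ℕ → ℝ} {C : ℝ} {k : ℕ}
    (hb : ∀ m : ℕ, |b m| ≤ C * ((m : ℝ) + 1) ^ k) {ρ : ℝ} (h0 : 0 ≤ ρ) (h1 : ρ < 1) :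
    Summable fun m => |b m| * ρ ^ m := by
  have hs : Summable fun m : ℕ => ((m : ℝ) + 1) ^ k * ρ ^ m := by
    rcases h0.eq_or_lt with h | h
    · refine summable_of_ne_finset_zero (s := {0}) fun m hm => ?_
      rw [← h, zero_pow (by simpa using hm), mul_zero]
    · have := summable_pow_mul_geometric_of_norm_lt_one (R := ℝ) k
        (r := ρ) (by rwa [Real.norm_of_nonneg h0])
      have := ((summable_nat_add_iff 1).2 this).mul_left ρ⁻¹
      refine this.congr fun m => ?_
      rw [pow_succ]
      push_cast
      field_simp
  refine Summable.of_nonneg_of_le (fun m => by positivity) (fun m => ?_) (hs.mul_left C)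
  rw [← mul_assoc]
  exact mul_le_mul_of_nonneg_right (hb m) (by positivity)

/-- Iterated summation by parts for power series. -/
theorem norm_tsum_mul_pow_le {w : ℂ} (hw : ‖w‖ < 1) (M : ℕ) {b : ℕ → ℝ} {C : ℝ} {k : ℕ}
    (hb : ∀ m : ℕ, |b m| ≤ C * ((m : ℝ) + 1) ^ k)
    (hM : Summable fun m => |(fwdDiff 1)^[M] b m|) :
    ‖∑' m, (b m : ℂ) * w ^ m‖ ≤ ∑ i ∈ Finset.range M, |(fwdDiff 1)^[i] b 0| * ‖1 - w‖⁻¹ ^ (i + 1)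
      + ‖1 - w‖⁻¹ ^ M * ∑' m, |(fwdDiff 1)^[M] b m| := by
  have hX : 0 < ‖1 - w‖ := by
    rw [norm_pos_iff, sub_ne_zero]
    rintro rfl
    simp at hw
  have hsum : ∀ {b : ℕ → ℝ} {C : ℝ} (_ : ∀ m : ℕ, |b m| ≤ C * ((m : ℝ) + 1) ^ k),
      Summable fun m => (b m : ℂ) * w ^ m := fun hb => by
    refine Summable.of_norm ?_
    simpa using summable_mul_pow_of_poly hb (norm_nonneg w) hw
  induction M generalizing b C with
  | zero =>
    simp only [Finset.range_zero, Finset.sum_empty, zero_add, pow_zero, one_mul,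
      Function.iterate_zero, id] at hM ⊢
    refine tsum_of_norm_bounded hM.hasSum fun m => ?_
    rw [norm_mul, norm_pow, Complex.norm_real]
    exact mul_le_of_le_one_right (norm_nonneg _) (pow_le_one₀ (norm_nonneg _) hw.le)
  | succ M ih =>
    have hC : 0 ≤ C := by
      have := (abs_nonneg _).trans (hb 0)
      simpa using this
    have hshift : ∀ m : ℕ, |b (m + 1)| ≤ C * 2 ^ k * ((m : ℝ) + 1) ^ k := fun m => by
      refine (hb _).trans ?_
      rw [mul_assoc, ← mul_pow]
      push_cast
      gcongr
      linarith [show (0 : ℝ) ≤ m by positivity]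
    have hdiff : ∀ m : ℕ, |fwdDiff 1 b m| ≤ (C * 2 ^ k + C) * ((m : ℝ) + 1) ^ k := fun m => by
      refine (abs_sub _ _).trans ?_
      rw [add_mul]
      exact add_le_add (hshift m) (hb m)
    -- One summation by parts: a factor `1 - w` is traded for a difference of the coefficients and
    -- one boundary term.
    have hrec : (1 - w) * ∑' m, (b m : ℂ) * w ^ m
        = b 0 + w * ∑' m, ((fwdDiff 1 b m : ℝ) : ℂ) * w ^ m := by
      have h1 := (hsum hb).tsum_eq_zero_add
      have h2 : ∑' m, ((fwdDiff 1 b m : ℝ) : ℂ) * w ^ m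
          = ∑' m, (b (m + 1) : ℂ) * w ^ m - ∑' m, (b m : ℂ) * w ^ m := by
        rw [← (hsum hshift).tsum_sub (hsum hb)]
        congr 1 with m
        simp only [fwdDiff]
        push_cast; ring
      have h3 : ∑' m, (b (m + 1) : ℂ) * w ^ (m + 1) = w * ∑' m, (b (m + 1) : ℂ) * w ^ m := by
        rw [← tsum_mul_left]
        congr 1 with m
        ring
      rw [h3] at h1
      rw [h2]
      simp only [pow_zero, mul_one] at h1
      linear_combination h1
    have hih := ih hdiff (by simpa only [Function.iterate_succ_apply] using hM)
    simp only [← Function.iterate_succ_apply] at hih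
    have h4 : ‖∑' m, (b m : ℂ) * w ^ m‖
        ≤ ‖1 - w‖⁻¹ * (|b 0| + ‖∑' m, ((fwdDiff 1 b m : ℝ) : ℂ) * w ^ m‖) := by
      rw [← div_eq_inv_mul, le_div_iff₀ hX, mul_comm, ← norm_mul, hrec]
      refine (norm_add_le _ _).trans ?_
      rw [Complex.norm_real, norm_mul, Real.norm_eq_abs]
      gcongr
      exact mul_le_of_le_one_left (norm_nonneg _) hw.le
    refine h4.trans ?_
    rw [Finset.sum_range_succ']
    have h5 := mul_le_mul_of_nonneg_left hih (inv_nonneg.2 hX.le)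
    rw [mul_add, Finset.mul_sum] at h5
    rw [mul_add]
    simp only [Function.iterate_zero, id, zero_add, pow_one]
    refine (add_le_add_right h5 _).trans_eq ?_
    have h6 : ∀ i ∈ Finset.range M, ‖1 - w‖⁻¹ * (|(fwdDiff 1)^[i + 1] b 0| * ‖1 - w‖⁻¹ ^ (i + 1))
        = |(fwdDiff 1)^[i + 1] b 0| * ‖1 - w‖⁻¹ ^ (i + 1 + 1) := fun i _ => by ring
    rw [Finset.sum_congr rfl h6]
    ring

/-- Telescoping, from `(x+1)⁻² ≤ 2 (x+1)⁻¹ - 2 (x+2)⁻¹` for `x ≥ 0`. -/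
theorem tsum_inv_sq_le (m : ℕ) :
    Summable (fun k : ℕ => (((m + k : ℕ) : ℝ) + 1)⁻¹ ^ 2) ∧
      ∑' k : ℕ, (((m + k : ℕ) : ℝ) + 1)⁻¹ ^ 2 ≤ 2 * ((m : ℝ) + 1)⁻¹ := by
  have hpart : ∀ n : ℕ, ∑ k ∈ Finset.range n, (((m + k : ℕ) : ℝ) + 1)⁻¹ ^ 2
      ≤ 2 * ((m : ℝ) + 1)⁻¹ - 2 * (((m + n : ℕ) : ℝ) + 1)⁻¹ := by
    intro n
    induction n with
    | zero => simp
    | succ n ih =>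
      rw [Finset.sum_range_succ]
      have h : (((m + n : ℕ) : ℝ) + 1)⁻¹ ^ 2
          ≤ 2 * (((m + n : ℕ) : ℝ) + 1)⁻¹ - 2 * (((m + (n + 1) : ℕ) : ℝ) + 1)⁻¹ := by
        set x : ℝ := ((m + n : ℕ) : ℝ) with hx
        have hx0 : 0 ≤ x := by positivity
        have : (((m + (n + 1) : ℕ) : ℝ) + 1) = x + 2 := by rw [hx]; push_cast; ring
        rw [this]
        have h1 : 2 * (x + 1)⁻¹ - 2 * (x + 2)⁻¹ = 2 / ((x + 1) * (x + 2)) := by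
          field_simp; ring
        rw [h1, inv_pow, inv_eq_one_div, div_le_div_iff₀ (by positivity) (by positivity)]
        nlinarith
      linarith
  have hle : ∀ n : ℕ, ∑ k ∈ Finset.range n, (((m + k : ℕ) : ℝ) + 1)⁻¹ ^ 2
      ≤ 2 * ((m : ℝ) + 1)⁻¹ := fun n => (hpart n).trans (by
        have : 0 ≤ 2 * (((m + n : ℕ) : ℝ) + 1)⁻¹ := by positivity
        linarith)
  exact ⟨summable_of_sum_range_le (fun k => by positivity) hle,
    Real.tsum_le_of_sum_range_le (fun k => by positivity) hle⟩

/-! ### Pointwise estimates of the kernel. -/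

/-- The `n`-th derivative of `w ↦ ∑ wᵐ / ∫|ζ|^{2m}ν dA`. -/
def kernelSeries (ν : ℂ → ℝ) (n : ℕ) (w : ℂ) : ℂ := ∑' m, (kernelCoeff ν n m : ℂ) * w ^ m

namespace IsDoublingWeight

variable {ν : ℂ → ℝ}

theorem kernelCoeff_poly (hν : IsDoublingWeight ν) (n : ℕ) :
    ∃ (C : ℝ) (k : ℕ), ∀ m : ℕ, |kernelCoeff ν n m| ≤ C * ((m : ℝ) + 1) ^ k := by
  obtain ⟨C, hC, h⟩ := (hν.isSymbol_kernelCoeff 0 n).bound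
  obtain ⟨s, D, hs, hD, hstep⟩ := hν.tail_node_le
  have h0 := hν.tail_node_pos 0
  refine ⟨C * (D * (tailIntegral ν (1 - 1 / (((0 : ℕ) : ℝ) + 1)))⁻¹), s + n, fun m =>
    (h m).trans ?_⟩
  rw [mul_assoc C]
  refine mul_le_mul_of_nonneg_left ?_ hC
  rw [pow_add, ← mul_assoc]
  refine mul_le_mul_of_nonneg_right ?_ (by positivity)
  have h1 := hstep 0 m
  have hm := hν.tail_node_pos m
  simp only [zero_add] at h1
  rw [inv_le_iff_one_le_mul₀ hm]
  have h2 : ((m : ℝ) + 1) / (((0 : ℕ) : ℝ) + 1) = m + 1 := by simp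
  rw [h2] at h1
  rw [show D * (tailIntegral ν (1 - 1 / (((0 : ℕ) : ℝ) + 1)))⁻¹ * ((m : ℝ) + 1) ^ s *
      tailIntegral ν (1 - 1 / ((m : ℝ) + 1)) = (tailIntegral ν (1 - 1 / (((0 : ℕ) : ℝ) + 1)))⁻¹ *
      (D * ((m : ℝ) + 1) ^ s * tailIntegral ν (1 - 1 / ((m : ℝ) + 1))) by ring,
    ← div_eq_inv_mul, le_div_iff₀ h0, one_mul]
  exact h1

theorem summable_kernelCoeff (hν : IsDoublingWeight ν) (n : ℕ) {ρ : ℝ} (h0 : 0 ≤ ρ) (h1 : ρ < 1) :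
    Summable fun m => |kernelCoeff ν n m| * ρ ^ m := by
  obtain ⟨C, k, h⟩ := hν.kernelCoeff_poly n
  exact summable_mul_pow_of_poly h h0 h1

/-- The series is cut at `m₀ ≈ 1/|1-w|`. Below the cut there is no useful cancellation and the terms
are summed by their size; above it, summation by parts started at `m₀` costs `|1-w|⁻¹ ≤ m₀ + 1` per
step and gains the same factor from each difference. -/
theorem norm_kernelSeries_le_node (hν : IsDoublingWeight ν) (n : ℕ) :
    ∃ C : ℝ, 0 ≤ C ∧ ∀ w : ℂ, ‖w‖ < 1 → ∀ m₀ : ℕ, m₀ ≤ ‖1 - w‖⁻¹ → ‖1 - w‖⁻¹ ≤ m₀ + 1 →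
      ‖kernelSeries ν n w‖
        ≤ C * (tailIntegral ν (1 - 1 / ((m₀ : ℝ) + 1)))⁻¹ * ((m₀ : ℝ) + 1) ^ (n + 1) := by
  obtain ⟨s, D, hs, hD, hstep⟩ := hν.tail_node_le
  obtain ⟨Cp, kp, hpoly⟩ := hν.kernelCoeff_poly n
  -- The coefficient grows like `m ^ n` over the tail, and the reciprocal tail like `m ^ s` at most,
  -- so `M` differences leave the summable `m ^ (-2)`.
  set M := n + s + 2 with hM
  obtain ⟨C, hC, hbd⟩ := (hν.isSymbol_kernelCoeff M n).fwdDiff_bound fun m =>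
    mul_nonneg (inv_nonneg.2 (hν.tail_node_pos m).le) (by positivity)
  refine ⟨C + M * C + 2 * (C * D), by positivity, fun w hw m₀ hm1 hm2 => ?_⟩
  have hX : 0 < ‖1 - w‖ := by
    rw [norm_pos_iff, sub_ne_zero]
    rintro rfl
    simp at hw
  set Y := ‖1 - w‖⁻¹ with hY
  set x : ℝ := (m₀ : ℝ) + 1 with hx
  have hx0 : 0 < x := by positivity
  set τ : ℝ := tailIntegral ν (1 - 1 / ((m₀ : ℝ) + 1)) with hτ
  have hτ0 : 0 < τ := hν.tail_node_pos m₀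
  have hsum : Summable fun m => (kernelCoeff ν n m : ℂ) * w ^ m := by
    refine Summable.of_norm ?_
    simpa using summable_mul_pow_of_poly hpoly (norm_nonneg w) hw
  have hhead : ‖∑ m ∈ Finset.range m₀, (kernelCoeff ν n m : ℂ) * w ^ m‖
      ≤ C * τ⁻¹ * x ^ (n + 1) := by
    have h1 : ∀ m ∈ Finset.range m₀, ‖(kernelCoeff ν n m : ℂ) * w ^ m‖ ≤ C * (τ⁻¹ * x ^ n) := by
      intro m hm
      have hm' := (Finset.mem_range.1 hm).le
      rw [norm_mul, norm_pow, Complex.norm_real, Real.norm_eq_abs]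
      refine (mul_le_of_le_one_right (abs_nonneg _)
        (pow_le_one₀ (norm_nonneg _) hw.le)).trans ?_
      have := hbd 0 (by omega) m
      simp only [Function.iterate_zero, id, pow_zero, div_one] at this
      refine this.trans (mul_le_mul_of_nonneg_left ?_ hC)
      have h2 := hν.tail_node_anti hm'
      have h3 : (m : ℝ) + 1 ≤ x := by
        rw [hx]; gcongr
      gcongr
    refine (norm_sum_le_of_le _ h1).trans ?_
    rw [Finset.sum_const, Finset.card_range, nsmul_eq_mul]
    have : (m₀ : ℝ) ≤ x := by linarith
    calc (m₀ : ℝ) * (C * (τ⁻¹ * x ^ n)) ≤ x * (C * (τ⁻¹ * x ^ n)) := by gcongr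
      _ = _ := by ring
  set b : ℕ → ℝ := fun m => kernelCoeff ν n (m + m₀) with hb
  have hbiter : ∀ i m, (fwdDiff 1)^[i] b m = (fwdDiff 1)^[i] (kernelCoeff ν n) (m + m₀) :=
    fun i m => fwdDiff_iter_comp_add 1 (kernelCoeff ν n) m₀ i m
  have hbpoly : ∀ m : ℕ, |b m| ≤ Cp * ((m₀ : ℝ) + 1) ^ kp * ((m : ℝ) + 1) ^ kp := by
    intro m
    refine (hpoly _).trans ?_
    have hCp : 0 ≤ Cp := by
      have := (abs_nonneg _).trans (hpoly 0)
      simpa using this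
    rw [mul_assoc, ← mul_pow]
    have h1 : (0 : ℝ) ≤ m * m₀ := by positivity
    push_cast
    gcongr
    nlinarith
  have hterm : ∀ m : ℕ, |(fwdDiff 1)^[M] b m|
      ≤ C * D * τ⁻¹ * x⁻¹ ^ s * (((m₀ + m : ℕ) : ℝ) + 1)⁻¹ ^ 2 := by
    intro m
    rw [hbiter, add_comm m m₀]
    refine (hbd M le_rfl (m₀ + m)).trans ?_
    set y : ℝ := ((m₀ + m : ℕ) : ℝ) + 1 with hy
    have hy0 : 0 < y := by positivity
    set σ : ℝ := tailIntegral ν (1 - 1 / (((m₀ + m : ℕ) : ℝ) + 1)) with hσ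
    have hσ0 : 0 < σ := hν.tail_node_pos _
    have h1 : τ ≤ D * (y / x) ^ s * σ := hstep m₀ m
    have h2 : σ⁻¹ ≤ D * (y / x) ^ s * τ⁻¹ := by
      rw [inv_le_iff_one_le_mul₀ hσ0]
      calc (1 : ℝ) = τ * τ⁻¹ := by field_simp
        _ ≤ (D * (y / x) ^ s * σ) * τ⁻¹ := by gcongr
        _ = _ := by ring
    rw [div_le_iff₀ (by positivity)]
    calc C * (σ⁻¹ * y ^ n) ≤ C * (D * (y / x) ^ s * τ⁻¹ * y ^ n) := by gcongr
      _ = C * D * τ⁻¹ * x⁻¹ ^ s * y⁻¹ ^ 2 * y ^ M := by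
          rw [hM, pow_add, pow_add, div_eq_mul_inv, mul_pow]
          field_simp
  obtain ⟨hsq, hsqle⟩ := tsum_inv_sq_le m₀
  have hMsum : Summable fun m => |(fwdDiff 1)^[M] b m| :=
    Summable.of_nonneg_of_le (fun _ => abs_nonneg _) hterm (hsq.mul_left _)
  have htail : ‖∑' m, (b m : ℂ) * w ^ m‖
      ≤ M * (C * τ⁻¹ * x ^ (n + 1)) + 2 * (C * D) * τ⁻¹ * x ^ (n + 1) := by
    refine (norm_tsum_mul_pow_le hw M hbpoly hMsum).trans (add_le_add ?_ ?_)
    · have h1 : ∀ i ∈ Finset.range M, |(fwdDiff 1)^[i] b 0| * Y ^ (i + 1)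
          ≤ C * τ⁻¹ * x ^ (n + 1) := by
        intro i hi
        rw [hbiter, zero_add]
        have h2 := hbd i (Finset.mem_range.1 hi).le m₀
        calc |(fwdDiff 1)^[i] (kernelCoeff ν n) m₀| * Y ^ (i + 1)
            ≤ C * (τ⁻¹ * x ^ n) / x ^ i * x ^ (i + 1) := by gcongr
          _ = C * τ⁻¹ * x ^ (n + 1) := by
              rw [pow_succ, pow_succ]; field_simp
      refine (Finset.sum_le_sum h1).trans_eq ?_
      rw [Finset.sum_const, Finset.card_range, nsmul_eq_mul]
    · calc Y ^ M * ∑' m, |(fwdDiff 1)^[M] b m|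
          ≤ x ^ M * (C * D * τ⁻¹ * x⁻¹ ^ s * (2 * x⁻¹)) := by
            have h3 : ∑' m, |(fwdDiff 1)^[M] b m| ≤ C * D * τ⁻¹ * x⁻¹ ^ s * (2 * x⁻¹) := by
              refine (hMsum.tsum_le_tsum hterm (hsq.mul_left _)).trans ?_
              rw [tsum_mul_left]
              gcongr
            gcongr
        _ = 2 * (C * D) * τ⁻¹ * x ^ (n + 1) := by
            rw [hM, pow_add, pow_add, inv_pow]
            field_simp
            ring
  rw [kernelSeries, ← hsum.sum_add_tsum_nat_add m₀]
  have hw1 : ‖∑' m, (kernelCoeff ν n (m + m₀) : ℂ) * w ^ (m + m₀)‖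
      ≤ ‖∑' m, (b m : ℂ) * w ^ m‖ := by
    have : ∑' m, (kernelCoeff ν n (m + m₀) : ℂ) * w ^ (m + m₀)
        = w ^ m₀ * ∑' m, (b m : ℂ) * w ^ m := by
      rw [← tsum_mul_left]
      congr 1 with m
      rw [pow_add]; ring
    rw [this, norm_mul, norm_pow]
    exact mul_le_of_le_one_left (norm_nonneg _) (pow_le_one₀ (norm_nonneg _) hw.le)
  refine (norm_add_le _ _).trans ((add_le_add hhead (hw1.trans htail)).trans_eq ?_)
  ring

/-- Pointwise kernel estimate. -/
theorem norm_kernelSeries_le (hν : IsDoublingWeight ν) :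
    ∃ β : ℝ, 0 < β ∧ ∀ n : ℕ, ∃ C : ℝ, 0 < C ∧ ∀ (w : ℂ) (r : ℝ), ‖w‖ < 1 → r ∈ Ico (0 : ℝ) 1 →
      1 - r ≤ ‖1 - w‖ → ‖kernelSeries ν n w‖
        ≤ C * (tailIntegral ν r)⁻¹ * (1 - r) ^ β * ‖1 - w‖ ^ (-((n : ℝ) + 1 + β)) := by
  have hR := hν.toIsRadialWeight
  obtain ⟨β, D, hβ, hD, hdecay⟩ := hν.exists_decay
  obtain ⟨s, E, hs, hE, hgrow, -⟩ := hν.exists_exponent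
  refine ⟨β, hβ, fun n => ?_⟩
  obtain ⟨C, hC, hnode⟩ := hν.norm_kernelSeries_le_node n
  set F : ℝ := (D + E * 3 ^ s) * 3 ^ β with hF
  refine ⟨(C + 1) * 3 ^ (n + 1) * F, by positivity, fun w r hw hr hrw => ?_⟩
  have hr1 : 0 < 1 - r := by linarith [hr.2]
  set X := ‖1 - w‖ with hXd
  have hX : 0 < X := hr1.trans_le hrw
  have hX2 : X ≤ 2 := by
    have := norm_sub_le (1 : ℂ) w
    rw [norm_one] at this
    linarith
  set m₀ := ⌊X⁻¹⌋₊ with hm₀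
  have h1 : (m₀ : ℝ) ≤ X⁻¹ := Nat.floor_le (by positivity)
  have h2 : X⁻¹ ≤ m₀ + 1 := (Nat.lt_floor_add_one _).le
  have hx3 : (m₀ : ℝ) + 1 ≤ 3 * X⁻¹ := by
    have : 1 ≤ 2 * X⁻¹ := by
      rw [← div_eq_mul_inv, le_div_iff₀ hX]; linarith
    linarith
  have hb := hnode w hw m₀ h1 h2
  set x : ℝ := (m₀ : ℝ) + 1 with hx
  have hx0 : 0 < x := by positivity
  set y : ℝ := 1 - 1 / x with hy
  have hym : y ∈ Ico (0 : ℝ) 1 := node_mem m₀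
  have hτy := hR.tail_pos y hym
  have hτr := hR.tail_pos r hr
  have h1y : 1 - y = x⁻¹ := by rw [hy]; ring
  have hXy : X ≤ 3 * x⁻¹ := by
    rw [← div_eq_mul_inv, le_div_iff₀ hx0]
    calc X * x ≤ X * (3 * X⁻¹) := by gcongr
      _ = 3 := by field_simp
  -- The node `y` is at distance comparable to `X` from 1. If `y ≤ r`, power decay gives the factor
  -- `((1-r)/X) ^ β`. If `r ≤ y`, then `1 - r ≤ X` forces `1 - r` and `X` to be comparable, and
  -- upper growth suffices.
  have hcomp : tailIntegral ν r ≤ F * ((1 - r) / X) ^ β * tailIntegral ν y := by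
    rcases le_total y r with h | h
    · refine (hdecay y r hym.1 h hr.2).trans ?_
      refine mul_le_mul_of_nonneg_right ?_ hτy.le
      have h3 : (1 - r) / (1 - y) ≤ 3 * ((1 - r) / X) := by
        rw [h1y, mul_div_assoc', div_le_div_iff₀ (by positivity) hX]
        nlinarith
      calc D * ((1 - r) / (1 - y)) ^ β ≤ D * (3 * ((1 - r) / X)) ^ β := by
            have : 0 ≤ (1 - r) / (1 - y) := by rw [h1y]; positivity
            gcongr
        _ = D * 3 ^ β * ((1 - r) / X) ^ β := by
            rw [Real.mul_rpow (by norm_num) (by positivity)]; ring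
        _ ≤ F * ((1 - r) / X) ^ β := by
            refine mul_le_mul_of_nonneg_right ?_ (by positivity)
            rw [hF, add_mul]
            have : 0 ≤ E * 3 ^ s * 3 ^ β := by positivity
            linarith
    · refine (hgrow r y hr.1 h hym.2).trans ?_
      refine mul_le_mul_of_nonneg_right ?_ hτy.le
      have h3 : (1 - r) / (1 - y) ≤ 3 := by
        rw [h1y, div_le_iff₀ (by positivity)]
        linarith
      have h4 : 1 ≤ 3 * ((1 - r) / X) := by
        rw [mul_div_assoc', le_div_iff₀ hX, one_mul]
        have : x⁻¹ ≤ 1 - r := by linarith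
        linarith
      have h5 : 1 ≤ 3 ^ β * ((1 - r) / X) ^ β := by
        rw [← Real.mul_rpow (by norm_num) (by positivity)]
        exact Real.one_le_rpow h4 hβ.le
      calc E * ((1 - r) / (1 - y)) ^ s ≤ E * 3 ^ s := by
            have : 0 ≤ (1 - r) / (1 - y) := by rw [h1y]; positivity
            gcongr
        _ ≤ E * 3 ^ s * (3 ^ β * ((1 - r) / X) ^ β) := le_mul_of_one_le_right (by positivity) h5
        _ ≤ F * ((1 - r) / X) ^ β := by
            rw [← mul_assoc]
            refine mul_le_mul_of_nonneg_right ?_ (by positivity)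
            rw [hF, add_mul]
            have : 0 ≤ D * 3 ^ β := by positivity
            linarith
  have hcomp' : (tailIntegral ν y)⁻¹ ≤ F * ((1 - r) / X) ^ β * (tailIntegral ν r)⁻¹ := by
    rw [inv_le_iff_one_le_mul₀ hτy]
    calc (1 : ℝ) = tailIntegral ν r * (tailIntegral ν r)⁻¹ := by field_simp
      _ ≤ F * ((1 - r) / X) ^ β * tailIntegral ν y * (tailIntegral ν r)⁻¹ := by gcongr
      _ = _ := by ring
  refine hb.trans ?_
  have hFp : 0 < F := by positivity
  calc C * (tailIntegral ν y)⁻¹ * x ^ (n + 1)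
      ≤ (C + 1) * (F * ((1 - r) / X) ^ β * (tailIntegral ν r)⁻¹) * (3 * X⁻¹) ^ (n + 1) := by
        gcongr
        linarith
    _ = (C + 1) * 3 ^ (n + 1) * F * (tailIntegral ν r)⁻¹ * (1 - r) ^ β *
          X ^ (-((n : ℝ) + 1 + β)) := by
        rw [Real.div_rpow hr1.le hX.le, mul_pow, neg_add, Real.rpow_add hX, Real.rpow_neg hX.le β,
          Real.rpow_neg hX.le, ← Nat.cast_succ, Real.rpow_natCast, inv_pow]
        field_simp

end IsDoublingWeight

/-! ### Reproducing formulas and identification of the Bergman kernel. -/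

theorem differentiableOn_tsum_mul_pow {c : ℕ → ℂ}
    (hc : ∀ ρ : ℝ, 0 ≤ ρ → ρ < 1 → Summable fun m => ‖c m‖ * ρ ^ m) :
    DifferentiableOn ℂ (fun w => ∑' m, c m * w ^ m) unitDisc := by
  intro w hw
  rw [mem_ball_zero_iff] at hw
  obtain ⟨ρ, hρ1, hρ2⟩ := exists_between hw
  have hρ0 : 0 ≤ ρ := (norm_nonneg w).trans hρ1.le
  have h : DifferentiableOn ℂ (fun w => ∑' m, c m * w ^ m) (ball 0 ρ) := by
    refine Complex.differentiableOn_tsum_of_summable_norm (hc ρ hρ0 hρ2) (fun m => by fun_prop)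
      isOpen_ball fun m z hz => ?_
    rw [mem_ball_zero_iff] at hz
    rw [norm_mul, norm_pow]
    gcongr
  exact (h.differentiableAt (isOpen_ball.mem_nhds (by simpa using hρ1))).differentiableWithinAt

theorem DifferentiableOn.iteratedDeriv_unitDisc {f : ℂ → ℂ} (hf : DifferentiableOn ℂ f unitDisc)
    (n : ℕ) : DifferentiableOn ℂ (iteratedDeriv n f) unitDisc := by
  induction n with
  | zero => simpa using hf
  | succ n ih =>
    rw [iteratedDeriv_succ]
    exact ih.deriv isOpen_ball

theorem taylorCoeff_iteratedDeriv (f : ℂ → ℂ) (n m : ℕ) :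
    taylorCoeff (iteratedDeriv n f) m = ((m + 1).ascFactorial n : ℂ) * taylorCoeff f (m + n) := by
  have h : iteratedDeriv m (iteratedDeriv n f) = iteratedDeriv (m + n) f := by
    simp only [iteratedDeriv_eq_iterate, Function.iterate_add_apply]
  have h2 := Nat.factorial_mul_ascFactorial m n
  rw [taylorCoeff, taylorCoeff, h, ← h2]
  have h3 : ((m + 1).ascFactorial n : ℂ) ≠ 0 := by
    exact_mod_cast (Nat.ascFactorial_pos m n).ne'
  have h4 : (m.factorial : ℂ) ≠ 0 := by exact_mod_cast m.factorial_ne_zero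
  push_cast
  field_simp

theorem IsRadialWeight.mem_bergmanSpace_of_bounded {ω : ℂ → ℝ} (hω : IsRadialWeight ω) (p : ℝ)
    {g : ℂ → ℂ} (hg : g ∈ boundedAnalytic) : g ∈ bergmanSpace p ω := by
  obtain ⟨hd, M, hM⟩ := hg
  have := hω.isFiniteMeasure_weightedArea
  refine ⟨hd, MemLp.of_bound (hd.continuousOn.aestronglyMeasurable_weightedArea ω) M ?_⟩
  filter_upwards [weightedArea_ae ω] with z hz using hM z hz

theorem integrable_of_mem_bergmanSpace_two {ω : ℂ → ℝ} (hω : IsRadialWeight ω)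
    {g : ℂ → ℂ} (hg : g ∈ bergmanSpace 2 ω) : Integrable g (weightedArea ω) := by
  have := hω.isFiniteMeasure_weightedArea
  rw [← memLp_one_iff_integrable]
  refine hg.2.mono_exponent ?_
  simp

/-- The logarithmic factor is at least 1 on the disc, so `ν dA ≤ ν_log dA`. -/
theorem integrable_of_mem_logWeight {ν : ℂ → ℝ} (hν : IsRadialWeight ν) {f : ℂ → ℂ}
    (hf : f ∈ bergmanSpace 1 (logWeight ν)) : Integrable f (weightedArea ν) := by
  have h := hf.2
  rw [ENNReal.ofReal_one, memLp_one_iff_integrable] at h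
  refine h.mono_measure ?_
  refine Measure.le_intro fun s hs _ => ?_
  simp only [weightedArea, Measure.smul_apply, smul_eq_mul]
  refine mul_le_mul_right ?_ _
  refine (withDensity_mono ?_) s
  filter_upwards [ae_restrict_mem measurableSet_ball] with z hz
  refine ENNReal.ofReal_le_ofReal ?_
  have h0 := hν.nonneg z hz
  rw [mem_ball_zero_iff] at hz
  refine le_mul_of_one_le_left h0 ?_
  rw [Real.le_log_iff_exp_le (div_pos (Real.exp_pos _) (by linarith)),
    le_div_iff₀ (by linarith)]
  exact mul_le_of_le_one_right (Real.exp_pos _).le (by linarith [norm_nonneg z])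

/-- The function `ζ ↦ ∂ⁿ/∂āⁿ B_a(ζ)`. -/
def kernelDeriv (ν : ℂ → ℝ) (n : ℕ) (a ζ : ℂ) : ℂ := ζ ^ n * kernelSeries ν n (conj a * ζ)

namespace IsDoublingWeight

variable {ν : ℂ → ℝ}

theorem radialMoment_pos (hν : IsDoublingWeight ν) (m : ℕ) : 0 < radialMoment ν m := by
  obtain ⟨c, hc, h⟩ := hν.le_radialMoment
  exact (mul_pos hc (hν.tail_node_pos m)).trans_le (h m)

theorem summable_norm_kernelCoeff (hν : IsDoublingWeight ν) (n : ℕ) {ρ : ℝ} (h0 : 0 ≤ ρ)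
    (h1 : ρ < 1) : Summable fun m => ‖(kernelCoeff ν n m : ℂ)‖ * ρ ^ m := by
  simpa using hν.summable_kernelCoeff n h0 h1

theorem differentiableOn_kernelSeries (hν : IsDoublingWeight ν) (n : ℕ) :
    DifferentiableOn ℂ (kernelSeries ν n) unitDisc :=
  differentiableOn_tsum_mul_pow fun _ h0 h1 => hν.summable_norm_kernelCoeff n h0 h1

theorem mul_mem_unitDisc {a ζ : ℂ} (ha : a ∈ unitDisc) (hζ : ζ ∈ unitDisc) :
    a * ζ ∈ unitDisc := by
  rw [mem_ball_zero_iff] at *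
  rw [norm_mul]
  exact mul_lt_one_of_nonneg_of_lt_one_left (norm_nonneg _) ha hζ.le

theorem conj_mem_unitDisc {a : ℂ} (ha : a ∈ unitDisc) : conj a ∈ unitDisc := by
  rw [mem_ball_zero_iff] at *
  rwa [RCLike.norm_conj]

theorem norm_kernelSeries_le_tsum (hν : IsDoublingWeight ν) (n : ℕ) {w : ℂ} {ρ : ℝ}
    (hw : ‖w‖ ≤ ρ) (hρ : ρ < 1) :
    ‖kernelSeries ν n w‖ ≤ ∑' m, ‖(kernelCoeff ν n m : ℂ)‖ * ρ ^ m := by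
  refine tsum_of_norm_bounded
    (hν.summable_norm_kernelCoeff n ((norm_nonneg w).trans hw) hρ).hasSum fun m => ?_
  rw [norm_mul, norm_pow]
  gcongr

theorem kernelDeriv_mem_boundedAnalytic (hν : IsDoublingWeight ν) (n : ℕ) {a : ℂ}
    (ha : a ∈ unitDisc) : kernelDeriv ν n a ∈ boundedAnalytic := by
  refine ⟨?_, ∑' m, ‖(kernelCoeff ν n m : ℂ)‖ * ‖a‖ ^ m, fun ζ hζ => ?_⟩
  · have h : DifferentiableOn ℂ (fun ζ => kernelSeries ν n (conj a * ζ)) unitDisc :=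
      (hν.differentiableOn_kernelSeries n).comp (by fun_prop) fun ζ hζ =>
        mul_mem_unitDisc (conj_mem_unitDisc ha) hζ
    have h2 : DifferentiableOn ℂ (fun ζ : ℂ => ζ ^ n) unitDisc := by fun_prop
    exact h2.mul h
  · rw [mem_ball_zero_iff] at hζ ha
    rw [kernelDeriv, norm_mul, norm_pow]
    refine (mul_le_of_le_one_left (norm_nonneg _) (pow_le_one₀ (norm_nonneg _) hζ.le)).trans ?_
    refine hν.norm_kernelSeries_le_tsum n ?_ ha
    rw [norm_mul, RCLike.norm_conj]
    exact mul_le_of_le_one_right (norm_nonneg _) hζ.le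

/-- Reproducing formula for derivatives. -/
theorem integral_mul_conj_kernelDeriv (hν : IsDoublingWeight ν) {f : ℂ → ℂ}
    (hf : DifferentiableOn ℂ f unitDisc) (hfi : Integrable f (weightedArea ν)) (n : ℕ) {a : ℂ}
    (ha : a ∈ unitDisc) :
    ∫ ζ, f ζ * conj (kernelDeriv ν n a ζ) ∂weightedArea ν = iteratedDeriv n f a := by
  have hR := hν.toIsRadialWeight
  have ha' : ‖a‖ < 1 := by simpa using ha
  -- The coefficients of `kernelDeriv ν n a` as a power series in `ζ`; its factor `ζ ^ n` shifts the
  -- index by `n`. In the pairing, the moment of order `m + n` cancels and the coefficients of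
  -- `f^{(n)}` remain.
  set c : ℕ → ℂ := fun k =>
    if n ≤ k then (kernelCoeff ν n (k - n) : ℂ) * conj a ^ (k - n) else 0 with hc
  have hc1 : ∀ m, c (m + n) = (kernelCoeff ν n m : ℂ) * conj a ^ m := fun m => by simp [hc]
  have hc0 : ∀ k ∈ Finset.range n, c k = 0 := fun k hk => by
    simp [hc, (Finset.mem_range.1 hk).not_ge]
  have hcs : Summable fun k => ‖c k‖ := by
    rw [← summable_nat_add_iff n]
    simp only [hc1]
    refine (hν.summable_norm_kernelCoeff n (norm_nonneg a) ha').congr fun m => ?_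
    rw [norm_mul, norm_pow, RCLike.norm_conj]
  have hfun : ∀ ζ ∈ unitDisc, ∑' k, c k * ζ ^ k = kernelDeriv ν n a ζ := by
    intro ζ hζ
    rw [mem_ball_zero_iff] at hζ
    have hs : Summable fun k => c k * ζ ^ k := by
      refine Summable.of_norm_bounded hcs fun k => ?_
      rw [norm_mul, norm_pow]
      exact mul_le_of_le_one_right (norm_nonneg _) (pow_le_one₀ (norm_nonneg _) hζ.le)
    rw [← hs.sum_add_tsum_nat_add n, Finset.sum_eq_zero fun k hk => by rw [hc0 k hk, zero_mul],
      zero_add, kernelDeriv, kernelSeries, ← tsum_mul_left]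
    congr 1 with m
    rw [hc1, pow_add, mul_pow]; ring
  have h1 := hR.hasSum_integral_mul_conj_series hf hfi hcs
  have h2 : ∫ ζ, f ζ * conj (∑' m, c m * ζ ^ m) ∂weightedArea ν
      = ∫ ζ, f ζ * conj (kernelDeriv ν n a ζ) ∂weightedArea ν := by
    refine integral_congr_ae ?_
    filter_upwards [weightedArea_ae ν] with ζ hζ
    rw [hfun ζ hζ]
  rw [h2] at h1
  have h3 := (hasSum_nat_add_iff' n).2 h1
  rw [Finset.sum_eq_zero fun k hk => by rw [hc0 k hk, map_zero, zero_mul], sub_zero] at h3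
  refine h3.unique ?_
  refine (hasSum_taylorCoeff (hf.iteratedDeriv_unitDisc n) ha).congr_fun fun m => ?_
  rw [hc1, taylorCoeff_iteratedDeriv, kernelCoeff]
  have := (hν.radialMoment_pos (m + n)).ne'
  have h5 : (radialMoment ν (m + n) : ℂ) ≠ 0 := by exact_mod_cast this
  simp only [map_mul, map_pow, Complex.conj_conj, Complex.conj_ofReal]
  push_cast
  field_simp

theorem isBergmanKernelAt_kernelDeriv (hν : IsDoublingWeight ν) {z : ℂ} (hz : z ∈ unitDisc) :
    IsBergmanKernelAt ν z (kernelDeriv ν 0 z) := by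
  refine ⟨hν.toIsRadialWeight.mem_bergmanSpace_of_bounded 2
    (hν.kernelDeriv_mem_boundedAnalytic 0 hz), fun g hg => ?_⟩
  rw [hν.integral_mul_conj_kernelDeriv hg.1
    (integrable_of_mem_bergmanSpace_two hν.toIsRadialWeight hg) 0 hz, iteratedDeriv_zero]

/-- The kernel is obtained by choice, so only its reproducing property is available. Testing it on
monomials determines every Taylor coefficient, because the moments do not vanish. -/
theorem bergmanKernel_eq (hν : IsDoublingWeight ν) {z ζ : ℂ} (hz : z ∈ unitDisc)
    (hζ : ζ ∈ unitDisc) : bergmanKernel ν z ζ = kernelSeries ν 0 (conj z * ζ) := by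
  have hR := hν.toIsRadialWeight
  have hex : ∃ K, IsBergmanKernelAt ν z K := ⟨_, hν.isBergmanKernelAt_kernelDeriv hz⟩
  have hK : IsBergmanKernelAt ν z (bergmanKernel ν z) := by
    rw [bergmanKernel, dif_pos hex]
    exact hex.choose_spec
  have hL := hν.isBergmanKernelAt_kernelDeriv hz
  have key : ∀ {K : ℂ → ℂ}, IsBergmanKernelAt ν z K → ∀ m : ℕ,
      taylorCoeff K m * radialMoment ν m = conj (z ^ m) := by
    intro K hK m
    rw [← hR.integral_mul_conj_pow hK.1.1 (integrable_of_mem_bergmanSpace_two hR hK.1)]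
    have hm : (fun ζ : ℂ => ζ ^ m) ∈ bergmanSpace 2 ν := by
      refine hR.mem_bergmanSpace_of_bounded 2 ⟨by fun_prop, 1, fun ζ hζ => ?_⟩
      rw [mem_ball_zero_iff] at hζ
      simpa using pow_le_one₀ (norm_nonneg ζ) hζ.le
    have h1 := congrArg conj (hK.2 _ hm)
    rw [← integral_conj] at h1
    rw [h1]
    congr 1 with ζ
    simp only [map_mul, Complex.conj_conj]
    ring
  have h1 := hasSum_taylorCoeff hK.1.1 hζ
  have h2 := hasSum_taylorCoeff hL.1.1 hζ
  have h3 : ∀ m, taylorCoeff (bergmanKernel ν z) m = taylorCoeff (kernelDeriv ν 0 z) m := by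
    intro m
    have h5 : (radialMoment ν m : ℂ) ≠ 0 := by exact_mod_cast (hν.radialMoment_pos m).ne'
    exact mul_right_cancel₀ h5 ((key hK m).trans (key hL m).symm)
  simp only [h3] at h1
  rw [h1.unique h2, kernelDeriv, pow_zero, one_mul]

theorem conj_kernelSeries (n : ℕ) (w : ℂ) :
    conj (kernelSeries ν n w) = kernelSeries ν n (conj w) := by
  rw [kernelSeries, Complex.conj_tsum, kernelSeries]
  simp

theorem smallHankel_eq (hν : IsDoublingWeight ν) (f g : ℂ → ℂ) {z : ℂ} (hz : z ∈ unitDisc) :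
    smallHankel ν f g z
      = ∫ ζ, f ζ * conj (g ζ * kernelSeries ν 0 (conj z * ζ)) ∂weightedArea ν := by
  refine integral_congr_ae ?_
  filter_upwards [weightedArea_ae ν] with ζ hζ
  rw [hν.bergmanKernel_eq hz hζ]

/-- The kernel at the origin is constant, so the value at 0 is the bare pairing of `f` with `g`. The
necessity proof uses the operator only through this value. -/
theorem smallHankel_zero (hν : IsDoublingWeight ν) (f g : ℂ → ℂ) :
    smallHankel ν f g 0
      = (radialMoment ν 0 : ℂ)⁻¹ * ∫ ζ, f ζ * conj (g ζ) ∂weightedArea ν := by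
  rw [hν.smallHankel_eq f g (by simp), ← integral_const_mul]
  congr 1 with ζ
  have h : kernelSeries ν 0 0 = (radialMoment ν 0 : ℂ)⁻¹ := by
    rw [kernelSeries, tsum_eq_single 0 fun m hm => by rw [zero_pow hm, mul_zero]]
    simp [kernelCoeff]
  simp only [map_zero, zero_mul, h, map_mul, map_inv₀, Complex.conj_ofReal]
  ring

end IsDoublingWeight

/-! ### Subharmonicity and monotone integral means. -/

/-- Sub-mean value property of `|g|^p`. -/
theorem norm_rpow_le_circleAverage {g : ℂ → ℂ} {c : ℂ} {R p : ℝ} (hR : 0 < R) (hp : 0 < p)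
    (hg : AnalyticOnNhd ℂ g (closedBall c R)) :
    ‖g c‖ ^ p ≤ Real.circleAverage (fun z => ‖g z‖ ^ p) c R := by
  have hcont : ContinuousOn (fun z => ‖g z‖ ^ p) (sphere c R) :=
    ((hg.continuousOn.mono sphere_subset_closedBall).norm).rpow_const fun _ _ => Or.inr hp.le
  by_cases h0 : g c = 0
  · rw [h0, norm_zero, Real.zero_rpow hp.ne']
    exact Real.circleAverage_nonneg_of_nonneg fun z _ => by positivity
  have hn : 0 < ‖g c‖ := norm_pos_iff.2 h0
  -- Normalized so that `|k g(c)| ^ p = e`. The inequality `e log t ≤ t` is an equality at `t = e`,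
  -- so for `t = |k g| ^ p` it passes from the average of the logarithm to the average of the power
  -- without loss at the centre. Jensen's formula supplies the logarithmic bound, the zeros
  -- contributing non-negatively.
  set k : ℝ := Real.exp p⁻¹ / ‖g c‖ with hk
  have hk0 : 0 < k := by positivity
  set G : ℂ → ℂ := fun z => (k : ℂ) * g z with hG
  have hGa : AnalyticOnNhd ℂ G (closedBall c |R|) := by
    rw [abs_of_pos hR]
    exact analyticOnNhd_const.mul hg
  have hGn : ∀ z, ‖G z‖ = k * ‖g z‖ := fun z => by simp [hG, abs_of_pos hk0]
  have hGc : ‖G c‖ = Real.exp p⁻¹ := by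
    rw [hGn, hk, div_mul_cancel₀ _ hn.ne']
  have hG0 : G c ≠ 0 := by
    rw [← norm_pos_iff, hGc]; exact Real.exp_pos _
  have hjensen := hGa.circleAverage_log_norm hR.ne' hG0
  have hnonneg : 0 ≤ ∑ᶠ u, ((MeromorphicOn.divisor G (closedBall c |R|)) u : ℝ) *
      Real.log (R * ‖c - u‖⁻¹) := by
    refine finsum_nonneg fun u => ?_
    by_cases hu : u ∈ closedBall c |R|
    · refine mul_nonneg (mod_cast MeromorphicOn.AnalyticOnNhd.divisor_nonneg hGa u) ?_
      rcases eq_or_ne u c with rfl | huc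
      · simp
      · refine Real.log_nonneg ?_
        have : 0 < ‖c - u‖ := norm_pos_iff.2 (sub_ne_zero.2 huc.symm)
        rw [← div_eq_mul_inv, one_le_div this]
        rwa [mem_closedBall, dist_eq_norm', abs_of_pos hR] at hu
    · simp [hu]
  have hlog : p⁻¹ ≤ Real.circleAverage (fun z => Real.log ‖G z‖) c R := by
    rw [hjensen, hGc, Real.log_exp]
    linarith
  have hmono : Real.circleAverage ((Real.exp 1 * p) • fun z => Real.log ‖G z‖) c R
      ≤ Real.circleAverage ((k ^ p) • fun z => ‖g z‖ ^ p) c R := by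
    refine Real.circleAverage_mono ?_ ?_ fun z _ => ?_
    · exact ((hGa.mono sphere_subset_closedBall).meromorphicOn.circleIntegrable_log_norm).const_smul
    · exact ContinuousOn.circleIntegrable hR.le (hcont.const_smul _)
    · simp only [Pi.smul_apply, smul_eq_mul]
      rw [← Real.mul_rpow hk0.le (norm_nonneg _), ← hGn]
      rcases (norm_nonneg (G z)).eq_or_lt with h | h
      · rw [← h]; simp [Real.zero_rpow hp.ne']
      · rw [mul_assoc, ← Real.log_rpow h]
        have h1 := Real.add_one_le_exp (Real.log (‖G z‖ ^ p) - 1)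
        rw [Real.exp_sub, Real.exp_log (by positivity), sub_add_cancel,
          le_div_iff₀ (Real.exp_pos 1)] at h1
        linarith
  rw [Real.circleAverage_smul, Real.circleAverage_smul, smul_eq_mul, smul_eq_mul] at hmono
  have h1 : Real.exp 1 ≤ Real.exp 1 * p * Real.circleAverage (fun z => Real.log ‖G z‖) c R := by
    rw [mul_assoc]
    refine le_mul_of_one_le_right (Real.exp_pos 1).le ?_
    calc (1 : ℝ) = p * p⁻¹ := by field_simp
      _ ≤ _ := by gcongr
  have h2 : k ^ p * ‖g c‖ ^ p = Real.exp 1 := by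
    rw [← Real.mul_rpow hk0.le hn.le, ← hGn, hGc, ← Real.exp_mul, inv_mul_cancel₀ hp.ne']
  have h3 : 0 < k ^ p := by positivity
  have := h2.le.trans (h1.trans hmono)
  exact le_of_mul_le_mul_left this h3

theorem ofReal_circleAverage {F : ℂ → ℝ} {c : ℂ} {R : ℝ}
    (hF : Continuous fun θ => F (circleMap c R θ)) (h0 : ∀ θ, 0 ≤ F (circleMap c R θ)) :
    ENNReal.ofReal (Real.circleAverage F c R)
      = ∫⁻ θ, ENNReal.ofReal (F (circleMap c R θ)) ∂angularMeasure := by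
  have hπ := Real.pi_pos
  have hper : Function.Periodic (fun θ => F (circleMap c R θ)) (2 * Real.pi) := fun θ => by
    simp only [periodic_circleMap c R θ]
  have h1 := hper.intervalIntegral_add_eq 0 (-Real.pi)
  rw [zero_add, show -Real.pi + 2 * Real.pi = Real.pi by ring] at h1
  rw [Real.circleAverage, h1, smul_eq_mul, ENNReal.ofReal_mul (by positivity), angularMeasure,
    lintegral_smul_measure, smul_eq_mul, intervalIntegral.integral_of_le (by linarith),
    integral_Ioc_eq_integral_Ioo, ofReal_integral_eq_lintegral_ofReal]
  · exact (hF.integrableOn_Icc (a := -Real.pi) (b := Real.pi)).mono_set Ioo_subset_Icc_self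
  · filter_upwards with θ using h0 θ

theorem enorm_rpow_eq_ofReal {p : ℝ} (hp : 0 ≤ p) (z : ℂ) :
    ‖z‖ₑ ^ p = ENNReal.ofReal (‖z‖ ^ p) := by
  rw [← ofReal_norm, ENNReal.ofReal_rpow_of_nonneg (norm_nonneg _) hp]

/-- The integral mean `∫ |g(r e^{iθ})|^p dθ/2π`. -/
def circleMean (p : ℝ) (g : ℂ → ℂ) (r : ℝ) : ℝ≥0∞ :=
  ∫⁻ θ, ‖g (circleMap 0 r θ)‖ₑ ^ p ∂angularMeasure

theorem circleMap_add_mem_unitDisc {z : ℂ} {ρ : ℝ} (hρ : 0 ≤ ρ) (h : ‖z‖ + ρ < 1) (θ : ℝ) :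
    circleMap z ρ θ ∈ unitDisc := by
  rw [mem_ball_zero_iff, circleMap]
  refine (norm_add_le _ _).trans_lt ?_
  simpa [abs_of_nonneg hρ] using h

theorem enorm_rpow_le_lintegral {g : ℂ → ℂ} (hg : DifferentiableOn ℂ g unitDisc) {p : ℝ}
    (hp : 0 < p) {z : ℂ} {ρ : ℝ} (hρ : 0 ≤ ρ) (h : ‖z‖ + ρ < 1) :
    ‖g z‖ₑ ^ p ≤ ∫⁻ θ, ‖g (circleMap z ρ θ)‖ₑ ^ p ∂angularMeasure := by
  rcases hρ.eq_or_lt with rfl | hρ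
  · simp [circleMap]
  have hsub : closedBall z ρ ⊆ unitDisc := fun w hw => by
    rw [mem_ball_zero_iff]
    rw [mem_closedBall, dist_eq_norm] at hw
    have := norm_add_le z (w - z)
    rw [add_sub_cancel] at this
    linarith
  have hcont : Continuous fun θ => g (circleMap z ρ θ) :=
    hg.continuousOn.comp_continuous (continuous_circleMap z ρ)
      fun θ => circleMap_add_mem_unitDisc hρ.le h θ
  have h1 := norm_rpow_le_circleAverage hρ hp
    ((hg.analyticOnNhd isOpen_ball).mono hsub)
  simp only [enorm_rpow_eq_ofReal hp.le]
  rw [← ofReal_circleAverage (F := fun z => ‖g z‖ ^ p)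
    (hcont.norm.rpow_const fun _ => Or.inr hp.le) fun θ => by positivity]
  exact ENNReal.ofReal_le_ofReal h1

theorem circleMean_eq_ofReal {g : ℂ → ℂ} (hg : ContinuousOn g unitDisc) {p : ℝ}
    (hp : 0 < p) {r : ℝ} (hr : r ∈ Ico (0 : ℝ) 1) :
    circleMean p g r = ENNReal.ofReal (Real.circleAverage (fun z => ‖g z‖ ^ p) 0 r) := by
  have hcont : Continuous fun θ => g (circleMap 0 r θ) :=
    hg.comp_continuous (continuous_circleMap 0 r)
      fun θ => circleMap_add_mem_unitDisc hr.1 (by simpa using hr.2) θ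
  rw [ofReal_circleAverage (F := fun z => ‖g z‖ ^ p)
    (hcont.norm.rpow_const fun _ => Or.inr hp.le) fun θ => by positivity]
  simp only [circleMean, enorm_rpow_eq_ofReal hp.le]

theorem continuousOn_circleAverage_rpow {g : ℂ → ℂ} (hg : ContinuousOn g unitDisc) {p : ℝ}
    (hp : 0 < p) :
    ContinuousOn (Real.circleAverage (fun z => ‖g z‖ ^ p) 0) (Ico (0 : ℝ) 1) := by
  refine Real.ContinuousOn.circleAverage ?_ fun r hr => hr.1
  refine ContinuousOn.mono (s := unitDisc) (hg.norm.rpow_const fun _ _ => Or.inr hp.le) ?_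
  intro z hz
  have : ‖z - 0‖ < 1 := hz.2
  simpa using this

/-- The sub-mean value property of each rotation of `g` is averaged over all rotations: `z ↦
circleMean p g ‖z‖` is a radial function with the sub-mean value property. -/
theorem circleMean_le_lintegral {g : ℂ → ℂ} (hg : DifferentiableOn ℂ g unitDisc) {p : ℝ}
    (hp : 0 < p) {r ρ : ℝ} (hr : 0 ≤ r) (hρ : 0 ≤ ρ) (h : r + ρ < 1) :
    circleMean p g r ≤ ∫⁻ φ, circleMean p g ‖circleMap (r : ℂ) ρ φ‖ ∂angularMeasure := by
  have hmem : ∀ φ, circleMap (r : ℂ) ρ φ ∈ unitDisc := fun φ =>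
    circleMap_add_mem_unitDisc hρ (by simpa [abs_of_nonneg hr] using h) φ
  have hrot : ∀ φ, circleMean p g ‖circleMap (r : ℂ) ρ φ‖
      = ∫⁻ θ, ‖g (circleMap (r : ℂ) ρ φ * Complex.exp (θ * Complex.I))‖ₑ ^ p ∂angularMeasure := by
    intro φ
    rw [circleMean, ← lintegral_angularMeasure_rotate (F := fun z => ‖g z‖ₑ ^ p) _
      (circleMap (r : ℂ) ρ φ).arg]
    congr 1 with θ
    congr 3
    conv_rhs => rw [← Complex.norm_mul_exp_arg_mul_I (circleMap (r : ℂ) ρ φ)]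
    rw [circleMap, zero_add, mul_assoc, ← Complex.exp_add]
    congr 2
    push_cast; ring
  simp only [hrot]
  rw [lintegral_lintegral_swap]
  · refine lintegral_mono fun θ => ?_
    have hd : DifferentiableOn ℂ (fun z => g (z * Complex.exp (θ * Complex.I))) unitDisc := by
      refine hg.comp (by fun_prop) fun z hz => ?_
      rw [mem_ball_zero_iff] at hz ⊢
      rwa [norm_mul, Complex.norm_exp_ofReal_mul_I, mul_one]
    have := enorm_rpow_le_lintegral hd hp (z := (r : ℂ)) hρ (by simpa [abs_of_nonneg hr] using h)
    simpa [circleMap] using this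
  · have hc : Continuous fun q : ℝ × ℝ =>
        g (circleMap (r : ℂ) ρ q.1 * Complex.exp (q.2 * Complex.I)) := by
      refine hg.continuousOn.comp_continuous ?_ fun q => ?_
      · have := continuous_circleMap (r : ℂ) ρ
        fun_prop
      · have := hmem q.1
        rw [mem_ball_zero_iff] at this ⊢
        rwa [norm_mul, Complex.norm_exp_ofReal_mul_I, mul_one]
    exact (hc.enorm.measurable.pow_const p).aemeasurable

/-- Maximum principle for the radial function `u(|z|)`. If the maximum over `[0, s]` is not attained
at `s`, let `m` be the last point where it is. The circle about `m` of radius `s - m` stays in `|z|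
≤ s` and meets `|z| = s`, where `u` is smaller, so its average is below the maximum, against the
sub-mean value property at `m`. -/
theorem circleAverage_rpow_mono {g : ℂ → ℂ} (hg : DifferentiableOn ℂ g unitDisc) {p : ℝ}
    (hp : 0 < p) {r s : ℝ} (hr : 0 ≤ r) (hrs : r ≤ s) (hs : s < 1) :
    Real.circleAverage (fun z => ‖g z‖ ^ p) 0 r ≤ Real.circleAverage (fun z => ‖g z‖ ^ p) 0 s := by
  set u : ℝ → ℝ := Real.circleAverage (fun z => ‖g z‖ ^ p) 0 with hu
  have hcont : ContinuousOn u (Icc 0 s) :=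
    (continuousOn_circleAverage_rpow hg.continuousOn hp).mono fun x hx => ⟨hx.1, hx.2.trans_lt hs⟩
  have hs0 : 0 ≤ s := hr.trans hrs
  obtain ⟨x₀, hx₀, hmax⟩ := isCompact_Icc.exists_isMaxOn (nonempty_Icc.2 hs0) hcont
  set A := u x₀ with hA
  have hle : ∀ x ∈ Icc 0 s, u x ≤ A := fun x hx => hmax hx
  set S : Set ℝ := Icc 0 s ∩ u ⁻¹' {A} with hS
  have hSc : IsCompact S :=
    isCompact_Icc.of_isClosed_subset
      (hcont.preimage_isClosed_of_isClosed isClosed_Icc isClosed_singleton) inter_subset_left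
  obtain ⟨m, hmS, hmub⟩ := hSc.exists_isGreatest ⟨x₀, hx₀, rfl⟩
  rcases hmS.1.2.eq_or_lt with hms | hms
  · have : u s = A := by rw [← hms]; exact hmS.2
    rw [this]
    exact hle r ⟨hr, hrs⟩
  exfalso
  have hus : u s < A := by
    refine lt_of_le_of_ne (hle s ⟨hs0, le_rfl⟩) fun h => ?_
    exact absurd (hmub ⟨⟨hs0, le_rfl⟩, h⟩) (not_le.2 hms)
  have hρ : 0 < s - m := sub_pos.2 hms
  have hm0 : 0 ≤ m := hmS.1.1
  have hmem : ∀ φ, ‖circleMap (m : ℂ) (s - m) φ‖ ∈ Icc 0 s := fun φ => by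
    refine ⟨norm_nonneg _, ?_⟩
    rw [circleMap]
    refine (norm_add_le _ _).trans ?_
    rw [norm_mul, Complex.norm_exp_ofReal_mul_I, Complex.norm_real, Complex.norm_real,
      Real.norm_of_nonneg hm0, Real.norm_of_nonneg hρ.le]
    linarith
  have hvc : Continuous fun φ => u ‖circleMap (m : ℂ) (s - m) φ‖ :=
    hcont.comp_continuous (continuous_circleMap _ _).norm hmem
  have hu0 : ∀ x, 0 ≤ u x := fun x =>
    Real.circleAverage_nonneg_of_nonneg fun z _ => by positivity
  have h1 := circleMean_le_lintegral hg hp hm0 hρ.le (by linarith)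
  rw [circleMean_eq_ofReal hg.continuousOn hp ⟨hm0, hms.trans hs⟩] at h1
  have h2 : ∀ φ, circleMean p g ‖circleMap (m : ℂ) (s - m) φ‖
      = ENNReal.ofReal (u ‖circleMap (m : ℂ) (s - m) φ‖) := fun φ =>
    circleMean_eq_ofReal hg.continuousOn hp ⟨(hmem φ).1, (hmem φ).2.trans_lt hs⟩
  simp only [h2] at h1
  rw [← ofReal_circleAverage (F := fun z => u ‖z‖) hvc fun _ => hu0 _] at h1
  have h3 : A ≤ Real.circleAverage (fun z => u ‖z‖) (m : ℂ) (s - m) := by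
    have h4 : u m = A := hmS.2
    rw [← hu, h4] at h1
    refine (ENNReal.ofReal_le_ofReal_iff ?_).1 h1
    exact Real.circleAverage_nonneg_of_nonneg fun z _ => hu0 _
  have h5 : Real.circleAverage (fun z => u ‖z‖) (m : ℂ) (s - m) < A := by
    have h6 : ∫ φ in (0 : ℝ)..2 * Real.pi, u ‖circleMap (m : ℂ) (s - m) φ‖
        < ∫ φ in (0 : ℝ)..2 * Real.pi, A := by
      refine intervalIntegral.integral_lt_integral_of_continuousOn_of_le_of_exists_lt
        (by positivity) hvc.continuousOn continuousOn_const (fun φ _ => hle _ (hmem φ))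
        ⟨0, ⟨le_rfl, by positivity⟩, ?_⟩
      have : ‖circleMap (m : ℂ) (s - m) 0‖ = s := by
        have h7 : circleMap (m : ℂ) (s - m) 0 = (s : ℂ) := by simp [circleMap]
        rw [h7, Complex.norm_real, Real.norm_of_nonneg hs0]
      rw [this]
      exact hus
    rw [intervalIntegral.integral_const, sub_zero, smul_eq_mul] at h6
    rw [Real.circleAverage, smul_eq_mul, inv_mul_lt_iff₀ (by positivity)]
    exact h6
  linarith

theorem circleMean_mono {g : ℂ → ℂ} (hg : DifferentiableOn ℂ g unitDisc) {p : ℝ}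
    (hp : 0 < p) {r s : ℝ} (hr : 0 ≤ r) (hrs : r ≤ s) (hs : s < 1) :
    circleMean p g r ≤ circleMean p g s := by
  rw [circleMean_eq_ofReal hg.continuousOn hp ⟨hr, hrs.trans_lt hs⟩,
    circleMean_eq_ofReal hg.continuousOn hp ⟨hr.trans hrs, hs⟩]
  exact ENNReal.ofReal_le_ofReal (circleAverage_rpow_mono hg hp hr hrs hs)

/-- The weight 1 lets plain area on the disc use the polar formula for radial weights. -/
theorem isRadialWeight_one : IsRadialWeight fun _ => 1 := by
  refine ⟨fun _ _ => zero_le_one, ?_, fun _ _ => rfl, fun r hr => ?_⟩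
  · exact integrableOn_const (measure_ball_lt_top.ne) (by simp)
  · simpa [tailIntegral] using hr.2

/-- Pointwise growth in terms of a circle mean. -/
theorem enorm_rpow_mul_le_circleMean {g : ℂ → ℂ} (hg : DifferentiableOn ℂ g unitDisc) {p : ℝ}
    (hp : 0 < p) {z : ℂ} (hz : z ∈ unitDisc) :
    ‖g z‖ₑ ^ p * ENNReal.ofReal (1 - ‖z‖) ≤ 8 * circleMean p g ((1 + ‖z‖) / 2) := by
  have hz1 : ‖z‖ < 1 := by simpa using hz
  set r := ‖z‖ with hr
  have hr0 : 0 ≤ r := norm_nonneg z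
  -- The disc of radius `δ` about `z` lies in the annulus `r - δ < |w| < s`. Averaging over the disc
  -- costs `δ ^ 2`, while the annulus has normalized area at most `4 δ` and all its circle means are
  -- at most the one at `s`. The quotient `4 / δ` is `8 / (1 - r)`.
  set δ := (1 - r) / 2 with hδ
  have hδ0 : 0 < δ := by rw [hδ]; linarith
  set s := (1 + r) / 2 with hs
  have hs1 : s < 1 := by rw [hs]; linarith
  have hsr : s = r + δ := by rw [hs, hδ]; ring
  set F : ℂ → ℝ≥0∞ := unitDisc.indicator fun w => ‖g w‖ₑ ^ p with hF
  have hFm : Measurable F := by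
    have h1 : Measurable (unitDisc.indicator g) := by
      classical
      rw [← piecewise_eq_indicator]
      exact hg.continuousOn.measurable_piecewise continuousOn_const measurableSet_ball
    have h2 : F = fun w => ‖unitDisc.indicator g w‖ₑ ^ p := by
      ext w
      by_cases hw : w ∈ unitDisc <;> simp [hF, hw, hp]
    rw [h2]
    exact h1.enorm.pow_const p
  have hFd : ∀ w ∈ unitDisc, F w = ‖g w‖ₑ ^ p := fun w hw => indicator_of_mem hw _
  have hR := isRadialWeight_one
  have hsubm : ∀ ρ ∈ Ioo 0 δ, ‖g z‖ₑ ^ p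
      ≤ ∫⁻ θ, (ball (0 : ℂ) δ).indicator (fun w => F (z + w)) (circleMap 0 ρ θ)
        ∂angularMeasure := by
    intro ρ hρ
    have hρ1 : ‖z‖ + ρ < 1 := by
      have := hρ.2
      linarith
    refine (enorm_rpow_le_lintegral hg hp hρ.1.le hρ1).trans_eq (lintegral_congr fun θ => ?_)
    rw [indicator_of_mem (by simp [abs_of_pos hρ.1, hρ.2])]
    have : z + circleMap 0 ρ θ = circleMap z ρ θ := by simp [circleMap]
    rw [this, hFd _ (circleMap_add_mem_unitDisc hρ.1.le hρ1 θ)]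
  have hmeas1 : Measurable ((ball (0 : ℂ) δ).indicator fun w => F (z + w)) :=
    (hFm.comp (measurable_const_add z)).indicator measurableSet_ball
  have hball : ball z δ ⊆ unitDisc := fun w hw => by
    rw [mem_ball_zero_iff]
    rw [mem_ball, dist_eq_norm] at hw
    have := norm_add_le z (w - z)
    rw [add_sub_cancel] at this
    linarith
  have hw1 : weightedArea (fun _ => 1) = ENNReal.ofReal Real.pi⁻¹ • volume.restrict unitDisc := by
    simp [weightedArea]
  have hlow : ‖g z‖ₑ ^ p * ENNReal.ofReal (δ ^ 2)
      ≤ ∫⁻ w, (ball (0 : ℂ) δ).indicator (fun w => F (z + w)) w ∂weightedArea fun _ => 1 := by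
    rw [hR.lintegral_weightedArea hmeas1.aemeasurable, hR.lintegral_radialMeasure]
    · calc ‖g z‖ₑ ^ p * ENNReal.ofReal (δ ^ 2)
          = ∫⁻ ρ in Ioo 0 δ, ENNReal.ofReal (2 * ρ) * ‖g z‖ₑ ^ p := by
            rw [lintegral_mul_const _ (by fun_prop), mul_comm]
            congr 1
            rw [← ofReal_integral_eq_lintegral_ofReal]
            · rw [← integral_Ioc_eq_integral_Ioo, ← intervalIntegral.integral_of_le hδ0.le,
                intervalIntegral.integral_const_mul, integral_id]
              congr 1; ring
            · exact ((by fun_prop : Continuous fun ρ : ℝ => 2 * ρ).integrableOn_Icc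
                (a := 0) (b := δ)).mono_set Ioo_subset_Icc_self
            · filter_upwards [ae_restrict_mem measurableSet_Ioo] with ρ hρ
              have := hρ.1
              simp only [Pi.zero_apply]; linarith
        _ ≤ ∫⁻ ρ in Ioo 0 δ, ENNReal.ofReal (2 * ρ * 1) * ∫⁻ θ, (ball (0 : ℂ) δ).indicator
              (fun w => F (z + w)) (circleMap 0 ρ θ) ∂angularMeasure := by
            refine setLIntegral_mono' measurableSet_Ioo fun ρ hρ => ?_
            rw [mul_one]
            exact mul_le_mul_right (hsubm ρ hρ) _
        _ ≤ _ := lintegral_mono_set (Ioo_subset_Ioo_right (by linarith))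
    · have h : Measurable (Function.uncurry fun ρ θ : ℝ =>
          (ball (0 : ℂ) δ).indicator (fun w => F (z + w)) (circleMap 0 ρ θ)) :=
        hmeas1.comp continuous_circleMap_uncurry.measurable
      exact h.lintegral_prod_right.aemeasurable
  have htrans : ∫⁻ w, (ball (0 : ℂ) δ).indicator (fun w => F (z + w)) w ∂weightedArea (fun _ => 1)
      ≤ ∫⁻ w, {w : ℂ | r - δ < ‖w‖ ∧ ‖w‖ < s}.indicator F w ∂weightedArea fun _ => 1 := by
    rw [hw1, lintegral_smul_measure, lintegral_smul_measure]
    refine mul_le_mul_right ?_ _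
    calc ∫⁻ w in unitDisc, (ball (0 : ℂ) δ).indicator (fun w => F (z + w)) w
        ≤ ∫⁻ w, (ball (0 : ℂ) δ).indicator (fun w => F (z + w)) w := setLIntegral_le_lintegral _ _
      _ = ∫⁻ w, (ball z δ).indicator F (z + w) := by
          refine lintegral_congr fun w => ?_
          by_cases hw : w ∈ ball (0 : ℂ) δ
          · rw [indicator_of_mem hw, indicator_of_mem (by simpa using hw)]
          · rw [indicator_of_notMem hw, indicator_of_notMem (by simpa using hw)]
      _ = ∫⁻ w, (ball z δ).indicator F w := lintegral_add_left_eq_self _ z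
      _ = ∫⁻ w in unitDisc, (ball z δ).indicator F w := by
          rw [← lintegral_indicator measurableSet_ball]
          refine lintegral_congr fun w => ?_
          by_cases hw : w ∈ unitDisc
          · rw [indicator_of_mem hw]
          · rw [indicator_of_notMem hw, indicator_of_notMem fun h => hw (hball h)]
      _ ≤ ∫⁻ w in unitDisc, {w : ℂ | r - δ < ‖w‖ ∧ ‖w‖ < s}.indicator F w := by
          refine lintegral_mono fun w => ?_
          refine indicator_le_indicator_of_subset (fun w hw => ?_) (fun _ => zero_le) w
          rw [mem_ball, dist_eq_norm] at hw
          have h1 := norm_add_le z (w - z)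
          have h2 := norm_sub_le w (w - z)
          rw [add_sub_cancel] at h1
          rw [sub_sub_cancel] at h2
          exact ⟨by linarith, by linarith⟩
  have hann : MeasurableSet {w : ℂ | r - δ < ‖w‖ ∧ ‖w‖ < s} :=
    (measurableSet_lt measurable_const measurable_norm).inter
      (measurableSet_lt measurable_norm measurable_const)
  have hupp : ∫⁻ w, {w : ℂ | r - δ < ‖w‖ ∧ ‖w‖ < s}.indicator F w ∂weightedArea (fun _ => 1)
      ≤ ENNReal.ofReal (4 * δ) * circleMean p g s := by
    rw [hR.lintegral_weightedArea (hFm.indicator hann).aemeasurable, hR.lintegral_radialMeasure]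
    · calc ∫⁻ ρ in Ioo (0 : ℝ) 1, ENNReal.ofReal (2 * ρ * 1) *
            ∫⁻ θ, {w : ℂ | r - δ < ‖w‖ ∧ ‖w‖ < s}.indicator F (circleMap 0 ρ θ) ∂angularMeasure
          ≤ ∫⁻ ρ in Ioo (0 : ℝ) 1, (Ioo (r - δ) s).indicator
              (fun _ => 2 * circleMean p g s) ρ := by
            refine setLIntegral_mono' measurableSet_Ioo fun ρ hρ => ?_
            have hnorm : ∀ θ, ‖circleMap 0 ρ θ‖ = ρ := fun θ => by simp [abs_of_pos hρ.1]
            by_cases hm : ρ ∈ Ioo (r - δ) s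
            · rw [indicator_of_mem hm]
              refine mul_le_mul' ?_ ?_
              · rw [← ENNReal.ofReal_ofNat 2]
                exact ENNReal.ofReal_le_ofReal (by linarith [hρ.2])
              · refine le_trans (lintegral_mono fun θ => ?_)
                  (circleMean_mono hg hp hρ.1.le hm.2.le hs1)
                rw [indicator_of_mem (by rw [mem_ofPred_eq, hnorm]; exact hm),
                  hFd _ (circleMap_zero_mem_unitDisc hρ θ)]
            · rw [indicator_of_notMem hm]
              have : ∀ θ, {w : ℂ | r - δ < ‖w‖ ∧ ‖w‖ < s}.indicator F (circleMap 0 ρ θ) = 0 :=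
                fun θ => indicator_of_notMem (by rw [mem_ofPred_eq, hnorm]; exact hm) _
              simp [this]
        _ ≤ ∫⁻ ρ, (Ioo (r - δ) s).indicator (fun _ => 2 * circleMean p g s) ρ :=
            setLIntegral_le_lintegral _ _
        _ = ENNReal.ofReal (4 * δ) * circleMean p g s := by
            rw [lintegral_indicator_const measurableSet_Ioo, Real.volume_Ioo, hsr, mul_comm,
              ← mul_assoc]
            congr 1
            rw [← ENNReal.ofReal_ofNat 2, ← ENNReal.ofReal_mul (by linarith)]
            congr 1; ring
    · have h : Measurable (Function.uncurry fun ρ θ : ℝ =>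
          {w : ℂ | r - δ < ‖w‖ ∧ ‖w‖ < s}.indicator F (circleMap 0 ρ θ)) :=
        (hFm.indicator hann).comp continuous_circleMap_uncurry.measurable
      exact h.lintegral_prod_right.aemeasurable
  have hfin := (hlow.trans htrans).trans hupp
  have h1 : ENNReal.ofReal δ ≠ 0 := by simpa using hδ0
  refine (ENNReal.mul_le_mul_iff_left h1 ENNReal.ofReal_ne_top).1 ?_
  calc ‖g z‖ₑ ^ p * ENNReal.ofReal (1 - r) * ENNReal.ofReal δ
      = 2 * (‖g z‖ₑ ^ p * ENNReal.ofReal (δ ^ 2)) := by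
        rw [mul_assoc, ← ENNReal.ofReal_mul (by linarith), mul_left_comm,
          ← ENNReal.ofReal_ofNat 2, ← ENNReal.ofReal_mul (by norm_num)]
        congr 2; rw [hδ]; ring
    _ ≤ 2 * (ENNReal.ofReal (4 * δ) * circleMean p g s) := by gcongr
    _ = 8 * circleMean p g s * ENNReal.ofReal δ := by
        rw [ENNReal.ofReal_mul (by norm_num), ENNReal.ofReal_ofNat]
        ring

/-! ### Growth and embedding of functions in the weighted Bergman space. -/

theorem lintegral_le_of_monotoneOn {α β : Measure ℝ} {K : ℝ≥0∞} (hK : K ≠ ⊤)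
    (h : ∀ a ∈ Ico (0 : ℝ) 1, α (Ioo a 1) ≤ K * β (Ioo a 1)) {f : ℝ → ℝ}
    (hf0 : ∀ x, 0 ≤ f x) (hmono : MonotoneOn f (Ioo 0 1)) (hcont : ContinuousOn f (Ioo 0 1)) :
    ∫⁻ x in Ioo 0 1, ENNReal.ofReal (f x) ∂α
      ≤ K * ∫⁻ x in Ioo 0 1, ENNReal.ofReal (f x) ∂β := by
  -- Layer cake: a continuous increasing function on `(0, 1)` has superlevel sets that are empty or
  -- intervals `(a, 1)`, so the comparison of tails applies level by level.
  have hcake : ∀ μ : Measure ℝ, ∫⁻ x in Ioo 0 1, ENNReal.ofReal (f x) ∂μ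
      = ∫⁻ t in Ioi 0, μ (Ioo 0 1 ∩ f ⁻¹' Ioi t) := by
    intro μ
    rw [lintegral_eq_lintegral_meas_lt _ (ae_of_all _ hf0) (hcont.aemeasurable measurableSet_Ioo)]
    refine lintegral_congr fun t => ?_
    rw [Measure.restrict_apply' measurableSet_Ioo, inter_comm]
    rfl
  rw [hcake, hcake, ← lintegral_const_mul' _ _ hK]
  refine lintegral_mono fun t => ?_
  set U := Ioo 0 1 ∩ f ⁻¹' Ioi t with hU
  rcases U.eq_empty_or_nonempty with he | ⟨x₀, hx₀⟩
  · simp [he]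
  have hopen : IsOpen U := hcont.isOpen_inter_preimage isOpen_Ioo isOpen_Ioi
  have hbdd : BddBelow U := ⟨0, fun x hx => hx.1.1.le⟩
  have hUeq : U = Ioo (sInf U) 1 := by
    ext x
    constructor
    · intro hx
      refine ⟨?_, hx.1.2⟩
      obtain ⟨ε, hε, hεU⟩ := Metric.isOpen_iff.1 hopen x hx
      have : x - ε / 2 ∈ U := hεU (by
        rw [mem_ball, Real.dist_eq, abs_lt]; constructor <;> linarith)
      have := csInf_le hbdd this
      linarith
    · rintro ⟨hx, hx1⟩
      obtain ⟨y, hyU, hyx⟩ := exists_lt_of_csInf_lt ⟨x₀, hx₀⟩ hx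
      have hx' : x ∈ Ioo (0 : ℝ) 1 := ⟨hyU.1.1.trans hyx, hx1⟩
      exact ⟨hx', lt_of_lt_of_le (show t < f y from hyU.2) (hmono hyU.1 hx' hyx.le)⟩
  have ha : sInf U ∈ Ico (0 : ℝ) 1 :=
    ⟨le_csInf ⟨x₀, hx₀⟩ fun x hx => hx.1.1.le, (csInf_le hbdd hx₀).trans_lt hx₀.1.2⟩
  rw [hUeq]
  exact h _ ha

theorem circleAverage_rpow_nonneg (g : ℂ → ℂ) (p x : ℝ) :
    0 ≤ Real.circleAverage (fun z => ‖g z‖ ^ p) 0 x :=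
  Real.circleAverage_nonneg_of_nonneg fun z _ => by positivity

theorem IsRadialWeight.lintegral_enorm_rpow {ω : ℂ → ℝ} (hω : IsRadialWeight ω) {g : ℂ → ℂ}
    (hg : ContinuousOn g unitDisc) (p : ℝ) :
    ∫⁻ z, ‖g z‖ₑ ^ p ∂weightedArea ω = ∫⁻ r, circleMean p g r ∂radialMeasure ω :=
  hω.lintegral_weightedArea ((hg.aestronglyMeasurable_weightedArea ω).enorm.pow_const p)

theorem restrict_radialMeasure (ω : ℂ → ℝ) :
    (radialMeasure ω).restrict (Ioo 0 1) = radialMeasure ω :=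
  Measure.restrict_eq_self_of_ae_mem (IsRadialWeight.radialMeasure_ae ω)

theorem aemeasurable_circleMean {g : ℂ → ℂ} (hg : ContinuousOn g unitDisc) {p : ℝ} (hp : 0 < p) :
    AEMeasurable (circleMean p g) (volume.restrict (Ioo 0 1)) := by
  have h1 : ContinuousOn (Real.circleAverage (fun z => ‖g z‖ ^ p) 0) (Ioo (0 : ℝ) 1) :=
    (continuousOn_circleAverage_rpow hg hp).mono Ioo_subset_Ico_self
  refine (h1.aemeasurable measurableSet_Ioo).ennreal_ofReal.congr ?_
  filter_upwards [ae_restrict_mem measurableSet_Ioo] with r hr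
  exact (circleMean_eq_ofReal hg hp ⟨hr.1.le, hr.2⟩).symm

theorem IsRadialWeight.aemeasurable_tailIntegral {ω : ℂ → ℝ} (hω : IsRadialWeight ω) :
    AEMeasurable (tailIntegral ω) (volume.restrict (Ioo 0 1)) :=
  aemeasurable_restrict_of_antitoneOn measurableSet_Ioo
    fun _ hx _ hy hxy => hω.tailIntegral_anti hx.1.le hxy hy.2.le

/-- The means of `|g|^p` against `ω̂(ρ)/(1-ρ) dρ` are controlled by the norm. -/
theorem IsDoublingWeight.lintegral_circleMean_mul_tail_le {ω : ℂ → ℝ} (hω : IsDoublingWeight ω)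
    {p : ℝ} (hp : 0 < p) : ∃ C : ℝ, 0 < C ∧ ∀ g : ℂ → ℂ, DifferentiableOn ℂ g unitDisc →
      ∫⁻ ρ in Ioo (0 : ℝ) 1, circleMean p g ρ * ENNReal.ofReal (tailIntegral ω ρ / (1 - ρ))
        ≤ ENNReal.ofReal C * ∫⁻ z, ‖g z‖ₑ ^ p ∂weightedArea ω := by
  obtain ⟨C₁, hC₁, h1⟩ := hω.lintegral_tail_div_le
  obtain ⟨C₂, hC₂, h2⟩ := hω.radialMeasure_Ioo_ge
  refine ⟨C₁ * C₂, by positivity, fun g hg => ?_⟩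
  set d : ℝ → ℝ≥0∞ := fun x => ENNReal.ofReal (tailIntegral ω x / (1 - x)) with hd
  have hdm : AEMeasurable d (volume.restrict (Ioo 0 1)) :=
    (hω.aemeasurable_tailIntegral.div
      (by fun_prop : Measurable fun x : ℝ => 1 - x).aemeasurable).ennreal_ofReal
  set α := (volume.restrict (Ioo (0 : ℝ) 1)).withDensity d with hα
  have hle : ∀ a ∈ Ico (0 : ℝ) 1, α (Ioo a 1)
      ≤ ENNReal.ofReal (C₁ * C₂) * radialMeasure ω (Ioo a 1) := by
    intro a ha
    rw [hα, withDensity_apply _ measurableSet_Ioo, Measure.restrict_restrict measurableSet_Ioo,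
      inter_eq_left.2 (Ioo_subset_Ioo_left ha.1)]
    refine (h1 a ha).trans ?_
    rw [ENNReal.ofReal_mul hC₁.le, ENNReal.ofReal_mul hC₁.le, mul_assoc]
    exact mul_le_mul_right (h2 a ha) _
  have hmono : MonotoneOn (Real.circleAverage (fun z => ‖g z‖ ^ p) 0) (Ioo (0 : ℝ) 1) :=
    fun x hx y hy hxy => circleAverage_rpow_mono hg hp hx.1.le hxy hy.2
  have hcont : ContinuousOn (Real.circleAverage (fun z => ‖g z‖ ^ p) 0) (Ioo (0 : ℝ) 1) :=
    (continuousOn_circleAverage_rpow hg.continuousOn hp).mono Ioo_subset_Ico_self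
  have := lintegral_le_of_monotoneOn ENNReal.ofReal_ne_top hle
    (circleAverage_rpow_nonneg g p) hmono hcont
  rw [restrict_radialMeasure] at this
  calc ∫⁻ ρ in Ioo (0 : ℝ) 1, circleMean p g ρ * d ρ
      = ∫⁻ x in Ioo 0 1, ENNReal.ofReal (Real.circleAverage (fun z => ‖g z‖ ^ p) 0 x) ∂α := by
        have hr : α.restrict (Ioo 0 1) = α := by
          rw [hα, restrict_withDensity measurableSet_Ioo, Measure.restrict_restrict
            measurableSet_Ioo, inter_self]
        rw [hr, hα, lintegral_withDensity_eq_lintegral_mul₀ hdm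
          (hcont.aemeasurable measurableSet_Ioo).ennreal_ofReal]
        refine setLIntegral_congr_fun measurableSet_Ioo fun x hx => ?_
        simp only [Pi.mul_apply]
        rw [circleMean_eq_ofReal hg.continuousOn hp ⟨hx.1.le, hx.2⟩, mul_comm]
    _ ≤ _ := this
    _ = _ := by
        rw [hω.lintegral_enorm_rpow hg.continuousOn]
        congr 1
        refine lintegral_congr_ae ?_
        filter_upwards [IsRadialWeight.radialMeasure_ae ω] with x hx
        exact (circleMean_eq_ofReal hg.continuousOn hp ⟨hx.1.le, hx.2⟩).symm

theorem circleMean_mul_radialMeasure_le {g : ℂ → ℂ} (hg : DifferentiableOn ℂ g unitDisc)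
    {p : ℝ} (hp : 0 < p) {ω : ℂ → ℝ} (hω : IsRadialWeight ω) {s : ℝ} (hs : 0 ≤ s) :
    circleMean p g s * radialMeasure ω (Ioo s 1) ≤ ∫⁻ z, ‖g z‖ₑ ^ p ∂weightedArea ω := by
  rw [hω.lintegral_enorm_rpow hg.continuousOn]
  calc circleMean p g s * radialMeasure ω (Ioo s 1)
      = ∫⁻ _ in Ioo s 1, circleMean p g s ∂radialMeasure ω := by rw [setLIntegral_const]
    _ ≤ ∫⁻ r in Ioo s 1, circleMean p g r ∂radialMeasure ω :=
        setLIntegral_mono' measurableSet_Ioo fun r hr => circleMean_mono hg hp hs hr.1.le hr.2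
    _ ≤ _ := setLIntegral_le_lintegral _ _

/-- Pointwise growth of functions in the weighted Bergman space. -/
theorem IsDoublingWeight.enorm_rpow_mul_tail_le {ω : ℂ → ℝ} (hω : IsDoublingWeight ω)
    {p : ℝ} (hp : 0 < p) : ∃ C : ℝ, 0 < C ∧ ∀ g : ℂ → ℂ, DifferentiableOn ℂ g unitDisc →
      ∀ z ∈ unitDisc, ‖g z‖ₑ ^ p * ENNReal.ofReal (tailIntegral ω ‖z‖ * (1 - ‖z‖))
        ≤ ENNReal.ofReal C * ∫⁻ z, ‖g z‖ₑ ^ p ∂weightedArea ω := by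
  obtain ⟨C₁, hC₁, h1⟩ := hω.upper
  obtain ⟨C₂, hC₂, h2⟩ := hω.radialMeasure_Ioo_ge
  refine ⟨8 * C₁ * C₂, by positivity, fun g hg z hz => ?_⟩
  have hz1 : ‖z‖ < 1 := by simpa using hz
  have hr : ‖z‖ ∈ Ico (0 : ℝ) 1 := ⟨norm_nonneg z, hz1⟩
  set s := (1 + ‖z‖) / 2 with hs
  have hs' : s ∈ Ico (0 : ℝ) 1 := ⟨by rw [hs]; positivity, by rw [hs]; linarith⟩
  rw [mul_comm (tailIntegral ω ‖z‖), ENNReal.ofReal_mul (by linarith), ← mul_assoc]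
  calc ‖g z‖ₑ ^ p * ENNReal.ofReal (1 - ‖z‖) * ENNReal.ofReal (tailIntegral ω ‖z‖)
      ≤ 8 * circleMean p g s *
        (ENNReal.ofReal C₁ * (ENNReal.ofReal C₂ * radialMeasure ω (Ioo s 1))) := by
        refine mul_le_mul' (enorm_rpow_mul_le_circleMean hg hp hz) ?_
        refine (ENNReal.ofReal_le_ofReal (h1 _ hr)).trans ?_
        rw [ENNReal.ofReal_mul (by linarith)]
        exact mul_le_mul_right (h2 s hs') _
    _ = ENNReal.ofReal (8 * C₁ * C₂) * (circleMean p g s * radialMeasure ω (Ioo s 1)) := by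
        rw [ENNReal.ofReal_mul (by positivity), ENNReal.ofReal_mul (by positivity),
          ENNReal.ofReal_ofNat]
        ring
    _ ≤ _ := mul_le_mul_right (circleMean_mul_radialMeasure_le hg hp hω.toIsRadialWeight hs'.1) _

theorem bergmanNorm_eq {p : ℝ} (hp : 0 < p) (ω : ℂ → ℝ) (g : ℂ → ℂ) :
    bergmanNorm p ω g = (∫⁻ z, ‖g z‖ₑ ^ p ∂weightedArea ω) ^ (1 / p) := by
  rw [bergmanNorm, eLpNorm_eq_lintegral_rpow_enorm_toReal (by simpa using hp)
    ENNReal.ofReal_ne_top, ENNReal.toReal_ofReal hp.le]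

/-- For `p ≤ 1` the space `A^p_ω` embeds into a weighted `A^1`. -/
theorem IsDoublingWeight.lintegral_circleMean_one_le {ω : ℂ → ℝ} (hω : IsDoublingWeight ω)
    {p : ℝ} (hp : 0 < p) (hp1 : p ≤ 1) :
    ∃ C : ℝ, 0 < C ∧ ∀ g : ℂ → ℂ, DifferentiableOn ℂ g unitDisc →
      ∫⁻ ρ in Ioo (0 : ℝ) 1, ENNReal.ofReal ((tailIntegral ω ρ * (1 - ρ)) ^ (1 / p) *
        ((1 - ρ) ^ 2)⁻¹) * circleMean 1 g ρ ≤ ENNReal.ofReal C * bergmanNorm p ω g := by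
  obtain ⟨C₁, hC₁, h1⟩ := hω.enorm_rpow_mul_tail_le hp
  obtain ⟨C₂, hC₂, h2⟩ := hω.lintegral_circleMean_mul_tail_le hp
  have he : 0 ≤ 1 / p - 1 := by rw [sub_nonneg, one_le_div hp]; exact hp1
  refine ⟨C₁ ^ (1 / p - 1) * C₂, by positivity, fun g hg => ?_⟩
  set I := ∫⁻ z, ‖g z‖ₑ ^ p ∂weightedArea ω with hI
  set E := (ENNReal.ofReal C₁ * I) ^ (1 / p - 1) with hE
  -- Splitting `|g| = |g|^{1-p} |g|^p`, the first factor is bounded by pointwise growth, its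
  -- exponent being non-negative since `p ≤ 1`.
  have hpt : ∀ z ∈ unitDisc, ENNReal.ofReal ((tailIntegral ω ‖z‖ * (1 - ‖z‖)) ^ (1 / p)) * ‖g z‖ₑ
      ≤ E * (ENNReal.ofReal (tailIntegral ω ‖z‖ * (1 - ‖z‖)) * ‖g z‖ₑ ^ p) := by
    intro z hz
    have hz1 : ‖z‖ < 1 := by simpa using hz
    have hΦ : 0 < tailIntegral ω ‖z‖ * (1 - ‖z‖) :=
      mul_pos (hω.tail_pos _ ⟨norm_nonneg z, hz1⟩) (by linarith)
    rw [← ENNReal.ofReal_rpow_of_nonneg hΦ.le (by positivity)]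
    set Φ := ENNReal.ofReal (tailIntegral ω ‖z‖ * (1 - ‖z‖))
    have h3 := ENNReal.rpow_le_rpow (h1 g hg z hz) he
    rw [ENNReal.mul_rpow_of_nonneg _ _ he, ← ENNReal.rpow_mul] at h3
    have h4 : Φ ^ (1 / p) = Φ ^ (1 / p - 1) * Φ := by
      conv_rhs => rw [← ENNReal.rpow_one Φ, ← ENNReal.rpow_mul, one_mul,
        ← ENNReal.rpow_add_of_nonneg _ _ he zero_le_one, sub_add_cancel]
    have h5 : ‖g z‖ₑ = ‖g z‖ₑ ^ (p * (1 / p - 1)) * ‖g z‖ₑ ^ p := by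
      rw [← ENNReal.rpow_add_of_nonneg _ _ (mul_nonneg hp.le he) hp.le,
        show p * (1 / p - 1) + p = 1 by field_simp; ring, ENNReal.rpow_one]
    calc Φ ^ (1 / p) * ‖g z‖ₑ
        = ‖g z‖ₑ ^ (p * (1 / p - 1)) * Φ ^ (1 / p - 1) * (Φ * ‖g z‖ₑ ^ p) := by
          rw [h4]; nth_rewrite 1 [h5]; ring
      _ ≤ _ := mul_le_mul_left h3 _
  calc ∫⁻ ρ in Ioo (0 : ℝ) 1, ENNReal.ofReal ((tailIntegral ω ρ * (1 - ρ)) ^ (1 / p) *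
        ((1 - ρ) ^ 2)⁻¹) * circleMean 1 g ρ
      ≤ ∫⁻ ρ in Ioo (0 : ℝ) 1, E * (circleMean p g ρ *
          ENNReal.ofReal (tailIntegral ω ρ / (1 - ρ))) := by
        refine setLIntegral_mono' measurableSet_Ioo fun ρ hρ => ?_
        have h1ρ : 0 < 1 - ρ := by linarith [hρ.2]
        have hτ := hω.tail_pos ρ ⟨hρ.1.le, hρ.2⟩
        have hn : ∀ θ, ‖circleMap 0 ρ θ‖ = ρ := fun θ => by simp [abs_of_pos hρ.1]
        have h3 : ENNReal.ofReal ((tailIntegral ω ρ * (1 - ρ)) ^ (1 / p)) * circleMean 1 g ρ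
            ≤ E * (ENNReal.ofReal (tailIntegral ω ρ * (1 - ρ)) * circleMean p g ρ) := by
          rw [circleMean, circleMean, ← lintegral_const_mul' _ _ ENNReal.ofReal_ne_top,
            ← lintegral_const_mul' _ _ ENNReal.ofReal_ne_top, ← lintegral_const_mul'']
          · refine lintegral_mono fun θ => ?_
            have := hpt _ (circleMap_zero_mem_unitDisc hρ θ)
            rw [hn] at this
            simpa using this
          · have hc : Continuous fun θ => g (circleMap 0 ρ θ) :=
              hg.continuousOn.comp_continuous (continuous_circleMap 0 ρ)
                (circleMap_zero_mem_unitDisc hρ)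
            exact ((hc.enorm.measurable.pow_const p).const_mul _).aemeasurable
        rw [mul_comm (_ ^ (1 / p)), ENNReal.ofReal_mul (by positivity), mul_assoc]
        refine (mul_le_mul_right h3 _).trans_eq ?_
        have h4 : tailIntegral ω ρ / (1 - ρ)
            = ((1 - ρ) ^ 2)⁻¹ * (tailIntegral ω ρ * (1 - ρ)) := by field_simp
        rw [h4, ENNReal.ofReal_mul (p := ((1 - ρ) ^ 2)⁻¹) (by positivity)]
        ring
    _ = E * ∫⁻ ρ in Ioo (0 : ℝ) 1, circleMean p g ρ *
          ENNReal.ofReal (tailIntegral ω ρ / (1 - ρ)) := by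
        refine lintegral_const_mul'' _ ((aemeasurable_circleMean hg.continuousOn hp).mul ?_)
        exact (hω.aemeasurable_tailIntegral.div
          (by fun_prop : Measurable fun x : ℝ => 1 - x).aemeasurable).ennreal_ofReal
    _ ≤ E * (ENNReal.ofReal C₂ * I) := mul_le_mul_right (h2 g hg) _
    _ = _ := by
        rw [hE, bergmanNorm_eq hp, ENNReal.mul_rpow_of_nonneg _ _ he,
          ENNReal.ofReal_mul (by positivity), ENNReal.ofReal_rpow_of_nonneg hC₁.le he, ← hI]
        have : I ^ (1 / p) = I ^ (1 / p - 1) * I := by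
          conv_rhs => rw [← ENNReal.rpow_one I, ← ENNReal.rpow_mul, one_mul,
            ← ENNReal.rpow_add_of_nonneg _ _ he zero_le_one, sub_add_cancel]
        rw [this]; ring

/-! ### Averages of a weight and their moments. -/

/-- The radial function `∫_{|z|}^1 2 ω(r)/r dr`. Passing from `ω` to it divides the moments
`∫ |ζ|^{2m} ω dA` by `m + 1`. -/
def averageWeight (ω : ℂ → ℝ) (z : ℂ) : ℝ := ∫ r in ‖z‖..1, 2 * ω (r : ℂ) / r

theorem averageWeight_ofReal (ω : ℂ → ℝ) {ρ : ℝ} (hρ : 0 ≤ ρ) :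
    averageWeight ω (ρ : ℂ) = ∫ r in ρ..1, 2 * ω (r : ℂ) / r := by
  rw [averageWeight, Complex.norm_real, Real.norm_of_nonneg hρ]

namespace IsRadialWeight

variable {ω : ℂ → ℝ}

theorem div_nonneg_ofReal (hω : IsRadialWeight ω) {r : ℝ} (h0 : 0 ≤ r) (h1 : r < 1) :
    0 ≤ 2 * ω (r : ℂ) / r := by
  have := hω.nonneg_ofReal h0 h1
  positivity

theorem integrableOn_div (hω : IsRadialWeight ω) {a : ℝ} (ha : 0 < a) :
    IntegrableOn (fun r : ℝ => 2 * ω (r : ℂ) / r) (Ioo a 1) := by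
  have h := hω.integrableOn_Ioo ha.le
  refine Integrable.mono' (h.const_mul (2 / a)) ?_ ?_
  · exact ((h.aestronglyMeasurable.aemeasurable.const_mul 2).div
      measurable_id.aemeasurable).aestronglyMeasurable
  · filter_upwards [ae_restrict_mem measurableSet_Ioo] with r hr
    have h0 := hω.nonneg_ofReal (ha.trans hr.1).le hr.2
    rw [Real.norm_of_nonneg (hω.div_nonneg_ofReal (ha.trans hr.1).le hr.2), div_mul_eq_mul_div]
    exact div_le_div_of_nonneg_left (by positivity) ha hr.1.le

theorem averageWeight_le (hω : IsRadialWeight ω) {ρ : ℝ} (hρ : ρ ∈ Ioo (0 : ℝ) 1) :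
    averageWeight ω (ρ : ℂ) ≤ 2 / ρ * tailIntegral ω ρ := by
  rw [averageWeight_ofReal ω hρ.1.le, tailIntegral_eq_setIntegral hρ.2.le, ← integral_const_mul,
    intervalIntegral.integral_of_le hρ.2.le, integral_Ioc_eq_integral_Ioo]
  refine setIntegral_mono_on (hω.integrableOn_div hρ.1)
    ((hω.integrableOn_Ioo hρ.1.le).const_mul _) measurableSet_Ioo fun r hr => ?_
  have h0 := hω.nonneg_ofReal (hρ.1.trans hr.1).le hr.2
  rw [div_mul_eq_mul_div]
  exact div_le_div_of_nonneg_left (by positivity) hρ.1 hr.1.le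

theorem averageWeight_ge (hω : IsRadialWeight ω) {ρ : ℝ} (hρ : ρ ∈ Ioo (0 : ℝ) 1) :
    2 * tailIntegral ω ρ ≤ averageWeight ω (ρ : ℂ) := by
  rw [averageWeight_ofReal ω hρ.1.le, tailIntegral_eq_setIntegral hρ.2.le, ← integral_const_mul,
    intervalIntegral.integral_of_le hρ.2.le, integral_Ioc_eq_integral_Ioo]
  refine setIntegral_mono_on ((hω.integrableOn_Ioo hρ.1.le).const_mul _)
    (hω.integrableOn_div hρ.1) measurableSet_Ioo fun r hr => ?_
  have h0 := hω.nonneg_ofReal (hρ.1.trans hr.1).le hr.2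
  rw [le_div_iff₀ (hρ.1.trans hr.1)]
  exact mul_le_of_le_one_right (by positivity) hr.2.le

theorem ofReal_averageWeight (hω : IsRadialWeight ω) {ρ : ℝ} (hρ : ρ ∈ Ioo (0 : ℝ) 1) :
    ENNReal.ofReal (averageWeight ω (ρ : ℂ))
      = ∫⁻ r in Ioo ρ 1, ENNReal.ofReal (2 * ω (r : ℂ) / r) := by
  rw [averageWeight_ofReal ω hρ.1.le, intervalIntegral.integral_of_le hρ.2.le,
    integral_Ioc_eq_integral_Ioo, ofReal_integral_eq_lintegral_ofReal (hω.integrableOn_div hρ.1)]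
  filter_upwards [ae_restrict_mem measurableSet_Ioo] with r hr
  exact hω.div_nonneg_ofReal (hρ.1.trans hr.1).le hr.2

theorem lintegral_averageWeight (hω : IsRadialWeight ω) {φ : ℝ → ℝ≥0∞} (hφ : Measurable φ) :
    ∫⁻ ρ in Ioo (0 : ℝ) 1, φ ρ * ENNReal.ofReal (averageWeight ω (ρ : ℂ))
      = ∫⁻ r in Ioo (0 : ℝ) 1, ENNReal.ofReal (2 * ω (r : ℂ) / r) * ∫⁻ ρ in Ioo 0 r, φ ρ := by
  set d : ℝ → ℝ≥0∞ := fun r => ENNReal.ofReal (2 * ω (r : ℂ) / r) with hd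
  have hdm : AEMeasurable d (volume.restrict (Ioo (0 : ℝ) 1)) :=
    (((hω.integrableOn_Ioo le_rfl).aestronglyMeasurable.aemeasurable.const_mul 2).div
      measurable_id.aemeasurable).ennreal_ofReal
  calc ∫⁻ ρ in Ioo (0 : ℝ) 1, φ ρ * ENNReal.ofReal (averageWeight ω (ρ : ℂ))
      = ∫⁻ ρ in Ioo (0 : ℝ) 1, ∫⁻ r in Ioo (0 : ℝ) 1,
          φ ρ * d r * {x : ℝ × ℝ | x.1 < x.2}.indicator 1 (ρ, r) := by
        refine setLIntegral_congr_fun measurableSet_Ioo fun ρ hρ => ?_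
        rw [hω.ofReal_averageWeight hρ, ← inter_eq_left.2 (Ioo_subset_Ioo_left hρ.1.le),
          ← Measure.restrict_restrict measurableSet_Ioo, ← lintegral_indicator measurableSet_Ioo,
          ← lintegral_const_mul'' _ (hdm.indicator measurableSet_Ioo)]
        refine setLIntegral_congr_fun measurableSet_Ioo fun r hr => ?_
        by_cases h : ρ < r
        · have h1 : r ∈ Ioo ρ 1 := ⟨h, hr.2⟩
          have h2 : (ρ, r) ∈ {x : ℝ × ℝ | x.1 < x.2} := h
          simp [indicator_of_mem h1, indicator_of_mem h2, hd]
        · have h1 : r ∉ Ioo ρ 1 := fun h' => h h'.1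
          have h2 : (ρ, r) ∉ {x : ℝ × ℝ | x.1 < x.2} := h
          simp [indicator_of_notMem h1, indicator_of_notMem h2]
    _ = ∫⁻ r in Ioo (0 : ℝ) 1, ∫⁻ ρ in Ioo (0 : ℝ) 1,
          φ ρ * d r * {x : ℝ × ℝ | x.1 < x.2}.indicator 1 (ρ, r) := by
        refine lintegral_lintegral_swap ?_
        refine ((hφ.comp measurable_fst).aemeasurable.mul hdm.comp_snd).mul ?_
        exact (measurable_one.indicator (measurableSet_lt measurable_fst
          measurable_snd)).aemeasurable
    _ = _ := by
        refine setLIntegral_congr_fun measurableSet_Ioo fun r hr => ?_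
        rw [← inter_eq_left.2 (Ioo_subset_Ioo_right hr.2.le : Ioo 0 r ⊆ Ioo 0 1),
          ← Measure.restrict_restrict measurableSet_Ioo,
          ← lintegral_indicator (s := Ioo 0 r) measurableSet_Ioo, ← lintegral_const_mul _ (hφ.indicator measurableSet_Ioo)]
        refine setLIntegral_congr_fun measurableSet_Ioo fun ρ hρ => ?_
        by_cases h : ρ < r
        · have h1 : ρ ∈ Ioo 0 r := ⟨hρ.1, h⟩
          have h2 : (ρ, r) ∈ {x : ℝ × ℝ | x.1 < x.2} := h
          simp [indicator_of_mem h1, indicator_of_mem h2, hd, mul_comm]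
        · have h1 : ρ ∉ Ioo 0 r := fun h' => h h'.2
          have h2 : (ρ, r) ∉ {x : ℝ × ℝ | x.1 < x.2} := h
          simp [indicator_of_notMem h1, indicator_of_notMem h2]

/-- Tonelli gives `∫_a^1 2 ω(r) (r - a)/r dr`, and `(r - a)/r ≤ 1 - a` absorbs the singularity of
`1/r`. -/
theorem lintegral_Ioo_averageWeight_le (hω : IsRadialWeight ω) {a : ℝ} (ha : 0 ≤ a)
    (ha1 : a ≤ 1) : ∫⁻ ρ in Ioo a 1, ENNReal.ofReal (averageWeight ω (ρ : ℂ))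
      ≤ ENNReal.ofReal (2 * (1 - a) * tailIntegral ω a) := by
  have h1 := hω.lintegral_averageWeight (measurable_one.indicator (measurableSet_Ioi (a := a)))
  have h2 : ∫⁻ ρ in Ioo (0 : ℝ) 1, (Ioi a).indicator (1 : ℝ → ℝ≥0∞) ρ *
      ENNReal.ofReal (averageWeight ω (ρ : ℂ))
      = ∫⁻ ρ in Ioo a 1, ENNReal.ofReal (averageWeight ω (ρ : ℂ)) := by
    have h3 : Ioo a 1 = Ioi a ∩ Ioo 0 1 := by
      ext x; simp only [mem_Ioo, mem_inter_iff, mem_Ioi]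
      constructor
      · rintro ⟨h, h'⟩; exact ⟨h, ha.trans_lt h, h'⟩
      · rintro ⟨h, _, h'⟩; exact ⟨h, h'⟩
    rw [h3, ← Measure.restrict_restrict measurableSet_Ioi, ← lintegral_indicator measurableSet_Ioi]
    refine lintegral_congr fun ρ => ?_
    by_cases h : ρ ∈ Ioi a
    · simp [indicator_of_mem h]
    · simp [indicator_of_notMem h]
  rw [← h2, h1, ENNReal.ofReal_mul (by linarith), hω.ofReal_tailIntegral ha ha1,
    ← lintegral_const_mul' _ _ ENNReal.ofReal_ne_top]
  rw [← lintegral_indicator measurableSet_Ioo, ← lintegral_indicator measurableSet_Ioo]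
  refine lintegral_mono fun r => ?_
  by_cases hr : r ∈ Ioo (0 : ℝ) 1
  · rw [indicator_of_mem hr, lintegral_indicator measurableSet_Ioi, Measure.restrict_restrict
      measurableSet_Ioi]
    simp only [Pi.one_apply, setLIntegral_one]
    have h3 : Ioi a ∩ Ioo 0 r = Ioo a r := by
      ext x; simp only [mem_Ioo, mem_inter_iff, mem_Ioi]
      constructor
      · rintro ⟨h, _, h'⟩; exact ⟨h, h'⟩
      · rintro ⟨h, h'⟩; exact ⟨h, ha.trans_lt h, h'⟩
    rw [h3, Real.volume_Ioo]
    by_cases har : a < r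
    · rw [indicator_of_mem (show r ∈ Ioo a 1 from ⟨har, hr.2⟩), ← ENNReal.ofReal_mul (hω.div_nonneg_ofReal hr.1.le hr.2),
        ← ENNReal.ofReal_mul (by linarith)]
      refine ENNReal.ofReal_le_ofReal ?_
      have h0 := hω.nonneg_ofReal hr.1.le hr.2
      rw [div_mul_eq_mul_div, div_le_iff₀ hr.1]
      have : r - a ≤ (1 - a) * r := by nlinarith [hr.2]
      nlinarith
    · rw [ENNReal.ofReal_of_nonpos (by linarith : r - a ≤ 0), mul_zero]
      exact zero_le
  · rw [indicator_of_notMem hr]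
    exact zero_le

theorem continuousOn_averageWeight (hω : IsRadialWeight ω) :
    ContinuousOn (averageWeight ω) (unitDisc \ {0}) := by
  intro z hz
  have hz1 : ‖z‖ < 1 := by simpa using hz.1
  have hz0 : 0 < ‖z‖ := norm_pos_iff.2 hz.2
  have hint : IntegrableOn (fun r : ℝ => 2 * ω (r : ℂ) / r) (uIcc (‖z‖ / 2) 1) := by
    rw [uIcc_of_le (by linarith), integrableOn_Icc_iff_integrableOn_Ioo]
    exact hω.integrableOn_div (by linarith)
  have h1 := intervalIntegral.continuousOn_primitive_interval_left hint
  have h2 : ContinuousAt (fun x : ℝ => ∫ r in x..1, 2 * ω (r : ℂ) / r) ‖z‖ := by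
    refine h1.continuousAt ?_
    rw [uIcc_of_le (by linarith)]
    exact Icc_mem_nhds (by linarith) hz1
  exact (ContinuousAt.comp (f := fun w : ℂ => ‖w‖) h2 continuous_norm.continuousAt).continuousWithinAt

theorem averageWeight_nonneg (hω : IsRadialWeight ω) {z : ℂ} (hz : z ∈ unitDisc) :
    0 ≤ averageWeight ω z := by
  rw [mem_ball_zero_iff] at hz
  rw [averageWeight, intervalIntegral.integral_of_le hz.le, integral_Ioc_eq_integral_Ioo]
  exact setIntegral_nonneg measurableSet_Ioo fun r hr =>
    hω.div_nonneg_ofReal ((norm_nonneg z).trans hr.1.le) hr.2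

theorem averageWeight_isRadialWeight (hω : IsRadialWeight ω) :
    IsRadialWeight (averageWeight ω) := by
  have hcont : ContinuousOn (fun ρ : ℝ => averageWeight ω (ρ : ℂ)) (Ioo 0 1) := by
    refine hω.continuousOn_averageWeight.comp Complex.continuous_ofReal.continuousOn fun ρ hρ => ?_
    refine ⟨by simpa [abs_of_pos hρ.1] using hρ.2, ?_⟩
    simpa using hρ.1.ne'
  have hfin : ∫⁻ ρ in Ioo (0 : ℝ) 1, ENNReal.ofReal (averageWeight ω (ρ : ℂ)) < ⊤ :=
    (hω.lintegral_Ioo_averageWeight_le le_rfl zero_le_one).trans_lt ENNReal.ofReal_lt_top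
  have hmem : ∀ ρ : ℝ, ρ ∈ Ioo (0 : ℝ) 1 → 0 ≤ averageWeight ω (ρ : ℂ) := fun ρ hρ =>
    hω.averageWeight_nonneg (by simpa [abs_of_pos hρ.1] using hρ.2)
  have hint : IntegrableOn (fun ρ : ℝ => averageWeight ω (ρ : ℂ)) (Ioo 0 1) := by
    refine ⟨hcont.aestronglyMeasurable measurableSet_Ioo, ?_⟩
    rw [hasFiniteIntegral_iff_ofReal]
    · exact hfin
    · filter_upwards [ae_restrict_mem measurableSet_Ioo] with ρ hρ using hmem ρ hρ
  refine ⟨fun z hz => hω.averageWeight_nonneg hz, ?_, fun z _ => ?_, fun r hr => ?_⟩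
  · have hae : AEStronglyMeasurable (averageWeight ω) (volume.restrict unitDisc) := by
      have h1 : AEStronglyMeasurable (averageWeight ω) (volume.restrict (unitDisc \ {0})) :=
        hω.continuousOn_averageWeight.aestronglyMeasurable
          (measurableSet_ball.diff (measurableSet_singleton 0))
      rwa [Measure.restrict_congr_set (sdiff_null_ae_eq_self (by simp))] at h1
    refine ⟨hae, ?_⟩
    rw [hasFiniteIntegral_iff_ofReal]
    · have hR := isRadialWeight_one
      have hw1 : weightedArea (fun _ => 1)
          = ENNReal.ofReal Real.pi⁻¹ • volume.restrict unitDisc := by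
        simp [weightedArea]
      have h1 : ∫⁻ z, ENNReal.ofReal (averageWeight ω z) ∂weightedArea (fun _ => 1) < ⊤ := by
        rw [hR.lintegral_weightedArea]
        · have h2 : ∀ᵐ r ∂radialMeasure fun _ => 1,
              ∫⁻ θ, ENNReal.ofReal (averageWeight ω (circleMap 0 r θ)) ∂angularMeasure
                = ENNReal.ofReal (averageWeight ω (r : ℂ)) *
                  angularMeasure univ := by
            filter_upwards [IsRadialWeight.radialMeasure_ae fun _ => 1] with r hr
            rw [← lintegral_const]
            refine lintegral_congr fun θ => ?_
            simp [averageWeight]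
          rw [lintegral_congr_ae h2, lintegral_mul_const', hR.lintegral_radialMeasure]
          · refine ENNReal.mul_lt_top (lt_of_le_of_lt ?_ (ENNReal.mul_lt_top
              (ENNReal.ofReal_lt_top (r := 2)) hfin)) (measure_lt_top _ _)
            rw [← lintegral_const_mul' _ _ ENNReal.ofReal_ne_top]
            refine setLIntegral_mono' measurableSet_Ioo fun ρ hρ => ?_
            exact mul_le_mul_left (ENNReal.ofReal_le_ofReal (by linarith [hρ.2])) _
          · exact (hcont.aemeasurable measurableSet_Ioo).ennreal_ofReal
          · exact measure_ne_top _ _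
        · rw [hw1]
          exact (hae.aemeasurable.smul_measure _).ennreal_ofReal
      rw [hw1, lintegral_smul_measure, smul_eq_mul] at h1
      refine lt_top_iff_ne_top.2 fun h => ?_
      rw [h, ENNReal.mul_top (by simpa using Real.pi_pos)] at h1
      exact lt_irrefl _ h1
    · filter_upwards [ae_restrict_mem measurableSet_ball] with z hz
      exact hω.averageWeight_nonneg hz
  · simp [averageWeight]
  · rw [tailIntegral]
    refine intervalIntegral.intervalIntegral_pos_of_pos_on ?_ (fun x hx => ?_) hr.2
    · rw [intervalIntegrable_iff_integrableOn_Ioo_of_le hr.2.le]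
      exact hint.mono_set (Ioo_subset_Ioo_left hr.1)
    · have hx' : x ∈ Ioo (0 : ℝ) 1 := ⟨hr.1.trans_lt hx.1, hx.2⟩
      have := hω.averageWeight_ge hx'
      have := hω.tail_pos x ⟨hx'.1.le, hx'.2⟩
      linarith

theorem tailIntegral_averageWeight_le (hω : IsRadialWeight ω) {a : ℝ} (ha : a ∈ Ico (0 : ℝ) 1) :
    tailIntegral (averageWeight ω) a ≤ 2 * (1 - a) * tailIntegral ω a := by
  have h := hω.lintegral_Ioo_averageWeight_le ha.1 ha.2.le
  rw [← hω.averageWeight_isRadialWeight.ofReal_tailIntegral ha.1 ha.2.le] at h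
  refine (ENNReal.ofReal_le_ofReal_iff ?_).1 h
  have := hω.tail_pos a ha
  have := ha.2
  exact mul_nonneg (by linarith) (by linarith)

theorem ofReal_radialMoment (hω : IsRadialWeight ω) (m : ℕ) :
    ENNReal.ofReal (radialMoment ω m)
      = ∫⁻ r in Ioo (0 : ℝ) 1, ENNReal.ofReal (2 * r ^ (2 * m + 1)) * ENNReal.ofReal (ω (r : ℂ)) := by
  rw [radialMoment, ofReal_integral_eq_lintegral_ofReal (hω.integrable_pow _),
    hω.lintegral_radialMeasure (by fun_prop)]
  · refine setLIntegral_congr_fun measurableSet_Ioo fun r hr => ?_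
    have h0 := hω.nonneg_ofReal hr.1.le hr.2
    have hr0 := hr.1.le
    rw [← ENNReal.ofReal_mul (by positivity), ← ENNReal.ofReal_mul (by positivity)]
    congr 1; ring
  · filter_upwards [IsRadialWeight.radialMeasure_ae ω] with r hr
    exact pow_nonneg hr.1.le _

theorem radialMoment_nonneg (ω : ℂ → ℝ) (m : ℕ) : 0 ≤ radialMoment ω m := by
  refine integral_nonneg_of_ae ?_
  filter_upwards [IsRadialWeight.radialMeasure_ae ω] with r hr
  exact pow_nonneg hr.1.le _

/-- After Tonelli the inner integral is `r ^ (2 * m + 2) / (m + 1)`, and the denominator `r` in the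
average restores the power `r ^ (2 * m + 1)` of the original moment. This is the reason for
averaging `2 ω(r) / r`. -/
theorem radialMoment_averageWeight (hω : IsRadialWeight ω) (m : ℕ) :
    radialMoment (averageWeight ω) m = radialMoment ω m / (m + 1) := by
  have h : ENNReal.ofReal (radialMoment (averageWeight ω) m)
      = ENNReal.ofReal (radialMoment ω m / (m + 1)) := by
    rw [hω.averageWeight_isRadialWeight.ofReal_radialMoment,
      hω.lintegral_averageWeight (by fun_prop), div_eq_inv_mul,
      ENNReal.ofReal_mul (by positivity), hω.ofReal_radialMoment,
      ← lintegral_const_mul' _ _ ENNReal.ofReal_ne_top]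
    refine setLIntegral_congr_fun measurableSet_Ioo fun r hr => ?_
    have h0 := hω.nonneg_ofReal hr.1.le hr.2
    have hr0 := hr.1
    have h1 : ∫⁻ ρ in Ioo 0 r, ENNReal.ofReal (2 * ρ ^ (2 * m + 1))
        = ENNReal.ofReal (r ^ (2 * m + 2) / (m + 1)) := by
      rw [← ofReal_integral_eq_lintegral_ofReal]
      · rw [← integral_Ioc_eq_integral_Ioo, ← intervalIntegral.integral_of_le hr.1.le,
          intervalIntegral.integral_const_mul, integral_pow]
        congr 1
        push_cast
        field_simp
        ring
      · exact ((by fun_prop : Continuous fun ρ : ℝ => 2 * ρ ^ (2 * m + 1)).integrableOn_Icc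
          (a := 0) (b := r)).mono_set Ioo_subset_Icc_self
      · filter_upwards [ae_restrict_mem measurableSet_Ioo] with ρ hρ
        have := hρ.1.le
        simp only [Pi.zero_apply]; positivity
    rw [h1, ← ENNReal.ofReal_mul (by positivity), ← ENNReal.ofReal_mul (by positivity),
      ← ENNReal.ofReal_mul (by positivity)]
    congr 1
    field_simp
    ring
  refine (ENNReal.ofReal_eq_ofReal_iff (radialMoment_nonneg _ _) ?_).1 h
  exact div_nonneg (radialMoment_nonneg _ _) (by positivity)

end IsRadialWeight

/-! ### The Euler operator and integration by parts. -/

theorem taylorCoeff_eq_of_hasSum {F : ℂ → ℂ} {a : ℕ → ℂ}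
    (h : ∀ z ∈ unitDisc, HasSum (fun m => a m * z ^ m) (F z)) (hF : DifferentiableOn ℂ F unitDisc)
    (m : ℕ) : taylorCoeff F m = a m := by
  have key : ∀ b : ℕ → ℂ, (∀ z ∈ unitDisc, HasSum (fun m => b m * z ^ m) (F z)) →
      HasFPowerSeriesAt F (FormalMultilinearSeries.ofScalars ℂ b) 0 := by
    intro b hb
    rw [hasFPowerSeriesAt_iff]
    filter_upwards [isOpen_ball.mem_nhds (by simp : (0 : ℂ) ∈ unitDisc)] with z hz
    rw [zero_add]
    refine (hb z hz).congr_fun fun m => ?_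
    simp [mul_comm]
  have h1 := (key _ fun z hz => hasSum_taylorCoeff hF hz).eq_formalMultilinearSeries (key a h)
  have h2 := congrArg (fun p => p.coeff m) h1
  simpa using h2

/-- Falling factorials are the eigenvalues of `ζ^j d^j/dζ^j` on `ζ^m`, so this expands `(1 + ζ
d/dζ)^n` in those operators. The induction uses `(m+1) (m)_j = (m)_{j+1} + (j+1) (m)_j` and the
Stirling recurrence. -/
theorem succ_pow_eq_sum_descFactorial (n m : ℕ) :
    (m + 1) ^ n = ∑ j ∈ Finset.range (n + 1),
      Nat.stirlingSecond (n + 1) (j + 1) * m.descFactorial j := by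
  induction n with
  | zero => simp [Nat.stirlingSecond_self]
  | succ n ih =>
    have hd : ∀ j, (m + 1) * m.descFactorial j
        = m.descFactorial (j + 1) + (j + 1) * m.descFactorial j := by
      intro j
      rw [Nat.descFactorial_succ, ← add_mul]
      rcases le_or_gt j m with h | h
      · congr 1; omega
      · rw [Nat.descFactorial_eq_zero_iff_lt.2 h]; simp
    rw [pow_succ', ih, Finset.mul_sum]
    have h1 : ∑ j ∈ Finset.range (n + 2), Nat.stirlingSecond (n + 1) j * m.descFactorial j
        = ∑ j ∈ Finset.range (n + 1),
          Nat.stirlingSecond (n + 1) (j + 1) * m.descFactorial (j + 1) := by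
      rw [Finset.sum_range_succ']
      simp [Nat.stirlingSecond_succ_zero]
    have h2 : ∑ j ∈ Finset.range (n + 2),
          (j + 1) * (Nat.stirlingSecond (n + 1) (j + 1) * m.descFactorial j)
        = ∑ j ∈ Finset.range (n + 1),
          (j + 1) * (Nat.stirlingSecond (n + 1) (j + 1) * m.descFactorial j) := by
      rw [Finset.sum_range_succ, Nat.stirlingSecond_eq_zero_of_lt (by omega)]
      simp
    calc ∑ j ∈ Finset.range (n + 1),
          (m + 1) * (Nat.stirlingSecond (n + 1) (j + 1) * m.descFactorial j)
        = ∑ j ∈ Finset.range (n + 1), (Nat.stirlingSecond (n + 1) (j + 1) * m.descFactorial (j + 1)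
          + (j + 1) * (Nat.stirlingSecond (n + 1) (j + 1) * m.descFactorial j)) := by
          refine Finset.sum_congr rfl fun j _ => ?_
          rw [mul_left_comm, hd]; ring
      _ = _ := by
          rw [Finset.sum_add_distrib, ← h1, ← h2, ← Finset.sum_add_distrib]
          refine Finset.sum_congr rfl fun j _ => ?_
          rw [Nat.stirlingSecond_succ_succ (n + 1) j]; ring

/-- The differential operator `(1 + ζ d/dζ)^n`. -/
def eulerDeriv (n : ℕ) (f : ℂ → ℂ) (ζ : ℂ) : ℂ :=
  ∑ j ∈ Finset.range (n + 1),
    (Nat.stirlingSecond (n + 1) (j + 1) : ℂ) * (ζ ^ j * iteratedDeriv j f ζ)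

theorem differentiableOn_eulerDeriv {f : ℂ → ℂ} (hf : DifferentiableOn ℂ f unitDisc) (n : ℕ) :
    DifferentiableOn ℂ (eulerDeriv n f) unitDisc := by
  refine DifferentiableOn.fun_sum fun j _ => ?_
  have h : DifferentiableOn ℂ (fun ζ : ℂ => ζ ^ j) unitDisc := by fun_prop
  exact (h.mul (hf.iteratedDeriv_unitDisc j)).const_mul _

theorem hasSum_pow_mul_iteratedDeriv {f : ℂ → ℂ} (hf : DifferentiableOn ℂ f unitDisc) (j : ℕ)
    {ζ : ℂ} (hζ : ζ ∈ unitDisc) :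
    HasSum (fun m : ℕ => (m.descFactorial j : ℂ) * taylorCoeff f m * ζ ^ m)
      (ζ ^ j * iteratedDeriv j f ζ) := by
  have h := (hasSum_taylorCoeff (hf.iteratedDeriv_unitDisc j) hζ).mul_left (ζ ^ j)
  rw [← hasSum_nat_add_iff' j, Finset.sum_eq_zero, sub_zero]
  · refine h.congr_fun fun m => ?_
    rw [Nat.add_descFactorial_eq_ascFactorial, taylorCoeff_iteratedDeriv]
    ring
  · intro m hm
    rw [Nat.descFactorial_eq_zero_iff_lt.2 (Finset.mem_range.1 hm)]
    simp

theorem taylorCoeff_eulerDeriv {f : ℂ → ℂ} (hf : DifferentiableOn ℂ f unitDisc) (n m : ℕ) :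
    taylorCoeff (eulerDeriv n f) m = ((m : ℂ) + 1) ^ n * taylorCoeff f m := by
  refine taylorCoeff_eq_of_hasSum (a := fun m => ((m : ℂ) + 1) ^ n * taylorCoeff f m) (fun ζ hζ => ?_) (differentiableOn_eulerDeriv hf n) m
  have h := hasSum_sum (s := Finset.range (n + 1)) fun j _ =>
    (hasSum_pow_mul_iteratedDeriv hf j hζ).mul_left (Nat.stirlingSecond (n + 1) (j + 1) : ℂ)
  refine h.congr_fun fun m => ?_
  have h2 : ((m : ℂ) + 1) ^ n = ((m + 1) ^ n : ℕ) := by push_cast; rfl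
  rw [h2, succ_pow_eq_sum_descFactorial, Nat.cast_sum, Finset.sum_mul, Finset.sum_mul]
  refine Finset.sum_congr rfl fun j _ => ?_
  push_cast; ring

namespace IsRadialWeight

variable {ω : ℂ → ℝ}

theorem iterate_averageWeight (hω : IsRadialWeight ω) (n : ℕ) :
    IsRadialWeight (averageWeight^[n] ω) := by
  induction n with
  | zero => exact hω
  | succ n ih =>
    rw [Function.iterate_succ_apply']
    exact ih.averageWeight_isRadialWeight

theorem radialMoment_iterate (hω : IsRadialWeight ω) (n m : ℕ) :
    radialMoment (averageWeight^[n] ω) m = radialMoment ω m / (m + 1) ^ n := by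
  induction n with
  | zero => simp
  | succ n ih =>
    rw [Function.iterate_succ_apply', (hω.iterate_averageWeight n).radialMoment_averageWeight, ih,
      div_div, pow_succ]

theorem tailIntegral_iterate_le (hω : IsRadialWeight ω) (n : ℕ) {a : ℝ} (ha : a ∈ Ico (0 : ℝ) 1) :
    tailIntegral (averageWeight^[n] ω) a ≤ 2 ^ n * (1 - a) ^ n * tailIntegral ω a := by
  have h1 : 0 ≤ 1 - a := by linarith [ha.2]
  induction n with
  | zero => simp
  | succ n ih =>
    rw [Function.iterate_succ_apply']
    calc _ ≤ _ := (hω.iterate_averageWeight n).tailIntegral_averageWeight_le ha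
      _ ≤ 2 * (1 - a) * (2 ^ n * (1 - a) ^ n * tailIntegral ω a) := by gcongr
      _ = _ := by ring

/-- The last average is bounded by `2/ρ` times a tail, whose `n` earlier averages each contribute a
factor `2 (1 - ρ)`; the polar factor `ρ` cancels `1/ρ`. -/
theorem lintegral_radialMeasure_iterate_le (hω : IsRadialWeight ω) (n : ℕ) {h : ℝ → ℝ≥0∞}
    (hh : AEMeasurable h (volume.restrict (Ioo 0 1))) :
    ∫⁻ r, h r ∂radialMeasure (averageWeight^[n + 1] ω)
      ≤ ∫⁻ ρ in Ioo (0 : ℝ) 1,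
        ENNReal.ofReal (4 * 2 ^ n * ((1 - ρ) ^ n * tailIntegral ω ρ)) * h ρ := by
  rw [(hω.iterate_averageWeight (n + 1)).lintegral_radialMeasure hh]
  refine setLIntegral_mono' measurableSet_Ioo fun ρ hρ => ?_
  refine mul_le_mul_left (ENNReal.ofReal_le_ofReal ?_) _
  rw [Function.iterate_succ_apply']
  have h1 := (hω.iterate_averageWeight n).averageWeight_le hρ
  have h2 := hω.tailIntegral_iterate_le n ⟨hρ.1.le, hρ.2⟩
  have h0 := hρ.1
  calc 2 * ρ * averageWeight (averageWeight^[n] ω) ρ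
      ≤ 2 * ρ * (2 / ρ * (2 ^ n * (1 - ρ) ^ n * tailIntegral ω ρ)) := by
        gcongr
        exact h1.trans (by gcongr)
    _ = _ := by field_simp; ring

/-- Integration by parts against a bounded analytic function. -/
theorem integral_mul_conj_eq_eulerDeriv (hω : IsRadialWeight ω) {f G : ℂ → ℂ}
    (hf : DifferentiableOn ℂ f unitDisc) (hfi : Integrable f (weightedArea ω)) (n : ℕ)
    (hD : Integrable (eulerDeriv n f) (weightedArea (averageWeight^[n] ω)))
    (hG : G ∈ boundedAnalytic) :
    ∫ ζ, f ζ * conj (G ζ) ∂weightedArea ω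
      = ∫ ζ, eulerDeriv n f ζ * conj (G ζ) ∂weightedArea (averageWeight^[n] ω) := by
  obtain ⟨hGd, M, hM⟩ := hG
  have hdil : ∀ {s : ℝ}, s ∈ Ico (0 : ℝ) 1 → ∀ {ζ : ℂ}, ζ ∈ unitDisc → (s : ℂ) * ζ ∈ unitDisc := by
    intro s hs ζ hζ
    exact IsDoublingWeight.mul_mem_unitDisc (by simpa [abs_of_nonneg hs.1] using hs.2) hζ
  have hseries : ∀ {s : ℝ}, s ∈ Ico (0 : ℝ) 1 → ∀ {ζ : ℂ}, ζ ∈ unitDisc →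
      ∑' m, taylorCoeff G m * (s : ℂ) ^ m * ζ ^ m = G (s * ζ) := by
    intro s hs ζ hζ
    rw [← (hasSum_taylorCoeff hGd (hdil hs hζ)).tsum_eq]
    congr 1 with m
    ring
  -- A dilate of `G` has absolutely summable coefficients, so both pairings expand into series, and
  -- `(m+1)^n` from the Euler operator cancels `(m+1)^{-n}` from the moments. Letting the dilation
  -- tend to 1 is dominated convergence, as `G` is bounded.
  have hkey : ∀ s ∈ Ico (0 : ℝ) 1, ∫ ζ, f ζ * conj (G (s * ζ)) ∂weightedArea ω
      = ∫ ζ, eulerDeriv n f ζ * conj (G (s * ζ)) ∂weightedArea (averageWeight^[n] ω) := by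
    intro s hs
    have hc : Summable fun m => ‖taylorCoeff G m * (s : ℂ) ^ m‖ := by
      refine (summable_norm_taylorCoeff hGd hs).congr fun m => ?_
      simp [abs_of_nonneg hs.1]
    have h1 := hω.hasSum_integral_mul_conj_series hf hfi hc
    have h2 := (hω.iterate_averageWeight n).hasSum_integral_mul_conj_series
      (differentiableOn_eulerDeriv hf n) hD hc
    have h3 : (fun m => conj (taylorCoeff G m * (s : ℂ) ^ m) *
          (taylorCoeff (eulerDeriv n f) m * radialMoment (averageWeight^[n] ω) m))
        = fun m => conj (taylorCoeff G m * (s : ℂ) ^ m) * (taylorCoeff f m * radialMoment ω m) := by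
      ext m
      rw [taylorCoeff_eulerDeriv hf, hω.radialMoment_iterate]
      have : (m : ℂ) + 1 ≠ 0 := Nat.cast_add_one_ne_zero m
      push_cast
      field_simp
    rw [h3] at h2
    have h4 := h1.unique h2
    have h5 : ∀ (F : ℂ → ℂ) (η : ℂ → ℝ),
        ∫ ζ, F ζ * conj (∑' m, taylorCoeff G m * (s : ℂ) ^ m * ζ ^ m) ∂weightedArea η
          = ∫ ζ, F ζ * conj (G (s * ζ)) ∂weightedArea η := by
      intro F η
      refine integral_congr_ae ?_
      filter_upwards [weightedArea_ae η] with ζ hζ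
      rw [hseries hs hζ]
    rwa [h5, h5] at h4
  set s : ℕ → ℝ := fun k => 1 - 1 / ((k : ℝ) + 1) with hs
  have hsm : ∀ k, s k ∈ Ico (0 : ℝ) 1 := by
    intro k
    have : (0 : ℝ) < 1 / ((k : ℝ) + 1) := by positivity
    have : 1 / ((k : ℝ) + 1) ≤ 1 := by
      rw [div_le_one (by positivity)]; linarith [(Nat.cast_nonneg k : (0 : ℝ) ≤ k)]
    constructor <;> simp only [hs] <;> linarith
  have hst : Filter.Tendsto s Filter.atTop (nhds 1) := by
    simpa [hs] using tendsto_one_div_add_atTop_nhds_zero_nat.const_sub (1 : ℝ)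
  have hlim : ∀ (F : ℂ → ℂ) (η : ℂ → ℝ), Integrable F (weightedArea η) →
      Filter.Tendsto (fun k => ∫ ζ, F ζ * conj (G (s k * ζ)) ∂weightedArea η) Filter.atTop
        (nhds (∫ ζ, F ζ * conj (G ζ) ∂weightedArea η)) := by
    intro F η hF
    refine tendsto_integral_of_dominated_convergence (fun ζ => M * ‖F ζ‖) (fun k => ?_)
      (hF.norm.const_mul M) (fun k => ?_) ?_
    · have hcont : ContinuousOn (fun ζ => G (s k * ζ)) unitDisc :=
        hGd.continuousOn.comp (by fun_prop) fun ζ hζ => hdil (hsm k) hζ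
      exact hF.1.mul (Complex.continuous_conj.comp_aestronglyMeasurable
        (hcont.aestronglyMeasurable_weightedArea η))
    · filter_upwards [weightedArea_ae η] with ζ hζ
      rw [norm_mul, RCLike.norm_conj, mul_comm]
      exact mul_le_mul_of_nonneg_right (hM _ (hdil (hsm k) hζ)) (norm_nonneg _)
    · filter_upwards [weightedArea_ae η] with ζ hζ
      have h1 : ContinuousAt G ζ := hGd.continuousOn.continuousAt (isOpen_ball.mem_nhds hζ)
      have h2 : Filter.Tendsto (fun k => (s k : ℂ) * ζ) Filter.atTop (nhds ζ) := by
        have := ((Complex.continuous_ofReal.tendsto 1).comp hst).mul_const ζ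
        simpa using this
      exact ((Complex.continuous_conj.tendsto _).comp (h1.tendsto.comp h2)).const_mul _
  refine tendsto_nhds_unique (hlim f ω hfi) ?_
  simp only [fun k => hkey (s k) (hsm k)]
  exact hlim _ _ hD

end IsRadialWeight

/-! ### The growth condition on the symbol. -/

/-- The majorant of the `n`-th derivative in the condition on the symbol. -/
def growthFactor (p : ℝ) (ω ν : ℂ → ℝ) (n : ℕ) (r : ℝ) : ℝ :=
  (tailIntegral ω r * (1 - r)) ^ (1 / p) / (tailIntegral ν r * (1 - r) ^ (n + 1))

section growthFactor

variable {p : ℝ} {ω ν : ℂ → ℝ}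

theorem growthFactor_pos (hω : IsRadialWeight ω) (hν : IsRadialWeight ν) (n : ℕ) {r : ℝ}
    (hr : r ∈ Ico (0 : ℝ) 1) : 0 < growthFactor p ω ν n r := by
  have h1 := hω.tail_pos r hr
  have h2 := hν.tail_pos r hr
  have h3 : 0 < 1 - r := by linarith [hr.2]
  unfold growthFactor
  positivity

/-- The numerator decays at most like `(1 - r)^{(s+1)/p}`, and `hn` makes `(1 - r)^{n+1}` decay at
least as fast; `ν̂` only helps, being decreasing. Hence the factor is almost increasing, which is
what a large `n` buys. -/
theorem growthFactor_le (hp : 0 < p) (hω : IsRadialWeight ω) (hν : IsRadialWeight ν) {s : ℕ}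
    {C : ℝ} (hC : 1 ≤ C) (hs : ∀ x a, 0 ≤ x → x ≤ a → a < 1 →
      tailIntegral ω x ≤ C * ((1 - x) / (1 - a)) ^ s * tailIntegral ω a) {n : ℕ}
    (hn : (s : ℝ) + 1 ≤ p * (n + 1)) {x y : ℝ} (hx : 0 ≤ x) (hxy : x ≤ y) (hy : y < 1) :
    growthFactor p ω ν n x ≤ C ^ (1 / p) * growthFactor p ω ν n y := by
  have hx1 : 0 < 1 - x := by linarith
  have hy1 : 0 < 1 - y := by linarith
  have h1 := hω.tail_pos x ⟨hx, by linarith⟩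
  have h2 := hω.tail_pos y ⟨hx.trans hxy, hy⟩
  have h3 := hν.tail_pos x ⟨hx, by linarith⟩
  have h4 := hν.tail_pos y ⟨hx.trans hxy, hy⟩
  have h5 := hν.tailIntegral_anti hx hxy hy.le
  set R := (1 - x) / (1 - y) with hR
  have hR1 : 1 ≤ R := by rw [hR, one_le_div hy1]; linarith
  have h6 : tailIntegral ω x * (1 - x) ≤ C * R ^ ((s : ℝ) + 1) * (tailIntegral ω y * (1 - y)) := by
    calc tailIntegral ω x * (1 - x) ≤ (C * R ^ s * tailIntegral ω y) * (1 - x) := by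
          gcongr; exact hs x y hx hxy hy
      _ = C * R ^ ((s : ℝ) + 1) * (tailIntegral ω y * (1 - y)) := by
          rw [Real.rpow_add_one (by positivity), Real.rpow_natCast, hR]
          field_simp
  have h7 : R ^ ((s : ℝ) + 1) ≤ R ^ (p * (n + 1)) := Real.rpow_le_rpow_of_exponent_le hR1 hn
  have h8 : (tailIntegral ω x * (1 - x)) ^ (1 / p)
      ≤ C ^ (1 / p) * R ^ (n + 1) * (tailIntegral ω y * (1 - y)) ^ (1 / p) := by
    calc (tailIntegral ω x * (1 - x)) ^ (1 / p)
        ≤ (C * R ^ (p * (n + 1)) * (tailIntegral ω y * (1 - y))) ^ (1 / p) := by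
          refine Real.rpow_le_rpow (by positivity) (h6.trans ?_) (by positivity)
          gcongr
      _ = _ := by
          rw [Real.mul_rpow (by positivity) (by positivity),
            Real.mul_rpow (by positivity) (by positivity), ← Real.rpow_mul (by positivity)]
          congr 2
          rw [show p * ((n : ℝ) + 1) * (1 / p) = ((n + 1 : ℕ) : ℝ) by push_cast; field_simp,
            Real.rpow_natCast]
  unfold growthFactor
  rw [div_le_iff₀ (by positivity)]
  calc (tailIntegral ω x * (1 - x)) ^ (1 / p)
      ≤ C ^ (1 / p) * R ^ (n + 1) * (tailIntegral ω y * (1 - y)) ^ (1 / p) := h8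
    _ = C ^ (1 / p) * ((tailIntegral ω y * (1 - y)) ^ (1 / p) /
          (tailIntegral ν y * (1 - y) ^ (n + 1))) * (tailIntegral ν y * (1 - x) ^ (n + 1)) := by
        rw [hR, div_pow]; field_simp
    _ ≤ _ := by gcongr

/-- Bounds on the `n`-th derivative are inherited by the lower order derivatives. -/
theorem norm_iteratedDeriv_le_growthFactor (hp : 0 < p) (hω : IsRadialWeight ω)
    (hν : IsRadialWeight ν) {s : ℕ} {C : ℝ} (hC : 1 ≤ C) (hs : ∀ x a, 0 ≤ x → x ≤ a → a < 1 →
      tailIntegral ω x ≤ C * ((1 - x) / (1 - a)) ^ s * tailIntegral ω a) {n : ℕ}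
    (hn : (s : ℝ) + 1 ≤ p * (n + 1)) (k : ℕ) (hk : k ≤ n) :
    ∃ B : ℝ, 0 < B ∧ ∀ f : ℂ → ℂ, DifferentiableOn ℂ f unitDisc → ∀ A : ℝ, 0 ≤ A →
      (∀ z ∈ unitDisc, ‖iteratedDeriv n f z‖ ≤ A * growthFactor p ω ν n ‖z‖) →
      (∀ j < n, ‖iteratedDeriv j f 0‖ ≤ A) →
      ∀ z ∈ unitDisc, ‖iteratedDeriv (n - k) f z‖ ≤ B * A * growthFactor p ω ν n ‖z‖ := by
  induction k with
  | zero =>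
    refine ⟨1, one_pos, fun f _ A _ h _ z hz => ?_⟩
    simpa using h z hz
  | succ k ih =>
    obtain ⟨B, hB, h⟩ := ih (by omega)
    have h0 := growthFactor_pos (p := p) hω hν n (r := 0) (by simp)
    refine ⟨C ^ (1 / p) / growthFactor p ω ν n 0 + B * C ^ (1 / p), by positivity,
      fun f hf A hA h1 h2 z hz => ?_⟩
    set j := n - (k + 1) with hj
    have hj1 : n - k = j + 1 := by omega
    have hz1 : ‖z‖ < 1 := by simpa using hz
    have hmono : ∀ x, 0 ≤ x → x ≤ ‖z‖ →
        growthFactor p ω ν n x ≤ C ^ (1 / p) * growthFactor p ω ν n ‖z‖ := fun x hx hxz =>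
      growthFactor_le hp hω hν hC hs hn hx hxz hz1
    have hmem : ∀ w ∈ closedBall (0 : ℂ) ‖z‖, w ∈ unitDisc := fun w hw => by
      rw [mem_closedBall_zero_iff] at hw
      rw [mem_ball_zero_iff]; linarith
    -- Mean value inequality on `|w| ≤ |z|`, where almost monotonicity bounds the derivative by its
    -- majorant at `|z|`. The gain of a power of `1 - |z|` is not exploited, so the majorant of
    -- order `n` serves all lower derivatives.
    have hmv := (convex_closedBall (0 : ℂ) ‖z‖).norm_image_sub_le_of_norm_deriv_le
      (f := iteratedDeriv j f) (C := B * A * (C ^ (1 / p) * growthFactor p ω ν n ‖z‖))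
      (x := 0) (y := z) (fun w hw => (hf.iteratedDeriv_unitDisc j).differentiableAt
        (isOpen_ball.mem_nhds (hmem w hw))) (fun w hw => by
          rw [← iteratedDeriv_succ, ← hj1]
          refine (h f hf A hA h1 h2 w (hmem w hw)).trans ?_
          rw [mem_closedBall_zero_iff] at hw
          gcongr
          exact hmono _ (norm_nonneg w) hw) (by simp) (by simp)
    rw [sub_zero] at hmv
    have h3 := h2 j (by omega)
    have h4 : 1 ≤ C ^ (1 / p) / growthFactor p ω ν n 0 * growthFactor p ω ν n ‖z‖ := by
      rw [div_mul_eq_mul_div, one_le_div h0]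
      exact hmono 0 le_rfl (norm_nonneg z)
    have h5 := growthFactor_pos (p := p) hω hν n (r := ‖z‖) ⟨norm_nonneg z, hz1⟩
    have h6 : ‖iteratedDeriv j f z‖
        ≤ ‖iteratedDeriv j f 0‖ + ‖iteratedDeriv j f z - iteratedDeriv j f 0‖ := by
      have := norm_add_le (iteratedDeriv j f 0) (iteratedDeriv j f z - iteratedDeriv j f 0)
      rwa [add_sub_cancel] at this
    have h7 : B * A * (C ^ (1 / p) * growthFactor p ω ν n ‖z‖) * ‖z‖
        ≤ B * A * (C ^ (1 / p) * growthFactor p ω ν n ‖z‖) :=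
      mul_le_of_le_one_right (by positivity) hz1.le
    have h8 : A ≤ A * (C ^ (1 / p) / growthFactor p ω ν n 0 * growthFactor p ω ν n ‖z‖) :=
      le_mul_of_one_le_right hA h4
    calc _ ≤ A * (C ^ (1 / p) / growthFactor p ω ν n 0 * growthFactor p ω ν n ‖z‖)
          + B * A * (C ^ (1 / p) * growthFactor p ω ν n ‖z‖) := by linarith
      _ = _ := by ring

theorem norm_eulerDeriv_le_growthFactor (hp : 0 < p) (hω : IsRadialWeight ω)
    (hν : IsRadialWeight ν) {s : ℕ} {C : ℝ} (hC : 1 ≤ C) (hs : ∀ x a, 0 ≤ x → x ≤ a → a < 1 →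
      tailIntegral ω x ≤ C * ((1 - x) / (1 - a)) ^ s * tailIntegral ω a) {n : ℕ}
    (hn : (s : ℝ) + 1 ≤ p * (n + 1)) :
    ∃ B : ℝ, 0 < B ∧ ∀ f : ℂ → ℂ, DifferentiableOn ℂ f unitDisc → ∀ A : ℝ, 0 ≤ A →
      (∀ z ∈ unitDisc, ‖iteratedDeriv n f z‖ ≤ A * growthFactor p ω ν n ‖z‖) →
      (∀ j < n, ‖iteratedDeriv j f 0‖ ≤ A) →
      ∀ z ∈ unitDisc, ‖eulerDeriv n f z‖ ≤ B * A * growthFactor p ω ν n ‖z‖ := by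
  choose! B hB h using norm_iteratedDeriv_le_growthFactor hp hω hν hC hs hn
  refine ⟨∑ j ∈ Finset.range (n + 1), (Nat.stirlingSecond (n + 1) (j + 1) : ℝ) * B (n - j) + 1,
    add_pos_of_nonneg_of_pos (Finset.sum_nonneg fun j _ => mul_nonneg (Nat.cast_nonneg _)
      (hB _ (by omega)).le) one_pos, fun f hf A hA h1 h2 z hz => ?_⟩
  have hz1 : ‖z‖ < 1 := by simpa using hz
  have h5 := growthFactor_pos (p := p) hω hν n (r := ‖z‖) ⟨norm_nonneg z, hz1⟩
  calc ‖eulerDeriv n f z‖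
      ≤ ∑ j ∈ Finset.range (n + 1), (Nat.stirlingSecond (n + 1) (j + 1) : ℝ) *
          (B (n - j) * A * growthFactor p ω ν n ‖z‖) := by
        refine (norm_sum_le _ _).trans (Finset.sum_le_sum fun j hj => ?_)
        rw [norm_mul, Complex.norm_natCast, norm_mul, norm_pow]
        refine mul_le_mul_of_nonneg_left ?_ (Nat.cast_nonneg _)
        have hj' : j ≤ n := by have := Finset.mem_range.1 hj; omega
        have h3 := h (n - j) (by omega) f hf A hA h1 h2 z hz
        rw [Nat.sub_sub_self hj'] at h3
        exact (mul_le_of_le_one_left (norm_nonneg _) (pow_le_one₀ (norm_nonneg _) hz1.le)).trans h3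
    _ = (∑ j ∈ Finset.range (n + 1), (Nat.stirlingSecond (n + 1) (j + 1) : ℝ) * B (n - j)) *
          (A * growthFactor p ω ν n ‖z‖) := by
        rw [Finset.sum_mul]
        exact Finset.sum_congr rfl fun j _ => by ring
    _ ≤ _ := by
        rw [add_mul, add_mul, mul_assoc, one_mul]
        have : 0 ≤ A * growthFactor p ω ν n ‖z‖ := by positivity
        linarith

/-- Functions of growth `growthFactor` pair with `A^p_ω`. -/
theorem IsDoublingWeight.lintegral_mul_le_bergmanNorm (hω : IsDoublingWeight ω)
    (hν : IsRadialWeight ν) (hp : 0 < p) (hp1 : p ≤ 1) (n : ℕ) :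
    ∃ C : ℝ, 0 < C ∧ ∀ F : ℂ → ℂ, ContinuousOn F unitDisc → ∀ B : ℝ, 0 ≤ B →
      (∀ z ∈ unitDisc, ‖F z‖ ≤ B * growthFactor p ω ν (n + 1) ‖z‖) →
      ∀ g : ℂ → ℂ, DifferentiableOn ℂ g unitDisc →
      ∫⁻ z, ‖F z * g z‖ₑ ∂weightedArea (averageWeight^[n + 1] ν)
        ≤ ENNReal.ofReal (C * B) * bergmanNorm p ω g := by
  obtain ⟨C, hC, h⟩ := hω.lintegral_circleMean_one_le hp hp1
  refine ⟨C * (4 * 2 ^ n), by positivity, fun F hF B hB hFB g hg => ?_⟩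
  have hFg : ContinuousOn (fun z => F z * g z) unitDisc := hF.mul hg.continuousOn
  have h1 := (hν.iterate_averageWeight (n + 1)).lintegral_enorm_rpow hFg 1
  simp only [ENNReal.rpow_one] at h1
  rw [h1]
  refine (hν.lintegral_radialMeasure_iterate_le n (aemeasurable_circleMean hFg one_pos)).trans ?_
  -- The tail of `ν` cancels: `(1-ρ)^n ν̂(ρ)` times the growth factor of order `n + 1` is
  -- `(ω̂(ρ)(1-ρ))^{1/p} (1-ρ)^{-2}`, the weight of the embedding.
  calc ∫⁻ ρ in Ioo (0 : ℝ) 1, ENNReal.ofReal (4 * 2 ^ n * ((1 - ρ) ^ n * tailIntegral ν ρ)) *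
        circleMean 1 (fun z => F z * g z) ρ
      ≤ ∫⁻ ρ in Ioo (0 : ℝ) 1, ENNReal.ofReal (4 * 2 ^ n * B) *
        (ENNReal.ofReal ((tailIntegral ω ρ * (1 - ρ)) ^ (1 / p) * ((1 - ρ) ^ 2)⁻¹) *
          circleMean 1 g ρ) := by
        refine setLIntegral_mono' measurableSet_Ioo fun ρ hρ => ?_
        have h1ρ : 0 < 1 - ρ := by linarith [hρ.2]
        have hn : ∀ θ, ‖circleMap 0 ρ θ‖ = ρ := fun θ => by simp [abs_of_pos hρ.1]
        have hτ := hν.tail_pos ρ ⟨hρ.1.le, hρ.2⟩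
        have hτ' := hω.tail_pos ρ ⟨hρ.1.le, hρ.2⟩
        have h2 : circleMean 1 (fun z => F z * g z) ρ
            ≤ ENNReal.ofReal (B * growthFactor p ω ν (n + 1) ρ) * circleMean 1 g ρ := by
          rw [circleMean, circleMean, ← lintegral_const_mul' _ _ ENNReal.ofReal_ne_top]
          refine lintegral_mono fun θ => ?_
          simp only [ENNReal.rpow_one]
          rw [enorm_mul]
          refine mul_le_mul_left ?_ _
          rw [← ofReal_norm]
          have := hFB _ (circleMap_zero_mem_unitDisc hρ θ)
          rw [hn] at this
          exact ENNReal.ofReal_le_ofReal this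
        refine (mul_le_mul_right h2 _).trans_eq ?_
        rw [← mul_assoc (ENNReal.ofReal _) (ENNReal.ofReal _),
          ← ENNReal.ofReal_mul (by positivity), ← mul_assoc (ENNReal.ofReal _) (ENNReal.ofReal _),
          ← ENNReal.ofReal_mul (by positivity)]
        congr 2
        unfold growthFactor
        field_simp
        ring
    _ ≤ ENNReal.ofReal (4 * 2 ^ n * B) * (ENNReal.ofReal C * bergmanNorm p ω g) := by
        rw [lintegral_const_mul' _ _ ENNReal.ofReal_ne_top]
        exact mul_le_mul_right (h g hg) _
    _ = _ := by
        rw [← mul_assoc, ← ENNReal.ofReal_mul (by positivity)]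
        congr 2; ring

end growthFactor

/-! ### The kernel transform from `L¹` to `A^q_ν`. -/

/-- Integration of `H` against the kernel `B^ν_z` with respect to another measure. -/
def kernelTransform (ν : ℂ → ℝ) (κ : Measure ℂ) (H : ℂ → ℂ) (z : ℂ) : ℂ :=
  ∫ ζ, H ζ * kernelSeries ν 0 (z * conj ζ) ∂κ

namespace IsDoublingWeight

variable {ν η : ℂ → ℝ} {H : ℂ → ℂ}

theorem integrable_mul_kernelSeries (hν : IsDoublingWeight ν)
    (hH : Integrable H (weightedArea η)) {z : ℂ} (hz : z ∈ unitDisc) :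
    Integrable (fun ζ => H ζ * kernelSeries ν 0 (z * conj ζ)) (weightedArea η) := by
  refine hH.mul_bdd (c := ∑' m, ‖(kernelCoeff ν 0 m : ℂ)‖ * ‖z‖ ^ m) ?_ ?_
  · have hc : ContinuousOn (fun ζ => kernelSeries ν 0 (z * conj ζ)) unitDisc :=
      (hν.differentiableOn_kernelSeries 0).continuousOn.comp
        (continuous_const.mul Complex.continuous_conj).continuousOn
        fun ζ hζ => mul_mem_unitDisc hz (conj_mem_unitDisc hζ)
    exact hc.aestronglyMeasurable_weightedArea η
  · filter_upwards [weightedArea_ae η] with ζ hζ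
    rw [mem_ball_zero_iff] at hz hζ
    refine hν.norm_kernelSeries_le_tsum 0 ?_ hz
    rw [norm_mul, RCLike.norm_conj]
    exact mul_le_of_le_one_right (norm_nonneg _) hζ.le

/-- Expanding the kernel gives a power series in `z` with coefficients at most `|kernelCoeff ν 0 m|`
times the `L¹` norm of `H`. -/
theorem differentiableOn_kernelTransform (hν : IsDoublingWeight ν)
    (hH : Integrable H (weightedArea η)) :
    DifferentiableOn ℂ (kernelTransform ν (weightedArea η) H) unitDisc := by
  have hbd : ∀ᵐ ζ ∂weightedArea η, ∀ m : ℕ, ‖conj ζ ^ m‖ ≤ 1 := by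
    filter_upwards [weightedArea_ae η] with ζ hζ m
    rw [mem_ball_zero_iff] at hζ
    simpa using pow_le_one₀ (norm_nonneg ζ) hζ.le
  have hcm : Continuous fun ζ : ℂ => conj ζ := Complex.continuous_conj
  have hint : ∀ m : ℕ, Integrable (fun ζ => H ζ * conj ζ ^ m) (weightedArea η) := fun m =>
    hH.mul_bdd (hcm.pow m).aestronglyMeasurable (hbd.mono fun ζ h => h m)
  have hle : ∀ m : ℕ, ∫ ζ, ‖H ζ * conj ζ ^ m‖ ∂weightedArea η ≤ ∫ ζ, ‖H ζ‖ ∂weightedArea η := by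
    intro m
    refine integral_mono_ae (hint m).norm hH.norm ?_
    filter_upwards [hbd] with ζ hζ
    rw [norm_mul]
    exact mul_le_of_le_one_right (norm_nonneg _) (hζ m)
  set c : ℕ → ℂ := fun m => (kernelCoeff ν 0 m : ℂ) * ∫ ζ, H ζ * conj ζ ^ m ∂weightedArea η with hc
  have hcs : ∀ ρ : ℝ, 0 ≤ ρ → ρ < 1 → Summable fun m => ‖c m‖ * ρ ^ m := by
    intro ρ h0 h1
    refine Summable.of_nonneg_of_le (fun m => by positivity) (fun m => ?_)
      ((hν.summable_norm_kernelCoeff 0 h0 h1).mul_left (∫ ζ, ‖H ζ‖ ∂weightedArea η))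
    rw [hc, norm_mul, mul_comm ‖(kernelCoeff ν 0 m : ℂ)‖, mul_assoc]
    gcongr
    exact (norm_integral_le_integral_norm _).trans (hle m)
  refine (differentiableOn_tsum_mul_pow hcs).congr fun z hz => ?_
  have hz1 : ‖z‖ < 1 := by simpa using hz
  have h1 := hasSum_integral_of_summable_integral_norm
    (F := fun (m : ℕ) ζ => (kernelCoeff ν 0 m : ℂ) * z ^ m * (H ζ * conj ζ ^ m))
    (μ := weightedArea η) (fun m => (hint m).const_mul _) (by
      refine Summable.of_nonneg_of_le (fun m => integral_nonneg fun _ => norm_nonneg _)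
        (fun m => ?_) ((hν.summable_norm_kernelCoeff 0 (norm_nonneg z) hz1).mul_right
          (∫ ζ, ‖H ζ‖ ∂weightedArea η))
      simp only [norm_mul (_ * z ^ m)]
      rw [integral_const_mul, norm_mul, norm_pow]
      exact mul_le_mul_of_nonneg_left (hle m) (by positivity))
  have h2 : ∀ ζ, ∑' m : ℕ, (kernelCoeff ν 0 m : ℂ) * z ^ m * (H ζ * conj ζ ^ m)
      = H ζ * kernelSeries ν 0 (z * conj ζ) := by
    intro ζ
    rw [kernelSeries, ← tsum_mul_left]
    congr 1 with m
    rw [mul_pow]; ring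
  simp only [h2, integral_const_mul] at h1
  rw [kernelTransform, ← h1.tsum_eq]
  congr 1 with m
  rw [hc]; ring

/-- By Tonelli it suffices to bound the mean of the kernel over `|z| = r` uniformly in `ζ`. The
exponent `1 + β > 1` in the pointwise estimate avoids a logarithm: the mean of `|1 - ζ̄ z|^{-(1+β)}`
is at most a multiple of `(1 - r)^{-β}`, which cancels `(1 - r)^β`. -/
theorem circleMean_kernelTransform_le (hν : IsDoublingWeight ν) :
    ∃ C : ℝ, 0 < C ∧ ∀ (η : ℂ → ℝ) (H : ℂ → ℂ), IsRadialWeight η → Integrable H (weightedArea η) →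
      ∀ r ∈ Ioo (0 : ℝ) 1, circleMean 1 (kernelTransform ν (weightedArea η) H) r
        ≤ ENNReal.ofReal (C * (tailIntegral ν r)⁻¹) * ∫⁻ ζ, ‖H ζ‖ₑ ∂weightedArea η := by
  obtain ⟨β, hβ, hker⟩ := hν.norm_kernelSeries_le
  obtain ⟨C, hC, hk⟩ := hker 0
  obtain ⟨C', hC', hint⟩ := lintegral_norm_one_sub_rpow_le (P := 1 + β) (by linarith)
  refine ⟨C * C', by positivity, fun η H hη hH r hr => ?_⟩
  have := hη.isFiniteMeasure_weightedArea
  have hτ := hν.tail_pos r ⟨hr.1.le, hr.2⟩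
  have h1r : 0 < 1 - r := by linarith [hr.2]
  set D := C * (tailIntegral ν r)⁻¹ * (1 - r) ^ β with hD
  have hD0 : 0 < D := by positivity
  have hpt : ∀ θ, ∀ ζ ∈ unitDisc, ‖kernelSeries ν 0 (circleMap 0 r θ * conj ζ)‖ₑ
      ≤ ENNReal.ofReal D * ENNReal.ofReal (‖1 - conj ζ * circleMap 0 r θ‖ ^ (-(1 + β))) := by
    intro θ ζ hζ
    have hζ1 : ‖ζ‖ < 1 := by simpa using hζ
    have hw : ‖circleMap 0 r θ * conj ζ‖ ≤ r := by
      rw [norm_mul, RCLike.norm_conj, norm_circleMap_zero, abs_of_pos hr.1]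
      exact mul_le_of_le_one_right hr.1.le hζ1.le
    have h1 := norm_sub_norm_le (1 : ℂ) (circleMap 0 r θ * conj ζ)
    rw [norm_one] at h1
    have h2 := hk _ r (hw.trans_lt hr.2) ⟨hr.1.le, hr.2⟩ (by linarith)
    rw [← ofReal_norm, ← ENNReal.ofReal_mul hD0.le]
    refine ENNReal.ofReal_le_ofReal ?_
    rw [mul_comm (conj ζ)]
    simpa using h2
  have hmean : ∀ ζ ∈ unitDisc, ∫⁻ θ, ENNReal.ofReal D *
      ENNReal.ofReal (‖1 - conj ζ * circleMap 0 r θ‖ ^ (-(1 + β))) ∂angularMeasure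
      ≤ ENNReal.ofReal (C * C' * (tailIntegral ν r)⁻¹) := by
    intro ζ hζ
    have hζ1 : ‖ζ‖ < 1 := by simpa using hζ
    have hζr : ‖ζ‖ * r ≤ r := mul_le_of_le_one_left hr.1.le hζ1.le
    rw [lintegral_const_mul' _ _ ENNReal.ofReal_ne_top]
    have h1 := hint (conj ζ) r hr.1.le (by rw [RCLike.norm_conj]; linarith [hr.2])
    rw [RCLike.norm_conj] at h1
    refine (mul_le_mul_right h1 _).trans ?_
    rw [← ENNReal.ofReal_mul hD0.le]
    refine ENNReal.ofReal_le_ofReal ?_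
    have h2 : (1 - ‖ζ‖ * r) ^ (1 - (1 + β)) ≤ (1 - r) ^ (-β) := by
      rw [show 1 - (1 + β) = -β by ring]
      exact Real.rpow_le_rpow_of_nonpos h1r (by linarith) (by linarith)
    calc D * (C' * (1 - ‖ζ‖ * r) ^ (1 - (1 + β))) ≤ D * (C' * (1 - r) ^ (-β)) := by gcongr
      _ = C * C' * (tailIntegral ν r)⁻¹ * ((1 - r) ^ β * (1 - r) ^ (-β)) := by rw [hD]; ring
      _ = _ := by rw [← Real.rpow_add h1r]; simp
  calc circleMean 1 (kernelTransform ν (weightedArea η) H) r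
      ≤ ∫⁻ θ, ∫⁻ ζ, ‖H ζ‖ₑ * (ENNReal.ofReal D *
          ENNReal.ofReal (‖1 - conj ζ * circleMap 0 r θ‖ ^ (-(1 + β)))) ∂weightedArea η
          ∂angularMeasure := by
        refine lintegral_mono fun θ => ?_
        rw [ENNReal.rpow_one]
        refine (enorm_integral_le_lintegral_enorm _).trans (lintegral_mono_ae ?_)
        filter_upwards [weightedArea_ae η] with ζ hζ
        rw [enorm_mul]
        exact mul_le_mul_right (hpt θ ζ hζ) _
    _ = ∫⁻ ζ, ‖H ζ‖ₑ * ∫⁻ θ, ENNReal.ofReal D *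
          ENNReal.ofReal (‖1 - conj ζ * circleMap 0 r θ‖ ^ (-(1 + β))) ∂angularMeasure
          ∂weightedArea η := by
        rw [lintegral_lintegral_swap]
        · refine lintegral_congr fun ζ => ?_
          rw [lintegral_const_mul]
          have := (continuous_circleMap 0 r).measurable
          fun_prop
        · refine hH.1.enorm.comp_snd.mul (Measurable.aemeasurable ?_)
          have h1 : Measurable fun x : ℝ × ℂ => 1 - conj x.2 * circleMap 0 r x.1 := by
            have h2 : Measurable fun x : ℝ × ℂ => circleMap 0 r x.1 :=
              (continuous_circleMap 0 r).measurable.comp measurable_fst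
            have h3 : Measurable fun x : ℝ × ℂ => conj x.2 :=
              Complex.continuous_conj.measurable.comp measurable_snd
            exact measurable_const.sub (h3.mul h2)
          exact ((h1.norm.pow_const _).ennreal_ofReal).const_mul _
    _ ≤ ∫⁻ ζ, ‖H ζ‖ₑ * ENNReal.ofReal (C * C' * (tailIntegral ν r)⁻¹) ∂weightedArea η := by
        refine lintegral_mono_ae ?_
        filter_upwards [weightedArea_ae η] with ζ hζ
        exact mul_le_mul_right (hmean ζ hζ) _
    _ = _ := by rw [lintegral_mul_const' _ _ ENNReal.ofReal_ne_top, mul_comm]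

end IsDoublingWeight

theorem circleMean_le_rpow {q : ℝ} (hq0 : 0 < q) (hq1 : q ≤ 1) {g : ℂ → ℂ}
    (hg : ContinuousOn g unitDisc) {r : ℝ} (hr : r ∈ Ioo (0 : ℝ) 1) :
    circleMean q g r ≤ circleMean 1 g r ^ q := by
  have hc := continuous_comp_circleMap hg hr
  have h := eLpNorm_le_eLpNorm_of_exponent_le (μ := angularMeasure)
    (f := fun θ => g (circleMap 0 r θ)) (p := ENNReal.ofReal q) (q := 1)
    (by simpa using hq1) (integrable_angularMeasure hc).1
  rw [eLpNorm_eq_lintegral_rpow_enorm_toReal (by simpa using hq0) ENNReal.ofReal_ne_top,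
    ENNReal.toReal_ofReal hq0.le, eLpNorm_one_eq_lintegral_enorm] at h
  have h2 := ENNReal.rpow_le_rpow h hq0.le
  rw [← ENNReal.rpow_mul, one_div, inv_mul_cancel₀ hq0.ne', ENNReal.rpow_one] at h2
  simpa only [circleMean, ENNReal.rpow_one] using h2

/-- The kernel transform maps `L^1` into `A^q_ν`, `q < 1`. -/
theorem IsDoublingWeight.bergmanNorm_kernelTransform_le {ν : ℂ → ℝ} (hν : IsDoublingWeight ν)
    {q : ℝ} (hq0 : 0 < q) (hq1 : q < 1) :
    ∃ C : ℝ, 0 < C ∧ ∀ (η : ℂ → ℝ) (H : ℂ → ℂ), IsRadialWeight η → Integrable H (weightedArea η) →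
      bergmanNorm q ν (kernelTransform ν (weightedArea η) H)
        ≤ ENNReal.ofReal C * ∫⁻ ζ, ‖H ζ‖ₑ ∂weightedArea η := by
  obtain ⟨C, hC, h⟩ := hν.circleMean_kernelTransform_le
  have hfin := hν.lintegral_tail_rpow_neg_lt_top hq0 hq1
  set I := ∫⁻ r, ENNReal.ofReal ((tailIntegral ν r)⁻¹ ^ q) ∂radialMeasure ν with hI
  have hIq : I ^ (1 / q) < ⊤ := ENNReal.rpow_lt_top_of_nonneg (by positivity) hfin.ne
  -- The summand 1 only secures positivity of the constant.
  refine ⟨C * (I ^ (1 / q)).toReal + 1, by positivity, fun η H hη hH => ?_⟩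
  set J := ∫⁻ ζ, ‖H ζ‖ₑ ∂weightedArea η with hJ
  have hd := (hν.differentiableOn_kernelTransform hH).continuousOn
  rw [bergmanNorm_eq hq0, hν.lintegral_enorm_rpow hd]
  have h1 : ∫⁻ r, circleMean q (kernelTransform ν (weightedArea η) H) r ∂radialMeasure ν
      ≤ (ENNReal.ofReal C * J) ^ q * I := by
    rw [hI, ← lintegral_const_mul' _ _ (ENNReal.rpow_ne_top_of_nonneg hq0.le
      (ENNReal.mul_ne_top ENNReal.ofReal_ne_top hH.2.ne))]
    refine lintegral_mono_ae ?_
    filter_upwards [IsRadialWeight.radialMeasure_ae ν] with r hr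
    have hτ := hν.tail_pos r ⟨hr.1.le, hr.2⟩
    refine (circleMean_le_rpow hq0 hq1.le hd hr).trans ?_
    refine (ENNReal.rpow_le_rpow (h η H hη hH r hr) hq0.le).trans_eq ?_
    rw [ENNReal.ofReal_mul hC.le, mul_right_comm, ENNReal.mul_rpow_of_nonneg _ _ hq0.le,
      ENNReal.ofReal_rpow_of_nonneg (by positivity) hq0.le]
  refine (ENNReal.rpow_le_rpow h1 (by positivity)).trans ?_
  rw [ENNReal.mul_rpow_of_nonneg _ _ (by positivity), ← ENNReal.rpow_mul,
    mul_one_div_cancel hq0.ne', ENNReal.rpow_one, mul_right_comm]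
  refine mul_le_mul_left ?_ _
  rw [← ENNReal.ofReal_toReal hIq.ne, ← ENNReal.ofReal_mul hC.le]
  exact ENNReal.ofReal_le_ofReal (by simp)

theorem bergmanNorm_congr {q : ℝ} {ν : ℂ → ℝ} {f g : ℂ → ℂ} (h : EqOn f g unitDisc) :
    bergmanNorm q ν f = bergmanNorm q ν g :=
  eLpNorm_congr_ae ((weightedArea_ae ν).mono fun _ hz => h hz)

/-! ### Sufficiency of the condition. -/

namespace IsDoublingWeight

variable {p q : ℝ} {ω ν : ℂ → ℝ}

theorem mul_kernelSeries_mem_boundedAnalytic (hν : IsDoublingWeight ν) {g : ℂ → ℂ}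
    (hg : g ∈ boundedAnalytic) {z : ℂ} (hz : z ∈ unitDisc) :
    (fun ζ => g ζ * kernelSeries ν 0 (conj z * ζ)) ∈ boundedAnalytic := by
  obtain ⟨hgd, M, hM⟩ := hg
  obtain ⟨hkd, M', hM'⟩ := hν.kernelDeriv_mem_boundedAnalytic 0 hz
  have h : ∀ ζ, kernelDeriv ν 0 z ζ = kernelSeries ν 0 (conj z * ζ) := fun ζ => by
    simp [kernelDeriv]
  refine ⟨(hgd.mul hkd).congr fun ζ _ => by simp [h], M * M', fun ζ hζ => ?_⟩
  rw [norm_mul, ← h]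
  exact mul_le_mul (hM ζ hζ) (hM' ζ hζ) (norm_nonneg _) ((norm_nonneg _).trans (hM ζ hζ))

/-- The sufficiency of the condition on the symbol. -/
theorem exists_hankelBoundedBy (hω : IsDoublingWeight ω) (hν : IsDoublingWeight ν)
    (hp : 0 < p) (hp1 : p ≤ 1) (hq0 : 0 < q) (hq1 : q < 1) {s : ℕ}
    {C : ℝ} (hC : 1 ≤ C) (hs : ∀ x a, 0 ≤ x → x ≤ a → a < 1 →
      tailIntegral ω x ≤ C * ((1 - x) / (1 - a)) ^ s * tailIntegral ω a) {n : ℕ}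
    (hn : (s : ℝ) + 1 ≤ p * (((n + 1 : ℕ) : ℝ) + 1)) :
    ∃ K : ℝ, 0 < K ∧ ∀ f : ℂ → ℂ, DifferentiableOn ℂ f unitDisc → Integrable f (weightedArea ν) →
      ∀ A : ℝ, 0 ≤ A →
      (∀ z ∈ unitDisc, ‖iteratedDeriv (n + 1) f z‖ ≤ A * growthFactor p ω ν (n + 1) ‖z‖) →
      (∀ j < n + 1, ‖iteratedDeriv j f 0‖ ≤ A) →
      HankelBoundedBy p q ω ν f (K * A).toNNReal := by
  obtain ⟨B, hB, hgrowth⟩ :=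
    norm_eulerDeriv_le_growthFactor hp hω.toIsRadialWeight hν.toIsRadialWeight hC hs hn
  obtain ⟨C₁, hC₁, hpair⟩ := hω.lintegral_mul_le_bergmanNorm hν.toIsRadialWeight hp hp1 n
  obtain ⟨C₂, hC₂, htrans⟩ := hν.bergmanNorm_kernelTransform_le hq0 hq1
  refine ⟨C₂ * (C₁ * B), by positivity, fun f hf hfi A hA h1 h2 => ?_⟩
  set η := averageWeight^[n + 1] ν with hη
  have hηR : IsRadialWeight η := hν.iterate_averageWeight (n + 1)
  set F := eulerDeriv (n + 1) f with hF
  have hFd : DifferentiableOn ℂ F unitDisc := differentiableOn_eulerDeriv hf _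
  have hFm := hFd.continuousOn.aestronglyMeasurable_weightedArea η
  have hJ : ∀ g ∈ bergmanSpace p ω, ∫⁻ ζ, ‖F ζ * conj (g ζ)‖ₑ ∂weightedArea η
      ≤ ENNReal.ofReal (C₁ * (B * A)) * bergmanNorm p ω g := by
    intro g hg
    refine le_trans (le_of_eq ?_) (hpair F hFd.continuousOn (B * A) (by positivity)
      (hgrowth f hf A hA h1 h2) g hg.1)
    refine lintegral_congr fun ζ => ?_
    rw [enorm_mul, enorm_mul, RCLike.enorm_conj]
  have hint : ∀ g ∈ bergmanSpace p ω,
      Integrable (fun ζ => F ζ * conj (g ζ)) (weightedArea η) := by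
    intro g hg
    refine ⟨hFm.mul (Complex.continuous_conj.comp_aestronglyMeasurable
      (hg.1.continuousOn.aestronglyMeasurable_weightedArea η)), (hJ g hg).trans_lt ?_⟩
    exact ENNReal.mul_lt_top ENNReal.ofReal_lt_top hg.2.2
  -- The choice `g = 1` gives integrability of `F` itself, required for the integration by parts.
  have hFi : Integrable F (weightedArea η) := by
    have h := hint (fun _ => 1) (hω.mem_bergmanSpace_of_bounded p
      ⟨differentiableOn_const 1, 1, fun _ _ => by simp⟩)
    simpa using h
  -- The extension is explicit: the integral converges for every `g` in `A^p_ω`. Cutting off outside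
  -- the disc makes conjugate-linearity an identity of functions on all of `ℂ`.
  set S : (ℂ → ℂ) → ℂ → ℂ := fun g =>
    unitDisc.indicator (kernelTransform ν (weightedArea η) fun ζ => F ζ * conj (g ζ)) with hS
  have hSeq : ∀ g, EqOn (S g) (kernelTransform ν (weightedArea η) fun ζ => F ζ * conj (g ζ))
      unitDisc := fun g z hz => indicator_of_mem hz _
  have hSnorm : ∀ g ∈ bergmanSpace p ω, bergmanNorm q ν (S g)
      ≤ ENNReal.ofReal (C₂ * (C₁ * B) * A) * bergmanNorm p ω g := by
    intro g hg
    rw [bergmanNorm_congr (hSeq g)]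
    refine (htrans η _ hηR (hint g hg)).trans ((mul_le_mul_right (hJ g hg) _).trans_eq ?_)
    rw [← mul_assoc, ← ENNReal.ofReal_mul hC₂.le]
    congr 2; ring
  have hSmem : ∀ g ∈ bergmanSpace p ω, S g ∈ bergmanSpace q ν := by
    intro g hg
    have hd : DifferentiableOn ℂ (S g) unitDisc :=
      (hν.differentiableOn_kernelTransform (hint g hg)).congr (hSeq g)
    refine ⟨hd, hd.continuousOn.aestronglyMeasurable_weightedArea ν, (hSnorm g hg).trans_lt ?_⟩
    exact ENNReal.mul_lt_top ENNReal.ofReal_lt_top hg.2.2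
  refine ⟨{ toFun := fun g => ⟨S g, hSmem g g.2⟩, map_add' := ?_, map_smul' := ?_ }, ?_, ?_⟩
  · intro g h
    ext z
    by_cases hz : z ∈ unitDisc
    · simp only [Submodule.coe_add, Pi.add_apply]
      rw [hSeq _ hz, hSeq _ hz, hSeq _ hz, kernelTransform, kernelTransform, kernelTransform,
        ← integral_add (hν.integrable_mul_kernelSeries (hint g g.2) hz)
          (hν.integrable_mul_kernelSeries (hint h h.2) hz)]
      congr 1 with ζ
      simp only [Pi.add_apply, map_add]; ring
    · simp [hS, indicator_of_notMem hz]
  · intro c g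
    ext z
    by_cases hz : z ∈ unitDisc
    · simp only [Submodule.coe_smul, Pi.smul_apply, smul_eq_mul]
      rw [hSeq _ hz, hSeq _ hz, kernelTransform, kernelTransform, ← integral_const_mul]
      congr 1 with ζ
      simp only [Pi.smul_apply, smul_eq_mul, map_mul]; ring
    · simp [hS, indicator_of_notMem hz]
  · intro g hg z hz
    change S g z = _
    rw [hSeq _ hz, hν.smallHankel_eq f g hz, kernelTransform,
      hν.integral_mul_conj_eq_eulerDeriv hf hfi (n + 1) hFi
        (hν.mul_kernelSeries_mem_boundedAnalytic hg hz)]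
    congr 1 with ζ
    rw [map_mul, conj_kernelSeries, map_mul, Complex.conj_conj, ← mul_assoc]
  · intro g
    exact hSnorm g g.2

end IsDoublingWeight

/-! ### Necessity of the condition. -/

theorem derivativeSup_eq {p : ℝ} {ω ν : ℂ → ℝ} (n : ℕ) (f : ℂ → ℂ) :
    derivativeSup p ω ν n f
      = ⨆ z ∈ unitDisc, ENNReal.ofReal (‖iteratedDeriv n f z‖ / growthFactor p ω ν n ‖z‖) := by
  unfold derivativeSup growthFactor
  refine iSup_congr fun z => iSup_congr fun _ => ?_
  congr 1
  rw [div_div_eq_mul_div]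
  ring

namespace IsDoublingWeight

variable {p q : ℝ} {ω ν : ℂ → ℝ}

theorem enorm_zero_le_bergmanNorm (hν : IsDoublingWeight ν) (hq : 0 < q) :
    ∃ C : ℝ, 0 < C ∧ ∀ h : ℂ → ℂ, DifferentiableOn ℂ h unitDisc →
      ‖h 0‖ₑ ≤ ENNReal.ofReal C * bergmanNorm q ν h := by
  obtain ⟨C, hC, hle⟩ := hν.enorm_rpow_mul_tail_le hq
  have hτ := hν.tail_pos 0 (by simp)
  refine ⟨((tailIntegral ν 0)⁻¹ * C) ^ (1 / q), by positivity, fun h hh => ?_⟩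
  have h1 := hle h hh 0 (by simp)
  rw [norm_zero, sub_zero, mul_one] at h1
  have h2 : ‖h 0‖ₑ ^ q ≤ ENNReal.ofReal ((tailIntegral ν 0)⁻¹ * C) *
      ∫⁻ z, ‖h z‖ₑ ^ q ∂weightedArea ν := by
    calc ‖h 0‖ₑ ^ q = ENNReal.ofReal (tailIntegral ν 0)⁻¹ *
          (‖h 0‖ₑ ^ q * ENNReal.ofReal (tailIntegral ν 0)) := by
          rw [mul_left_comm, ← ENNReal.ofReal_mul (by positivity), inv_mul_cancel₀ hτ.ne']
          simp
      _ ≤ _ := by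
          rw [ENNReal.ofReal_mul (by positivity), mul_assoc]
          exact mul_le_mul_right h1 _
  have h3 := ENNReal.rpow_le_rpow h2 (z := 1 / q) (by positivity)
  rw [← ENNReal.rpow_mul, mul_one_div_cancel hq.ne', ENNReal.rpow_one,
    ENNReal.mul_rpow_of_nonneg _ _ (by positivity),
    ENNReal.ofReal_rpow_of_nonneg (by positivity) (by positivity)] at h3
  rwa [bergmanNorm_eq hq]

/-- Testing the Hankel operator on bounded functions. -/
theorem enorm_integral_mul_conj_le (hω : IsDoublingWeight ω) (hν : IsDoublingWeight ν)
    (hq : 0 < q) :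
    ∃ K : ℝ, 0 < K ∧ ∀ (f : ℂ → ℂ) (C : ℝ≥0), HankelBoundedBy p q ω ν f C →
      ∀ g ∈ boundedAnalytic, ‖∫ ζ, f ζ * conj (g ζ) ∂weightedArea ν‖ₑ
        ≤ ENNReal.ofReal K * C * bergmanNorm p ω g := by
  obtain ⟨K, hK, h⟩ := hν.enorm_zero_le_bergmanNorm hq
  have hm := hν.radialMoment_pos 0
  refine ⟨radialMoment ν 0 * K, by positivity, fun f C ⟨T, hT, hTC⟩ g hg => ?_⟩
  set g' : bergmanSpace p ω := ⟨g, hω.mem_bergmanSpace_of_bounded p hg⟩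
  have h0 : (T g' : ℂ → ℂ) 0 = smallHankel ν f g 0 := hT g' hg 0 (by simp)
  have h1 : ∫ ζ, f ζ * conj (g ζ) ∂weightedArea ν
      = (radialMoment ν 0 : ℂ) * (T g' : ℂ → ℂ) 0 := by
    have : (radialMoment ν 0 : ℂ) ≠ 0 := by exact_mod_cast hm.ne'
    rw [h0, hν.smallHankel_zero, mul_inv_cancel_left₀ this]
  rw [h1, enorm_mul, ENNReal.ofReal_mul hm.le, mul_assoc, mul_assoc]
  have h2 : ‖(radialMoment ν 0 : ℂ)‖ₑ = ENNReal.ofReal (radialMoment ν 0) := by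
    rw [← ofReal_norm, Complex.norm_real, Real.norm_of_nonneg hm.le]
  rw [h2]
  refine mul_le_mul_right ((h _ (T g').2.1).trans (mul_le_mul_right (hTC g') _)) _

/-- The norms of the derivatives of the Bergman kernel. -/
theorem bergmanNorm_kernelDeriv_le (hω : IsDoublingWeight ω) (hν : IsDoublingWeight ν)
    (hp : 0 < p) {s : ℕ} {C : ℝ} (hC : 1 ≤ C)
    (hs : ∀ a ∈ Ico (0 : ℝ) 1, ∫⁻ r, ENNReal.ofReal (((1 - a * r) ^ s)⁻¹) ∂radialMeasure ω
      ≤ ENNReal.ofReal (C * tailIntegral ω a * ((1 - a) ^ s)⁻¹)) {n : ℕ}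
    (hn : (s : ℝ) + 1 ≤ p * (n + 1)) :
    ∃ K : ℝ, 0 < K ∧ ∀ a ∈ unitDisc,
      bergmanNorm p ω (kernelDeriv ν n a) ≤ ENNReal.ofReal (K * growthFactor p ω ν n ‖a‖) := by
  obtain ⟨β, hβ, hker⟩ := hν.norm_kernelSeries_le
  obtain ⟨C₁, hC₁, hk⟩ := hker n
  set P := p * ((n : ℝ) + 1 + β) with hP
  -- This makes `P > 1` for the angular integral, and lets `(1 - t r)^{1-P}` be split into `(1 -
  -- t)^{s+1-P}` and the factor `(1 - t r)^{-s}`, whose radial integral is `hs`.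
  have hPs : (s : ℝ) + 1 < P := by
    have : 0 < p * β := by positivity
    rw [hP, mul_add]; linarith
  obtain ⟨C₂, hC₂, hint⟩ := lintegral_norm_one_sub_rpow_le (P := P) (by linarith)
  refine ⟨C₁ * (C₂ * C) ^ (1 / p), by positivity, fun a ha => ?_⟩
  have ha1 : ‖a‖ < 1 := by simpa using ha
  set t := ‖a‖ with ht
  have ht0 : 0 ≤ t := norm_nonneg a
  have h1t : 0 < 1 - t := by linarith
  have hτν := hν.tail_pos t ⟨ht0, ha1⟩
  have hτω := hω.tail_pos t ⟨ht0, ha1⟩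
  set D := C₁ * (tailIntegral ν t)⁻¹ * (1 - t) ^ β with hD
  have hD0 : 0 < D := by positivity
  have hpt : ∀ ζ ∈ unitDisc, ‖kernelDeriv ν n a ζ‖ₑ ^ p
      ≤ ENNReal.ofReal (D ^ p) * ENNReal.ofReal (‖1 - conj a * ζ‖ ^ (-P)) := by
    intro ζ hζ
    have hζ1 : ‖ζ‖ < 1 := by simpa using hζ
    have hw : ‖conj a * ζ‖ ≤ t := by
      rw [norm_mul, RCLike.norm_conj]
      exact mul_le_of_le_one_right ht0 hζ1.le
    have h1 := norm_sub_norm_le (1 : ℂ) (conj a * ζ)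
    rw [norm_one] at h1
    have h2 := hk _ t (hw.trans_lt ha1) ⟨ht0, ha1⟩ (by linarith)
    rw [enorm_rpow_eq_ofReal hp.le, ← ENNReal.ofReal_mul (by positivity)]
    refine ENNReal.ofReal_le_ofReal ?_
    have h3 : ‖kernelDeriv ν n a ζ‖ ≤ D * ‖1 - conj a * ζ‖ ^ (-((n : ℝ) + 1 + β)) := by
      rw [kernelDeriv, norm_mul, norm_pow]
      exact (mul_le_of_le_one_left (norm_nonneg _) (pow_le_one₀ (norm_nonneg _) hζ1.le)).trans h2
    calc ‖kernelDeriv ν n a ζ‖ ^ p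
        ≤ (D * ‖1 - conj a * ζ‖ ^ (-((n : ℝ) + 1 + β))) ^ p := by gcongr
      _ = _ := by
          rw [Real.mul_rpow hD0.le (by positivity), ← Real.rpow_mul (norm_nonneg _)]
          congr 2
          rw [hP]; ring
  have hmeas : Measurable fun ζ : ℂ => ENNReal.ofReal (‖1 - conj a * ζ‖ ^ (-P)) :=
    ((by fun_prop : Continuous fun ζ : ℂ => ‖1 - conj a * ζ‖).measurable.pow_const _).ennreal_ofReal
  have hI : ∫⁻ ζ, ‖kernelDeriv ν n a ζ‖ₑ ^ p ∂weightedArea ω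
      ≤ ENNReal.ofReal (D ^ p * (C₂ * ((1 - t) ^ ((s : ℝ) + 1 - P) *
        (C * tailIntegral ω t * ((1 - t) ^ s)⁻¹)))) := by
    calc ∫⁻ ζ, ‖kernelDeriv ν n a ζ‖ₑ ^ p ∂weightedArea ω
        ≤ ∫⁻ ζ, ENNReal.ofReal (D ^ p) * ENNReal.ofReal (‖1 - conj a * ζ‖ ^ (-P))
            ∂weightedArea ω :=
          lintegral_mono_ae ((weightedArea_ae ω).mono fun ζ hζ => hpt ζ hζ)
      _ = ENNReal.ofReal (D ^ p) * ∫⁻ r, ∫⁻ θ,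
            ENNReal.ofReal (‖1 - conj a * circleMap 0 r θ‖ ^ (-P)) ∂angularMeasure
            ∂radialMeasure ω := by
          rw [lintegral_const_mul' _ _ ENNReal.ofReal_ne_top,
            hω.lintegral_weightedArea hmeas.aemeasurable]
      _ ≤ ENNReal.ofReal (D ^ p) * ∫⁻ r, ENNReal.ofReal (C₂ * (1 - t) ^ ((s : ℝ) + 1 - P)) *
            ENNReal.ofReal (((1 - t * r) ^ s)⁻¹) ∂radialMeasure ω := by
          refine mul_le_mul_right (lintegral_mono_ae ?_) _
          filter_upwards [IsRadialWeight.radialMeasure_ae ω] with r hr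
          have htr : t * r ≤ t := mul_le_of_le_one_right ht0 hr.2.le
          have h1tr : 0 < 1 - t * r := by linarith
          have h1 := hint (conj a) r hr.1.le (by rw [RCLike.norm_conj]; linarith)
          rw [RCLike.norm_conj] at h1
          refine h1.trans ?_
          rw [← ENNReal.ofReal_mul (by positivity)]
          refine ENNReal.ofReal_le_ofReal ?_
          rw [mul_assoc]
          refine mul_le_mul_of_nonneg_left ?_ hC₂.le
          have h3 : (1 - t * r) ^ (1 - P)
              = (1 - t * r) ^ ((s : ℝ) + 1 - P) * ((1 - t * r) ^ s)⁻¹ := by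
            rw [← Real.rpow_natCast, ← Real.rpow_neg h1tr.le, ← Real.rpow_add h1tr]
            congr 1; ring
          rw [h3]
          refine mul_le_mul_of_nonneg_right ?_ (by positivity)
          exact Real.rpow_le_rpow_of_nonpos h1t (by linarith) (by linarith)
      _ ≤ _ := by
          rw [lintegral_const_mul' _ _ ENNReal.ofReal_ne_top, ← mul_assoc C₂,
            ENNReal.ofReal_mul (p := D ^ p) (by positivity),
            ENNReal.ofReal_mul (p := C₂ * (1 - t) ^ ((s : ℝ) + 1 - P)) (by positivity)]
          exact mul_le_mul_right (mul_le_mul_right (hs t ⟨ht0, ha1⟩) _) _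
  rw [bergmanNorm_eq hp]
  refine (ENNReal.rpow_le_rpow hI (by positivity)).trans_eq ?_
  rw [ENNReal.ofReal_rpow_of_nonneg (by positivity) (by positivity)]
  congr 1
  -- The auxiliary exponent `β` cancels here: `D ^ p` carries `(1 - t)^{pβ}` and `P` contains `pβ`.
  have e1 : D ^ p * (C₂ * ((1 - t) ^ ((s : ℝ) + 1 - P) *
        (C * tailIntegral ω t * ((1 - t) ^ s)⁻¹)))
      = (C₁ * (tailIntegral ν t)⁻¹) ^ p * (C₂ * C) * (tailIntegral ω t * (1 - t)) *
        ((1 - t) ^ ((n + 1 : ℕ) : ℝ))⁻¹ ^ p := by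
    have e2 : (1 - t) ^ (β * p) * ((1 - t) ^ ((s : ℝ) + 1 - P) * ((1 - t) ^ s)⁻¹)
        = (1 - t) * ((1 - t) ^ ((n + 1 : ℕ) : ℝ))⁻¹ ^ p := by
      rw [← Real.rpow_natCast (1 - t) s, ← Real.rpow_neg h1t.le, ← Real.rpow_neg h1t.le,
        ← Real.rpow_mul h1t.le, ← Real.rpow_add h1t, ← Real.rpow_add h1t]
      conv_rhs => lhs; rw [← Real.rpow_one (1 - t)]
      rw [← Real.rpow_add h1t]
      congr 1
      rw [hP]; push_cast; ring
    rw [hD, Real.mul_rpow (by positivity) (by positivity), ← Real.rpow_mul h1t.le]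
    linear_combination ((C₁ * (tailIntegral ν t)⁻¹) ^ p * (C₂ * C) * tailIntegral ω t) * e2
  rw [e1, Real.mul_rpow (by positivity) (by positivity),
    Real.mul_rpow (by positivity) (by positivity), Real.mul_rpow (by positivity) (by positivity),
    ← Real.rpow_mul (by positivity), ← Real.rpow_mul (by positivity),
    mul_one_div_cancel hp.ne', Real.rpow_one, Real.rpow_one, Real.rpow_natCast, growthFactor]
  field_simp

/-- The necessity of the condition on the symbol. -/
theorem derivativeSup_add_le (hω : IsDoublingWeight ω) (hν : IsDoublingWeight ν)
    (hp : 0 < p) (hq : 0 < q) {s : ℕ} {C : ℝ} (hC : 1 ≤ C)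
    (hs : ∀ a ∈ Ico (0 : ℝ) 1, ∫⁻ r, ENNReal.ofReal (((1 - a * r) ^ s)⁻¹) ∂radialMeasure ω
      ≤ ENNReal.ofReal (C * tailIntegral ω a * ((1 - a) ^ s)⁻¹)) {n : ℕ}
    (hn : (s : ℝ) + 1 ≤ p * (n + 1)) :
    ∃ K : ℝ≥0, 0 < K ∧ ∀ f : ℂ → ℂ, DifferentiableOn ℂ f unitDisc →
      Integrable f (weightedArea ν) → ∀ B : ℝ≥0, HankelBoundedBy p q ω ν f B →
      derivativeSup p ω ν n f + ∑ j ∈ Finset.range n, ENNReal.ofReal ‖iteratedDeriv j f 0‖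
        ≤ K * B := by
  obtain ⟨K₁, hK₁, h1⟩ := hω.enorm_integral_mul_conj_le (p := p) hν hq
  obtain ⟨K₂, hK₂, h2⟩ := hω.bergmanNorm_kernelDeriv_le hν hp hC hs hn
  -- For `j < n` the kernel norm estimate may fail, but at `a = 0` only finiteness of the norms is
  -- needed; they do not depend on `f`.
  set M : ℕ → ℝ≥0 := fun j => (bergmanNorm p ω (kernelDeriv ν j 0)).toNNReal with hM
  have hMe : ∀ j, (M j : ℝ≥0∞) = bergmanNorm p ω (kernelDeriv ν j 0) := fun j =>
    ENNReal.coe_toNNReal (hω.mem_bergmanSpace_of_bounded p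
      (hν.kernelDeriv_mem_boundedAnalytic j (by simp))).2.2.ne
  refine ⟨(K₁ * K₂).toNNReal + K₁.toNNReal * ∑ j ∈ Finset.range n, M j,
    add_pos_of_pos_of_nonneg (by simp [hK₁, hK₂]) zero_le, fun f hf hfi B hB => ?_⟩
  have hder : ∀ j, ∀ a ∈ unitDisc, ‖iteratedDeriv j f a‖ₑ
      ≤ ENNReal.ofReal K₁ * B * bergmanNorm p ω (kernelDeriv ν j a) := by
    intro j a ha
    rw [← hν.integral_mul_conj_kernelDeriv hf hfi j ha]
    exact h1 f B hB _ (hν.kernelDeriv_mem_boundedAnalytic j ha)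
  have hsup : derivativeSup p ω ν n f ≤ ENNReal.ofReal (K₁ * K₂) * B := by
    rw [derivativeSup_eq]
    refine iSup₂_le fun a ha => ?_
    have ha1 : ‖a‖ < 1 := by simpa using ha
    have hΛ := growthFactor_pos (p := p) hω.toIsRadialWeight hν.toIsRadialWeight n (r := ‖a‖)
      ⟨norm_nonneg a, ha1⟩
    rw [ENNReal.ofReal_div_of_pos hΛ, ofReal_norm]
    refine ENNReal.div_le_of_le_mul ?_
    refine (hder n a ha).trans ((mul_le_mul_right (h2 a ha) _).trans_eq ?_)
    rw [ENNReal.ofReal_mul hK₂.le, ENNReal.ofReal_mul hK₁.le]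
    ring
  have hsum : ∑ j ∈ Finset.range n, ENNReal.ofReal ‖iteratedDeriv j f 0‖
      ≤ ENNReal.ofReal K₁ * (∑ j ∈ Finset.range n, (M j : ℝ≥0∞)) * B := by
    rw [Finset.mul_sum, Finset.sum_mul]
    refine Finset.sum_le_sum fun j _ => ?_
    rw [ofReal_norm, hMe]
    exact (hder j 0 (by simp)).trans_eq (by ring)
  refine (add_le_add hsup hsum).trans_eq ?_
  push_cast
  rw [add_mul]
  rfl

end IsDoublingWeight

theorem norm_iteratedDeriv_le_of_derivativeSup_lt_top {p : ℝ} {ω ν : ℂ → ℝ}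
    (hω : IsRadialWeight ω) (hν : IsRadialWeight ν) {n : ℕ} {f : ℂ → ℂ}
    (h : derivativeSup p ω ν n f < ⊤) {z : ℂ} (hz : z ∈ unitDisc) :
    ‖iteratedDeriv n f z‖ ≤ (derivativeSup p ω ν n f).toReal * growthFactor p ω ν n ‖z‖ := by
  have hz1 : ‖z‖ < 1 := by simpa using hz
  have hΛ := growthFactor_pos (p := p) hω hν n (r := ‖z‖) ⟨norm_nonneg z, hz1⟩
  rw [← div_le_iff₀ hΛ]
  have h1 : ENNReal.ofReal (‖iteratedDeriv n f z‖ / growthFactor p ω ν n ‖z‖)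
      ≤ derivativeSup p ω ν n f := by
    rw [derivativeSup_eq]
    exact le_iSup₂ (f := fun z (_ : z ∈ unitDisc) =>
      ENNReal.ofReal (‖iteratedDeriv n f z‖ / growthFactor p ω ν n ‖z‖)) z hz
  exact (ENNReal.ofReal_le_iff_le_toReal h.ne).1 h1

/-- The symbol condition bounds the Hankel operator. -/
theorem IsDoublingWeight.hankelBoundedBy_of_derivativeSup {p q : ℝ} {ω ν : ℂ → ℝ}
    (hω : IsDoublingWeight ω) (hν : IsDoublingWeight ν)
    (hp : 0 < p) (hp1 : p ≤ 1) (hq0 : 0 < q) (hq1 : q < 1) {s : ℕ}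
    {C : ℝ} (hC : 1 ≤ C) (hs : ∀ x a, 0 ≤ x → x ≤ a → a < 1 →
      tailIntegral ω x ≤ C * ((1 - x) / (1 - a)) ^ s * tailIntegral ω a) {n : ℕ} (hn0 : n ≠ 0)
    (hn : (s : ℝ) + 1 ≤ p * (n + 1)) :
    ∃ K : ℝ≥0, 0 < K ∧ ∀ f : ℂ → ℂ, DifferentiableOn ℂ f unitDisc →
      Integrable f (weightedArea ν) → derivativeSup p ω ν n f < ⊤ →
      ∃ B : ℝ≥0, HankelBoundedBy p q ω ν f B ∧ (B : ℝ≥0∞) = K * (derivativeSup p ω ν n f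
        + ∑ j ∈ Finset.range n, ENNReal.ofReal ‖iteratedDeriv j f 0‖) := by
  -- At least one average is required, since it is the average that is bounded pointwise by a tail.
  obtain ⟨m, rfl⟩ := Nat.exists_eq_succ_of_ne_zero hn0
  obtain ⟨K, hK, h⟩ := exists_hankelBoundedBy hω hν hp hp1 hq0 hq1 hC hs hn
  refine ⟨K.toNNReal, by simpa using hK, fun f hf hfi hfin => ?_⟩
  set X := derivativeSup p ω ν (m + 1) f
    + ∑ j ∈ Finset.range (m + 1), ENNReal.ofReal ‖iteratedDeriv j f 0‖ with hX
  have hsumfin : ∑ j ∈ Finset.range (m + 1), ENNReal.ofReal ‖iteratedDeriv j f 0‖ ≠ ⊤ :=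
    ENNReal.sum_ne_top.2 fun j _ => ENNReal.ofReal_ne_top
  have hXfin : X ≠ ⊤ := ENNReal.add_ne_top.2 ⟨hfin.ne, hsumfin⟩
  refine ⟨_, h f hf hfi X.toReal ENNReal.toReal_nonneg (fun z hz => ?_) (fun j hj => ?_), ?_⟩
  · refine (norm_iteratedDeriv_le_of_derivativeSup_lt_top hω.toIsRadialWeight hν.toIsRadialWeight
      hfin hz).trans ?_
    have hz1 : ‖z‖ < 1 := by simpa using hz
    refine mul_le_mul_of_nonneg_right ?_ (growthFactor_pos hω.toIsRadialWeight
      hν.toIsRadialWeight _ ⟨norm_nonneg z, hz1⟩).le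
    exact ENNReal.toReal_mono hXfin le_self_add
  · refine (ENNReal.ofReal_le_iff_le_toReal hXfin).1 ?_
    refine le_trans ?_ (le_add_self : _ ≤ X)
    exact Finset.single_le_sum (f := fun j => ENNReal.ofReal ‖iteratedDeriv j f 0‖)
      (fun _ _ => zero_le) (Finset.mem_range.2 hj)
  · change ENNReal.ofReal (K * X.toReal) = ENNReal.ofReal K * X
    rw [ENNReal.ofReal_mul hK.le, ENNReal.ofReal_toReal hXfin]

end

/-! ### The theorem. -/

theorem theorem7 (p q : ℝ) (hp0 : 0 < p) (hp1 : p ≤ 1) (hq0 : 0 < q) (hq1 : q < 1)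
    (ω ν : ℂ → ℝ) (hω : IsDoublingWeight ω) (hν : IsDoublingWeight ν) :
    ∃ N : ℕ,
      (∀ f ∈ bergmanSpace 1 (logWeight ν),
        (HankelBounded p q ω ν f ↔ ∃ n : ℕ, N ≤ n ∧ derivativeSup p ω ν n f < ⊤) ∧
        (HankelBounded p q ω ν f ↔ ∀ n : ℕ, N ≤ n → derivativeSup p ω ν n f < ⊤)) ∧
      ∀ n : ℕ, N ≤ n → ∃ c C : ℝ≥0, 0 < c ∧ 0 < C ∧
        ∀ f ∈ bergmanSpace 1 (logWeight ν),
          (c : ℝ≥0∞) * (derivativeSup p ω ν n f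
              + ∑ j ∈ Finset.range n, ENNReal.ofReal ‖iteratedDeriv j f 0‖)
            ≤ hankelNorm p q ω ν f ∧
          hankelNorm p q ω ν f ≤
            (C : ℝ≥0∞) * (derivativeSup p ω ν n f
              + ∑ j ∈ Finset.range n, ENNReal.ofReal ‖iteratedDeriv j f 0‖) := by
  obtain ⟨s, C₀, hs1, hC₀, htail, hmom⟩ := hω.exists_exponent
  -- Any such `N` gives `p (n + 1) ≥ s + 1` for `n ≥ N`, and it is positive.
  obtain ⟨N, hN⟩ := exists_nat_ge (((s : ℝ) + 1) / p)
  rw [div_le_iff₀ hp0] at hN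
  have hn : ∀ n : ℕ, N ≤ n → (s : ℝ) + 1 ≤ p * (n + 1) := by
    intro n hNn
    have h1 : (N : ℝ) ≤ n := by exact_mod_cast hNn
    nlinarith
  have hn0 : ∀ n : ℕ, N ≤ n → n ≠ 0 := by
    rintro n hNn rfl
    have h1 : N = 0 := by omega
    rw [h1, Nat.cast_zero, zero_mul] at hN
    linarith
  have hR := hν.toIsRadialWeight
  have hequiv : ∀ f ∈ bergmanSpace 1 (logWeight ν), ∀ n : ℕ, N ≤ n →
      (HankelBounded p q ω ν f ↔ derivativeSup p ω ν n f < ⊤) := by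
    intro f hf n hNn
    constructor
    · rintro ⟨B, hB⟩
      obtain ⟨K, hK, h⟩ := hω.derivativeSup_add_le hν hp0 hq0 hC₀ hmom (hn n hNn)
      have h1 := h f hf.1 (integrable_of_mem_logWeight hR hf) B hB
      exact (le_self_add.trans h1).trans_lt (ENNReal.mul_lt_top ENNReal.coe_lt_top
        ENNReal.coe_lt_top)
    · intro hfin
      obtain ⟨K, hK, h⟩ := hω.hankelBoundedBy_of_derivativeSup hν hp0 hp1 hq0 hq1 hC₀ htail
        (hn0 n hNn) (hn n hNn)
      obtain ⟨B, hB, -⟩ := h f hf.1 (integrable_of_mem_logWeight hR hf) hfin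
      exact ⟨B, hB⟩
  refine ⟨N, fun f hf => ⟨⟨fun h => ⟨N, le_rfl, (hequiv f hf N le_rfl).1 h⟩, ?_⟩,
    fun h n hNn => (hequiv f hf n hNn).1 h, fun h => (hequiv f hf N le_rfl).2 (h N le_rfl)⟩,
    fun n hNn => ?_⟩
  · rintro ⟨n, hNn, h⟩
    exact (hequiv f hf n hNn).2 h
  · obtain ⟨K₁, hK₁, h1⟩ := hω.derivativeSup_add_le hν hp0 hq0 hC₀ hmom (hn n hNn)
    obtain ⟨K₂, hK₂, h2⟩ := hω.hankelBoundedBy_of_derivativeSup hν hp0 hp1 hq0 hq1 hC₀ htail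
      (hn0 n hNn) (hn n hNn)
    refine ⟨K₁⁻¹, K₂, inv_pos.2 hK₁, hK₂, fun f hf => ⟨?_, ?_⟩⟩
    · refine le_iInf₂ fun B hB => ?_
      have h3 := h1 f hf.1 (integrable_of_mem_logWeight hR hf) B hB
      refine (mul_le_mul_right h3 _).trans_eq ?_
      rw [← ENNReal.coe_mul, ← ENNReal.coe_mul, inv_mul_cancel_left₀ hK₁.ne']
    · rcases lt_or_ge (derivativeSup p ω ν n f) ⊤ with hfin | hfin
      · obtain ⟨B, hB, hBeq⟩ := h2 f hf.1 (integrable_of_mem_logWeight hR hf) hfin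
        rw [← hBeq]
        exact iInf₂_le B hB
      · rw [top_le_iff.1 hfin, top_add, ENNReal.mul_top (by simpa using hK₂.ne')]
        exact le_top
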